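/- **Setting.** Base stations form a point process $\Phi$ (a random locally finite set of points) in $\mathbb R^2$ of intensity $\lambda\in(0,\infty)$. The path loss is $\ell(x)=(1+\|x\|^\alpha)^{-1}$ or $\ell(x)=\|x\|^{-\alpha}$ with $\alpha>2$, the noise power is $W\ge 0$, and the fading variables $h_x\ge 0$ are i.i.d. with distribution function $F_h$ and independent of $\Phi$. The user at the origin $o$ is served by its nearest station $u$ (ties are broken uniformly at random), so that $$\mathrm{SINR}=\frac{h_u\ell(u)}{W+\sum_{x\in\Phi\setminus\{u\}}h_x\ell(x)},\qquad P_{\rm c}(\theta)=\mathbb P(\mathrm{SINR}>\theta).$$ $P_{\rm c}^{\rm PPP}$ is the same function for the Poisson point process (PPP) of intensity $\lambda$, with the same $\ell$, fading and $W$. The asymptotic deployment gain of $\Phi$ is $$\hat G=\lim_{p\uparrow1}\frac{P_{\rm c}^{-1}(p)}{(P_{\rm c}^{\rm PPP})^{-1}(p)},\qquad P_{\rm c}^{-1}(p)=\sup\{\theta>0: P_{\rm c}(\theta)\ge p\}.$$ Let $b(o,r)$ be the open disk of radius $r$ about $o$, $\xi$ the distance from $o$ to the nearest point of $\Phi$,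 with density $f_\xi$, $\Phi^\zeta$ the process $\Phi$ conditioned on $\zeta\in\Phi$ (Palm version), and $\Phi^\zeta_o$ the process $\Phi$ conditioned on its point nearest to $o$ being $\zeta$, i.e. $\Phi^\zeta$ conditioned on $\Phi^\zeta(b(o,\|\zeta\|))=0$. Put $I_o^\zeta=\sum_{x\in\Phi^\zeta_o\setminus\{\zeta\}}h_x\ell(x)$ and $\hat I^\zeta=\sum_{x\in\Phi^\zeta\setminus(\{\zeta\}\cup b(o,\|\zeta\|/2))}h_x\ell(x)$. **Assumptions.** $\Phi$ is motion-invariant (stationary and isotropic) and mixing, and 1. for every $n\ge2$ the $n$-th order factorial moment measure of $\Phi$ has a bounded density with respect to Lebesgue measure; 2. for every $y>0$ there is $\zeta$ with $\|\zeta\|=y$ and $\mathbb P(\Phi^\zeta(b(o,y))=0)\ne0$; 3. there is $y_0>0$ such that $\mathbb P(I_o^\zeta>z)\le\mathbb P(\hat I^\zeta>z)$ for all $\zeta$ with $\|\zeta\|>y_0$ and all $z\ge0$; 4. $\mathbb E(\xi^n)<\infty$ for all $n\in\mathbb N$. The fading satisfies $F_h(t)\sim a t^m$ as $t\downarrow0$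 for some $a,m\in(0,\infty)$, and $\mathbb E(h^n)<\infty$ for all $n\in\mathbb N$. **Claim.** Let $$\kappa=\int_0^\infty\mathbb E\big[a\,\ell(y)^{-m}(I_o^\zeta+W)^m\big]f_\xi(y)\,dy,\qquad \zeta=(y,0),$$ and let $\kappa^{\rm PPP}$ be the value of this expression for the PPP of intensity $\lambda$. Then $0<\kappa<\infty$, $0<\kappa^{\rm PPP}<\infty$, the asymptotic deployment gain of $\Phi$ exists, and $$\hat G=\Big(\frac{\kappa^{\rm PPP}}{\kappa}\Big)^{1/m}.$$ Moreover, with $I_r=\sum_{x\in\Phi^{\rm PPP}\setminus b(o,r)}h_x\ell(x)$, where $\Phi^{\rm PPP}$ is the PPP of intensity $\lambda$, $$\kappa^{\rm PPP}=2\lambda\pi\int_0^\infty\mathbb E\big[a\,\ell(r)^{-m}(I_r+W)^m\big]\,r\,e^{-\lambda\pi r^2}\,dr .$$ Nakagami-$m$ fading, $h\sim\mathrm{gamma}(m,1/m)$ with $m>0$, satisfies the assumptions on the fading with $a=m^{m-1}/\Gamma(m)$, so that in this case $$\kappa^{\rm PPP}=2\lambda\pi\int_0^\infty\mathbb E\Big[\frac{m^{m-1}}{\Gamma(m)}\,\ell(r)^{-m}(I_r+W)^m\Big]\,r\,e^{-\lambda\pi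 r^2}\,dr .$$ -/

import Mathlib

open MeasureTheory ProbabilityTheory Filter Topology Set
open scoped ENNReal NNReal

noncomputable section

namespace CellularNetwork

/-- The Euclidean plane. -/
abbrev Plane : Type := EuclideanSpace ℝ (Fin 2)

/-! ### Point patterns and point processes -/

/-- A point pattern: a locally finite set of points of the plane. -/
@[ext]
structure Config : Type where
  carrier : Set Plane
  locallyFinite : ∀ K : Set Plane, IsCompact K → (carrier ∩ K).Finite

/-- The number of points of `φ` in `B`. -/
def Config.count (φ : Config) (B : Set Plane) : ℝ≥0∞ := ((φ.carrier ∩ B).encard : ℝ≥0∞)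

/-- The usual sigma-algebra on point patterns, generated by the counts of Borel sets.
The distribution of a point process is a probability measure on `Config`. -/
instance : MeasurableSpace Config :=
  ⨆ B : {B : Set Plane // MeasurableSet B},
    MeasurableSpace.comap (fun φ : Config => φ.count B.1) inferInstance

/-- The image of a point pattern under an isometry of the plane. -/
def Config.image (e : Plane ≃ᵢ Plane) (φ : Config) : Config where
  carrier := e '' φ.carrier
  locallyFinite := by
    intro K hK
    have hK' : IsCompact (e ⁻¹' K) := e.toHomeomorph.isCompact_preimage.2 hK
    refine ((φ.locallyFinite _ hK').image e).subset ?_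
    rintro _ ⟨⟨x, hx, rfl⟩, hxK⟩
    exact ⟨x, ⟨hx, hxK⟩, rfl⟩

/-- The translate `φ + v`. -/
def Config.translate (v : Plane) (φ : Config) : Config :=
  φ.image (IsometryEquiv.addRight v)

/-- The process with distribution `P` has intensity `lam`. -/
def HasIntensity (P : Measure Config) (lam : ℝ) : Prop :=
  ∀ B : Set Plane, MeasurableSet B → ∫⁻ φ, φ.count B ∂P = ENNReal.ofReal lam * volume B

/-- Motion-invariance: invariance in law under translations and under rotations about the
origin. -/
structure MotionInvariant (P : Measure Config) : Prop where
  stationary : ∀ v : Plane, MeasurePreserving (Config.translate v) P P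
  isotropic : ∀ R : Plane ≃ₗᵢ[ℝ] Plane,
    LinearMap.det (R.toLinearEquiv : Plane →ₗ[ℝ] Plane) = 1 →
      MeasurePreserving (Config.image R.toIsometryEquiv) P P

/-- Mixing: events become independent as one of them is translated to infinity. -/
def Mixing (P : Measure Config) : Prop :=
  ∀ A B : Set Config, MeasurableSet A → MeasurableSet B →
    Tendsto (fun v : Plane => P (A ∩ Config.translate v ⁻¹' B)) (cocompact Plane)
      (𝓝 (P A * P B))

/-- The `n`-th factorial moment measure: the expected number of `n`-tuples of distinct points
of the process that lie in `B`. -/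
def factorialMoment (P : Measure Config) (n : ℕ) (B : Set (Fin n → Plane)) : ℝ≥0∞ :=
  ∫⁻ φ, (({x : Fin n → Plane |
    Function.Injective x ∧ (∀ i, x i ∈ φ.carrier) ∧ x ∈ B}.encard : ℕ∞) : ℝ≥0∞) ∂P

/-- `ρ` is an `n`-th moment density: a density of the `n`-th factorial moment measure with
respect to Lebesgue measure. -/
def IsMomentDensity (P : Measure Config) (n : ℕ) (ρ : (Fin n → Plane) → ℝ≥0∞) : Prop :=
  Measurable ρ ∧
    ∀ B : Set (Fin n → Plane), MeasurableSet B → factorialMoment P n B = ∫⁻ x in B, ρ x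

/-- The unit square `[0,1)²`. -/
def unitSquare : Set Plane := {x | ∀ i, x i ∈ Ico (0 : ℝ) 1}

/-- The Palm expectation `E[F(Φ^ζ)]`, where `Φ^ζ = (Φ ∣ ζ ∈ Φ)`, of a stationary process of
intensity `lam`: `lam⁻¹ E ∑_{x ∈ Φ ∩ [0,1)²} F(Φ - x + ζ)`. -/
def palmExp (P : Measure Config) (lam : ℝ) (ζ : Plane) (F : Config → ℝ≥0∞) : ℝ≥0∞ :=
  (∫⁻ φ, ∑' x : ↥(φ.carrier ∩ unitSquare), F (φ.translate (ζ - (x : Plane))) ∂P)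
    / ENNReal.ofReal lam

/-- The patterns without points in the open disk `b(o, r)`. -/
def emptyDisk (r : ℝ) : Set Config := {φ | φ.carrier ∩ Metric.ball 0 r = ∅}

/-- The expectation `E[F(Φ_o^ζ)]`, where `Φ_o^ζ = (Φ ∣ NP_Φ(o) = ζ)` is the process conditioned
on its point nearest to the origin being `ζ`, that is, `Φ^ζ` conditioned on having no points in
`b(o, ‖ζ‖)`. -/
def nearestExp (P : Measure Config) (lam : ℝ) (ζ : Plane) (F : Config → ℝ≥0∞) : ℝ≥0∞ :=
  palmExp P lam ζ ((emptyDisk ‖ζ‖).indicator F)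
    / palmExp P lam ζ ((emptyDisk ‖ζ‖).indicator fun _ => 1)

/-- `P` is the law of the Poisson point process of intensity `lam`: the counts of disjoint
bounded Borel sets are independent and Poisson distributed with means `lam` times the area. -/
def IsPoissonProcess (P : Measure Config) (lam : ℝ) : Prop :=
  ∀ (n : ℕ) (B : Fin n → Set Plane), (∀ i, MeasurableSet (B i)) →
    (∀ i, Bornology.IsBounded (B i)) → Pairwise (Function.onFun Disjoint B) →
    ∀ k : Fin n → ℕ,
      P {φ | ∀ i, φ.count (B i) = k i} =
        ∏ i, ENNReal.ofReal (Real.exp (-(lam * volume.real (B i))) *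
          (lam * volume.real (B i)) ^ k i / (k i).factorial)

/-! ### Path loss, fading, interference and SINR -/

/-- The non-singular path loss `(1 + ‖x‖^α)⁻¹`. -/
def pathLossNonsingular (α : ℝ) (x : Plane) : ℝ≥0∞ := (1 + ‖x‖ₑ ^ α)⁻¹

/-- The singular path loss `‖x‖^(-α)` (infinite at the origin). -/
def pathLossSingular (α : ℝ) (x : Plane) : ℝ≥0∞ := ‖x‖ₑ ^ (-α)

/-- The law of a family `(h_x)` of i.i.d. fading variables with law `μ`, one for each possible
base station location `x`. -/
def fadingLaw (μ : Measure ℝ) : Measure (Plane → ℝ) := Measure.infinitePi fun _ => μ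

/-- The interference `∑_{x ∈ s} h_x ℓ(x)` at the origin from the stations in `s`. -/
def interference (ℓ : Plane → ℝ≥0∞) (s : Set Plane) (h : Plane → ℝ) : ℝ≥0∞ :=
  ∑' x : s, ENNReal.ofReal (h x) * ℓ x

/-- The SINR at the origin if it is served by the station `u` of `φ`. -/
def sinr (ℓ : Plane → ℝ≥0∞) (W : ℝ) (φ : Config) (u : Plane) (h : Plane → ℝ) : ℝ≥0∞ :=
  ENNReal.ofReal (h u) * ℓ u / (ENNReal.ofReal W + interference ℓ (φ.carrier \ {u}) h)

/-- The points of `φ` that are nearest to the origin. -/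
def Config.nearest (φ : Config) : Set Plane :=
  {u | u ∈ φ.carrier ∧ ∀ v ∈ φ.carrier, ‖u‖ ≤ ‖v‖}

/-- The success probability `P_c(θ) = ℙ(SINR > θ)` at the origin. Given the point pattern, the
serving station is a uniformly random one among the nearest points. -/
def successProb (ℓ : Plane → ℝ≥0∞) (μ : Measure ℝ) (W : ℝ) (P : Measure Config) (θ : ℝ) : ℝ :=
  (∫⁻ φ, (∑' u : φ.nearest, fadingLaw μ {h | ENNReal.ofReal θ < sinr ℓ W φ u h})
    / ((φ.nearest.encard : ℕ∞) : ℝ≥0∞) ∂P).toReal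

/-- The (generalized) inverse `P_c⁻¹(p)` of the non-increasing success probability curve. -/
def successInv (ℓ : Plane → ℝ≥0∞) (μ : Measure ℝ) (W : ℝ) (P : Measure Config) (p : ℝ) : ℝ :=
  sSup {θ : ℝ | 0 < θ ∧ p ≤ successProb ℓ μ W P θ}

/-- The deployment gain `G(p)` of the process with law `P` relative to the one with law `Q`. -/
def deploymentGain (ℓ : Plane → ℝ≥0∞) (μ : Measure ℝ) (W : ℝ) (P Q : Measure Config)
    (p : ℝ) : ℝ :=
  successInv ℓ μ W P p / successInv ℓ μ W Q p

/-- The asymptotic deployment gain exists and equals `G`. -/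
def HasADG (ℓ : Plane → ℝ≥0∞) (μ : Measure ℝ) (W : ℝ) (P Q : Measure Config) (G : ℝ) : Prop :=
  Tendsto (deploymentGain ℓ μ W P Q) (𝓝[<] 1) (𝓝 G)

/-- The fading variable is nonnegative, its distribution function satisfies `F_h(t) ∼ a t^m` as
`t → 0`, and all its moments are finite. -/
structure FadingCondition (μ : Measure ℝ) (m a : ℝ) : Prop where
  nonneg : ∀ᵐ t ∂μ, 0 ≤ t
  m_pos : 0 < m
  a_pos : 0 < a
  near_zero : Asymptotics.IsEquivalent (𝓝[>] (0 : ℝ)) (fun t => cdf μ t) (fun t => a * t ^ m)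
  moments : ∀ n : ℕ, Integrable (fun t : ℝ => t ^ n) μ

/-! ### The class `𝒜` and the constant `κ` -/

/-- The class `𝒜` of motion-invariant mixing point process laws `P`, here of intensity `lam`,
for the path loss `ℓ` and the fading law `μ`. -/
structure ClassA (ℓ : Plane → ℝ≥0∞) (μ : Measure ℝ) (lam : ℝ) (P : Measure Config) : Prop where
  intensity : HasIntensity P lam
  motionInvariant : MotionInvariant P
  mixing : Mixing P
  /-- All moment densities of order at least two are bounded. -/
  boundedDensities : ∀ n : ℕ, 2 ≤ n → ∃ ρ : (Fin n → Plane) → ℝ≥0∞,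
    IsMomentDensity P n ρ ∧ ∃ q : ℝ≥0∞, q < ∞ ∧ ∀ x, ρ x < q
  /-- `ℙ(Φ^ζ(b(o,y)) = 0) ≠ 0`. -/
  emptySpace : ∀ y : ℝ, 0 < y → ∃ ζ : Plane, ‖ζ‖ = y ∧
    palmExp P lam ζ ((emptyDisk y).indicator fun _ => 1) ≠ 0
  /-- The interference from `Φ^ζ \ {ζ}` outside `b(o,‖ζ‖/2)` stochastically dominates the
  interference from `Φ_o^ζ \ {ζ}` if `‖ζ‖` is large. -/
  dominance : ∃ y₀ : ℝ, 0 < y₀ ∧ ∀ ζ : Plane, y₀ < ‖ζ‖ → ∀ z : ℝ≥0,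
    nearestExp P lam ζ (fun φ =>
        fadingLaw μ {h | (z : ℝ≥0∞) < interference ℓ (φ.carrier \ {ζ}) h}) ≤
      palmExp P lam ζ (fun φ =>
        fadingLaw μ {h | (z : ℝ≥0∞) <
          interference ℓ ((φ.carrier ∩ (Metric.ball 0 (‖ζ‖ / 2))ᶜ) \ {ζ}) h})
  /-- All moments of the contact distance are finite. -/
  contactMoments : ∀ n : ℕ, ∫⁻ φ, Metric.infEDist 0 φ.carrier ^ n ∂P < ∞

/-- The probability density function `f_ξ` of the contact distance. -/
def contactPDF (P : Measure Config) : ℝ → ℝ≥0∞ :=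
  pdf (fun φ : Config => Metric.infDist 0 φ.carrier) P volume

/-- `κ = ∫_0^∞ E[a ℓ(y)^(-m) (I(Φ_o^ζ) + W)^m] f_ξ(y) dy` with `ζ = (y, 0)`, where `I(Φ_o^ζ)` is
the interference from `Φ_o^ζ \ {ζ}`. -/
def kappa (ℓ : Plane → ℝ≥0∞) (μ : Measure ℝ) (W m a lam : ℝ) (P : Measure Config) : ℝ≥0∞ :=
  ∫⁻ y in Ioi (0 : ℝ),
    nearestExp P lam !₂[y, 0] (fun φ => ∫⁻ h,
      ENNReal.ofReal a * ℓ !₂[y, 0] ^ (-m) *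
        (interference ℓ (φ.carrier \ {!₂[y, 0]}) h + ENNReal.ofReal W) ^ m ∂(fadingLaw μ))
      * contactPDF P y

/-- `2 λ π ∫_0^∞ E[a ℓ(r)^(-m) (I_r + W)^m] r exp(-λ π r²) dr`, where
`I_r = ∑_{x ∈ Φ ∩ b(o,r)ᶜ} h_x ℓ(x)` and `Φ` has law `Q`. -/
def kappaPoissonIntegral (ℓ : Plane → ℝ≥0∞) (μ : Measure ℝ) (W m a lam : ℝ)
    (Q : Measure Config) : ℝ≥0∞ :=
  ENNReal.ofReal (2 * lam * Real.pi) *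
    ∫⁻ r in Ioi (0 : ℝ),
      (∫⁻ φ, ∫⁻ h, ENNReal.ofReal a * ℓ !₂[r, 0] ^ (-m) *
        (interference ℓ (φ.carrier ∩ (Metric.ball 0 r)ᶜ) h + ENNReal.ofReal W) ^ m
          ∂(fadingLaw μ) ∂Q)
        * ENNReal.ofReal (r * Real.exp (-(lam * Real.pi * r ^ 2)))

end CellularNetwork

end

/-!
# The asymptotic deployment gain of a cellular network

The asymptotic deployment gain is read off from the outage probability `1 - P_c(θ)` for small `θ`.
Almost surely the station nearest to the origin is unique. Given the point pattern, the interference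
`I` and the serving station `u`, the SINR is at most `θ` with probability
`F_h(θ (I + W) / ℓ(u))`, because the fading of `u` is independent of the interference
(`fadingLaw_sinr_le`). Multiplied by `θ^(-m)` this tends to the weight `a ℓ(u)^(-m) (I + W)^m`
(`outageWeight`), and it is at most a constant multiple of it. Hence `1 - P_c(θ) ∼ κ θ^m` by dominated
convergence (`tendsto_outageProb`), provided that `κ`, the expectation of the weight
(`kappa_eq_lintegral`), is finite. Inverting this asymptotic relation gives
`P_c⁻¹(p) ∼ ((1 - p) / κ)^(1/m)` as `p → 1` (`tendsto_sSup_div_rpow`), and the quotient of two such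
relations is the deployment gain (`hasADG`).

The definition of `κ` conditions on the location of the nearest point. Stationarity yields the
Campbell–Mecke formula (`lintegral_tsum_eq_palmExp`): the Campbell measure is invariant under
translations in its first component, hence a product with Lebesgue measure. Together with isotropy
and polar coordinates it identifies the density of the contact distance (`contactPDF_ae_eq`), and
shows that `κ` is an expectation over the original process
(`lintegral_nearestExp_mul_contactPDF`).

For the finiteness of `κ` (`kappa_lt_top`), bounded moment densities bound all moments of the shot
noise of the integrable function `(1 + ‖x‖)^(-α)` under the Palm version, uniformly in its base
point (`exists_palmExp_shot_pow_le`). If the nearest point `ζ` is close to the origin, then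
`ℓ(x) / ℓ(ζ)` is at most a multiple of that function for all further points `x`. If it is far away,
the assumed stochastic domination transfers the bound to the process conditioned on its nearest
point (`exists_nearestExp_interference_le`), and the moments of the contact distance integrate the
remaining factor `ℓ(ζ)^(-m)`. Positivity (`kappa_pos`) holds since `κ = 0` would leave room for only
one point, while the intensity is positive.

The Poisson process satisfies the same assumptions (`IsPoissonProcess.regularLaw`). The counts in
finitely many disjoint bounded sets determine a law (`ext_of_counts`); comparing them gives the
invariance under motions, the Mecke formula (`IsPoissonProcess.lintegral_tsum_erase`), and the
independence of the patterns inside and outside of a disk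
(`IsPoissonProcess.measure_emptyDisk_inter`). Slivnyak's theorem
(`IsPoissonProcess.palmExp_erase`) then makes the conditioned process explicit, which gives the
integral formula for its `κ` (`IsPoissonProcess.kappa_eq_kappaPoissonIntegral`).
-/

noncomputable section

namespace CellularNetwork

/-! ### Measurability of functionals of point patterns -/

lemma Config.countable (φ : Config) : φ.carrier.Countable := by
  have h : φ.carrier = ⋃ n : ℕ, φ.carrier ∩ Metric.closedBall 0 n := by
    rw [← inter_iUnion, Metric.iUnion_closedBall_nat, inter_univ]
  rw [h]
  exact countable_iUnion fun n => (φ.locallyFinite _ (isCompact_closedBall 0 (n : ℝ))).countable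

instance (φ : Config) : Countable φ.carrier := φ.countable.to_subtype

lemma Config.finite_inter (φ : Config) {B : Set Plane} (hB : Bornology.IsBounded B) :
    (φ.carrier ∩ B).Finite := by
  obtain ⟨r, hr⟩ := hB.subset_closedBall (0 : Plane)
  exact (φ.locallyFinite _ (isCompact_closedBall 0 r)).subset (inter_subset_inter_right _ hr)

lemma Config.count_eq_natCast (φ : Config) {B : Set Plane} (hB : Bornology.IsBounded B) :
    ∃ N : ℕ, φ.count B = N := by
  obtain ⟨N, hN⟩ := ENat.ne_top_iff_exists.1 (φ.finite_inter hB).encard_lt_top.ne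
  exact ⟨N, by rw [Config.count, ← hN]; rfl⟩

/-- The counting measure of a point pattern. -/
def Config.pointMeasure (φ : Config) : Measure Plane := .sum fun x : φ.carrier => .dirac x.1

lemma Config.lintegral_pointMeasure (φ : Config) (f : Plane → ℝ≥0∞) :
    ∫⁻ x, f x ∂φ.pointMeasure = ∑' x : φ.carrier, f x := by
  simp [Config.pointMeasure, lintegral_sum_measure]

lemma tsum_inter_eq_indicator (s B : Set Plane) (f : Plane → ℝ≥0∞) :
    ∑' x : ↥(s ∩ B), f x = ∑' x : s, B.indicator f x := by
  rw [tsum_subtype, tsum_subtype s, indicator_indicator]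

lemma Config.count_eq_tsum (φ : Config) (B : Set Plane) :
    φ.count B = ∑' x : φ.carrier, B.indicator (fun _ => (1 : ℝ≥0∞)) x := by
  rw [Config.count, ← ENNReal.tsum_set_one, ← tsum_inter_eq_indicator]

lemma Config.pointMeasure_apply (φ : Config) {B : Set Plane} (hB : MeasurableSet B) :
    φ.pointMeasure B = φ.count B := by
  rw [← lintegral_indicator_one hB, φ.lintegral_pointMeasure, φ.count_eq_tsum]
  rfl

lemma Config.count_eq_zero {φ : Config} {B : Set Plane} :
    φ.count B = 0 ↔ φ.carrier ∩ B = ∅ := by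
  simp [Config.count]

lemma measurable_count {B : Set Plane} (hB : MeasurableSet B) :
    Measurable fun φ : Config => φ.count B :=
  measurable_iff_comap_le.2
    (le_iSup (fun B : {B : Set Plane // MeasurableSet B} =>
      MeasurableSpace.comap (fun φ : Config => φ.count B.1) inferInstance) ⟨B, hB⟩)

lemma measurable_config_iff {β : Type*} [MeasurableSpace β] {Φ : β → Config} :
    Measurable Φ ↔ ∀ B, MeasurableSet B → Measurable fun b => (Φ b).count B := by
  refine ⟨fun h B hB => (measurable_count hB).comp h, fun h => ?_⟩
  rw [measurable_iff_comap_le]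
  change MeasurableSpace.comap Φ (⨆ B : {B : Set Plane // MeasurableSet B},
    MeasurableSpace.comap (fun φ : Config => φ.count B.1) inferInstance) ≤ _
  rw [MeasurableSpace.comap_iSup]
  refine iSup_le fun B => ?_
  rw [MeasurableSpace.comap_comp]
  exact measurable_iff_comap_le.1 (h B.1 B.2)

/-- The counting measure as a kernel from point patterns to the plane. -/
def pointKernel : Kernel Config Plane where
  toFun φ := φ.pointMeasure
  measurable' := Measure.measurable_of_measurable_coe _ fun B hB => by
    simpa only [Config.pointMeasure_apply _ hB] using measurable_count hB

lemma pointKernel_apply (φ : Config) : pointKernel φ = φ.pointMeasure := rfl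

/-- The annulus of points whose norm has integer part `n`. -/
def annulus (n : ℕ) : Set Plane := {x | ⌊‖x‖⌋₊ = n}

lemma measurableSet_annulus (n : ℕ) : MeasurableSet (annulus n) :=
  (Nat.measurable_floor.comp measurable_norm) (measurableSet_singleton n)

lemma isBounded_annulus (n : ℕ) : Bornology.IsBounded (annulus n) :=
  (Metric.isBounded_closedBall (x := (0 : Plane)) (r := (n : ℝ) + 1)).subset fun x hx => by
    have h : ⌊‖x‖⌋₊ = n := hx
    rw [mem_closedBall_zero_iff, ← h]
    exact (Nat.lt_floor_add_one _).le

instance : IsSFiniteKernel pointKernel := by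
  classical
  -- Cut the kernel according to the annulus of the point and the number of points in it.
  let κ : ℕ × ℕ → Kernel Config Plane := fun p =>
    Kernel.piecewise (s := {φ | φ.count (annulus p.1) = p.2})
      ((measurable_count (measurableSet_annulus p.1)) (measurableSet_singleton _))
      (pointKernel.restrict (measurableSet_annulus p.1)) 0
  have hfin : ∀ p, IsFiniteKernel (κ p) := fun p => by
    refine ⟨p.2, ENNReal.natCast_lt_top _, fun φ => ?_⟩
    simp only [κ, Kernel.piecewise_apply]
    split_ifs with h
    · rw [Kernel.restrict_apply, pointKernel_apply, Measure.restrict_apply_univ,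
        φ.pointMeasure_apply (measurableSet_annulus _)]
      exact le_of_eq h
    · simp
  have hsum : pointKernel = Kernel.sum κ := by
    ext φ B hB
    rw [Kernel.sum_apply' _ _ hB, ENNReal.summable.tsum_prod' fun _ => ENNReal.summable]
    have hpart : ∀ n : ℕ, ∑' k : ℕ, κ (n, k) φ B = φ.pointMeasure (B ∩ annulus n) := fun n => by
      obtain ⟨N, hN⟩ : ∃ N : ℕ, φ.count (annulus n) = N := φ.count_eq_natCast (isBounded_annulus n)
      rw [tsum_eq_single N]
      · simp only [κ, Kernel.piecewise_apply]
        rw [if_pos (by exact hN), Kernel.restrict_apply, pointKernel_apply,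
          Measure.restrict_apply hB]
      · intro k hk
        simp only [κ, Kernel.piecewise_apply]
        rw [if_neg]
        · simp
        · simp only [mem_ofPred_eq, hN, Nat.cast_inj]
          exact fun h => hk h.symm
    simp_rw [hpart]
    rw [← measure_iUnion]
    · rw [pointKernel_apply, ← inter_iUnion]
      congr 1
      ext x
      simp [annulus]
    · intro i j hij
      refine Disjoint.mono inter_subset_right inter_subset_right ?_
      exact Set.disjoint_left.2 fun x hx hx' => hij (hx.symm.trans hx')
    · exact fun n => hB.inter (measurableSet_annulus n)
  rw [hsum]
  infer_instance

/-- Sums over the points of a measurably varying pattern are measurable. -/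
lemma measurable_tsum_points {β : Type*} [MeasurableSpace β] {Φ : β → Config}
    (hΦ : Measurable Φ) {f : β × Plane → ℝ≥0∞} (hf : Measurable f) :
    Measurable fun b => ∑' x : (Φ b).carrier, f (b, x) := by
  have h := hf.lintegral_kernel_prod_right' (κ := pointKernel.comap Φ hΦ)
  simpa only [Kernel.comap_apply, pointKernel_apply, Config.lintegral_pointMeasure] using h

/-! ### Transformations of point patterns -/

lemma tsum_image (e : Plane ≃ᵢ Plane) (φ : Config) (f : Plane → ℝ≥0∞) :
    ∑' x : (φ.image e).carrier, f x = ∑' x : φ.carrier, f (e x) :=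
  _root_.tsum_image (f := f) e.injective.injOn

lemma tsum_translate (v : Plane) (φ : Config) (f : Plane → ℝ≥0∞) :
    ∑' x : (φ.translate v).carrier, f x = ∑' x : φ.carrier, f (x + v) :=
  tsum_image _ φ f

/-- The restriction of a point pattern to a set. -/
def Config.inter (φ : Config) (S : Set Plane) : Config where
  carrier := φ.carrier ∩ S
  locallyFinite K hK := (φ.locallyFinite K hK).subset (by gcongr; exact inter_subset_left)

/-- A point pattern with a point removed. -/
def Config.erase (φ : Config) (x : Plane) : Config := φ.inter {x}ᶜ

lemma tsum_inter (φ : Config) (S : Set Plane) (f : Plane → ℝ≥0∞) :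
    ∑' x : (φ.inter S).carrier, f x = ∑' x : φ.carrier, S.indicator f x :=
  tsum_inter_eq_indicator _ _ f

lemma Config.erase_carrier (φ : Config) (x : Plane) : (φ.erase x).carrier = φ.carrier \ {x} := rfl

lemma measurable_inter {β : Type*} [MeasurableSpace β] {Φ : β → Config} (hΦ : Measurable Φ)
    {S : β → Set Plane} (hS : MeasurableSet {p : β × Plane | p.2 ∈ S p.1}) :
    Measurable fun b => (Φ b).inter (S b) := by
  classical
  refine measurable_config_iff.2 fun B hB => ?_
  simp only [Config.count_eq_tsum, tsum_inter]
  have : ∀ (b : β) (x : Plane), (S b).indicator (B.indicator fun _ => (1 : ℝ≥0∞)) x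
      = ({p : β × Plane | p.2 ∈ S p.1} ∩ Prod.snd ⁻¹' B).indicator (fun _ => 1) (b, x) := by
    intro b x
    simp only [indicator, mem_inter_iff, mem_preimage, mem_ofPred_eq]
    split_ifs <;> simp_all
  simp only [this]
  exact measurable_tsum_points hΦ
    (measurable_const.indicator (hS.inter (measurable_snd hB)))

lemma measurable_erase : Measurable fun p : Config × Plane => p.1.erase p.2 := by
  refine measurable_inter measurable_fst (S := fun p : Config × Plane => {p.2}ᶜ) ?_
  have : {q : (Config × Plane) × Plane | q.2 ∈ ({q.1.2}ᶜ : Set Plane)} =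
      {q | q.2 = q.1.2}ᶜ := by ext; simp
  rw [this]
  exact (measurableSet_eq_fun (by fun_prop) (by fun_prop)).compl

lemma measurable_translate : Measurable fun p : Config × Plane => p.1.translate p.2 := by
  refine measurable_config_iff.2 fun B hB => ?_
  simp only [Config.count_eq_tsum, tsum_translate]
  exact measurable_tsum_points (f := fun q : (Config × Plane) × Plane =>
    B.indicator (fun _ => 1) (q.2 + q.1.2)) measurable_fst
    ((measurable_const.indicator hB).comp (by fun_prop))

lemma measurable_image (e : Plane ≃ᵢ Plane) : Measurable (Config.image e) := by
  refine measurable_config_iff.2 fun B hB => ?_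
  simp only [Config.count_eq_tsum, tsum_image]
  exact measurable_tsum_points (f := fun q : Config × Plane =>
    B.indicator (fun _ => 1) (e q.2)) measurable_id
    ((measurable_const.indicator hB).comp (e.continuous.measurable.comp measurable_snd))

lemma Config.mem_translate {φ : Config} {v x : Plane} :
    x ∈ (φ.translate v).carrier ↔ x - v ∈ φ.carrier := by
  change (∃ y, y ∈ φ.carrier ∧ y + v = x) ↔ _
  exact ⟨fun ⟨y, hy, h⟩ => by rw [← h]; simpa using hy, fun h => ⟨_, h, by simp⟩⟩

lemma Config.translate_translate (φ : Config) (v w : Plane) :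
    (φ.translate v).translate w = φ.translate (v + w) := by
  ext x
  simp only [Config.mem_translate, sub_sub, add_comm]

lemma Config.translate_zero (φ : Config) : φ.translate 0 = φ := by
  ext x
  simp [Config.translate, Config.image]

lemma Config.mem_image {φ : Config} {e : Plane ≃ᵢ Plane} {x : Plane} :
    x ∈ (φ.image e).carrier ↔ e.symm x ∈ φ.carrier := by
  simp only [Config.image, Set.mem_image]
  exact ⟨fun ⟨y, hy, h⟩ => by rw [← h]; simpa using hy, fun h => ⟨_, h, by simp⟩⟩

lemma measurableSet_emptyDisk' :
    MeasurableSet {p : Config × ℝ | p.1 ∈ emptyDisk p.2} := by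
  have : {p : Config × ℝ | p.1 ∈ emptyDisk p.2} =
      (fun p : Config × ℝ =>
        ∑' x : p.1.carrier, {q : (Config × ℝ) × Plane | ‖q.2‖ < q.1.2}.indicator
        (fun _ => (1 : ℝ≥0∞)) (p, x)) ⁻¹' {0} := by
    ext p
    have := Config.count_eq_zero (φ := p.1) (B := Metric.ball 0 p.2)
    rw [Config.count_eq_tsum] at this
    simp only [emptyDisk, mem_ofPred_eq, ← this, mem_preimage, mem_singleton_iff]
    have h2 : ∀ x : Plane, (Metric.ball (0 : Plane) p.2).indicator (fun _ => (1 : ℝ≥0∞)) x =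
        {q : (Config × ℝ) × Plane | ‖q.2‖ < q.1.2}.indicator (fun _ => (1 : ℝ≥0∞)) (p, x) := by
      intro x
      simp [indicator]
    simp only [h2]
  rw [this]
  exact measurable_tsum_points measurable_fst (measurable_const.indicator
    (measurableSet_lt (by fun_prop) (by fun_prop))) (measurableSet_singleton 0)

lemma measurableSet_emptyDisk (r : ℝ) : MeasurableSet (emptyDisk r) :=
  (measurable_id.prodMk measurable_const) measurableSet_emptyDisk'

/-! ### Shot noise with independent fading -/

/-- The shot noise `∑_{x ∈ φ} h_x g(x)`: the interference with a general weight `g`. -/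
def shot (φ : Config) (g : Plane → ℝ≥0∞) (h : Plane → ℝ) : ℝ≥0∞ :=
  ∑' x : φ.carrier, ENNReal.ofReal (h x) * g x

lemma interference_inter (ℓ : Plane → ℝ≥0∞) (φ : Config) (S : Set Plane) (h : Plane → ℝ) :
    interference ℓ (φ.carrier ∩ S) h = shot φ (S.indicator ℓ) h := by
  rw [interference, shot, tsum_inter_eq_indicator φ.carrier S fun x => ENNReal.ofReal (h x) * ℓ x]
  exact tsum_congr fun x => indicator_mul_right S (fun x => ENNReal.ofReal (h x)) ℓ

lemma interference_diff (ℓ : Plane → ℝ≥0∞) (φ : Config) (S : Set Plane) (h : Plane → ℝ) :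
    interference ℓ (φ.carrier \ S) h = shot φ (Sᶜ.indicator ℓ) h := by
  rw [sdiff_eq, interference_inter]

lemma shot_inter (φ : Config) (S : Set Plane) (g : Plane → ℝ≥0∞) (h : Plane → ℝ) :
    shot (φ.inter S) g h = shot φ (S.indicator g) h := interference_inter g φ S h

lemma shot_mono (φ : Config) {g g' : Plane → ℝ≥0∞} (hg : ∀ x ∈ φ.carrier, g x ≤ g' x)
    (h : Plane → ℝ) : shot φ g h ≤ shot φ g' h :=
  ENNReal.tsum_le_tsum fun x => by gcongr; exact hg x x.2

lemma shot_const_mul (φ : Config) (c : ℝ≥0∞) (g : Plane → ℝ≥0∞) (h : Plane → ℝ) :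
    shot φ (fun x => c * g x) h = c * shot φ g h := by
  simp only [shot, ← ENNReal.tsum_mul_left]
  exact tsum_congr fun x => by ring

lemma measurable_shot (φ : Config) (g : Plane → ℝ≥0∞) : Measurable (shot φ g) :=
  Measurable.tsum fun x => by fun_prop

/-- A real label of the points of the plane, used to order the points of a pattern. -/
def label : Plane → ℝ := embeddingReal Plane

/-- The number of a point `x` within the pattern `φ`: the integer part of its norm, together with
the number of points of `φ` in the same annulus that have a smaller label. It depends measurably
on `φ` and `x` and separates the points of `φ`. -/
def Config.number (φ : Config) (x : Plane) : ℕ × ℕ :=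
  (⌊‖x‖⌋₊, ⌊(φ.count (annulus ⌊‖x‖⌋₊ ∩ {y | label y < label x})).toReal⌋₊)

lemma measurable_label : Measurable label := (measurableEmbedding_embeddingReal Plane).measurable

lemma Config.number_injOn (φ : Config) : InjOn φ.number φ.carrier := by
  -- Of two points in the same annulus, the one with the larger label has the larger number.
  have key : ∀ x ∈ φ.carrier, ∀ y ∈ φ.carrier, φ.number x = φ.number y →
      ¬ label x < label y := by
    intro x hx y hy hxy hlt
    simp only [Config.number, Prod.mk.injEq] at hxy
    obtain ⟨h1, h2⟩ := hxy
    rw [← h1] at h2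
    set A := annulus ⌊‖x‖⌋₊
    have hA : ∀ z, (φ.carrier ∩ (A ∩ {w | label w < label z})).Finite := fun z =>
      φ.finite_inter ((isBounded_annulus _).subset inter_subset_left)
    have hc : ∀ z, φ.count (A ∩ {w | label w < label z}) =
        ((φ.carrier ∩ (A ∩ {w | label w < label z})).ncard : ℝ≥0∞) := fun z => by
      rw [Config.count, ← (hA z).cast_ncard_eq]
      rfl
    simp only [hc, ENNReal.toReal_natCast, Nat.floor_natCast] at h2
    refine absurd h2 (ne_of_lt (ncard_lt_ncard ⟨?_, fun hsub => ?_⟩ (hA y)))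
    · exact inter_subset_inter_right _ (inter_subset_inter_right _ fun w hw => lt_trans hw hlt)
    · have h3 := (hsub (⟨hx, rfl, hlt⟩ :
        x ∈ φ.carrier ∩ (A ∩ {w | label w < label y}))).2.2
      exact lt_irrefl (label x) h3
  intro x hx y hy hxy
  refine (measurableEmbedding_embeddingReal Plane).injective (le_antisymm ?_ ?_)
  · exact not_lt.1 (key y hy x hx hxy.symm)
  · exact not_lt.1 (key x hx y hy hxy)

lemma measurable_number : Measurable fun p : Config × Plane => p.1.number p.2 := by
  refine Measurable.prodMk (Nat.measurable_floor.comp (by fun_prop))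
    (Nat.measurable_floor.comp (Measurable.ennreal_toReal ?_))
  simp only [Config.count_eq_tsum]
  have : ∀ (p : Config × Plane) (y : Plane),
      (annulus ⌊‖p.2‖⌋₊ ∩ {y | label y < label p.2}).indicator (fun _ => (1 : ℝ≥0∞)) y =
      {q : (Config × Plane) × Plane | ⌊‖q.2‖⌋₊ = ⌊‖q.1.2‖⌋₊ ∧ label q.2 < label q.1.2}.indicator
        (fun _ => (1 : ℝ≥0∞)) (p, y) := fun p y => rfl
  simp only [this]
  have hl := measurable_label
  refine measurable_tsum_points measurable_fst (measurable_const.indicator ?_)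
  exact (measurableSet_eq_fun (f := fun q : (Config × Plane) × Plane => ⌊‖q.2‖⌋₊)
    (g := fun q => ⌊‖q.1.2‖⌋₊) (Nat.measurable_floor.comp (by fun_prop))
    (Nat.measurable_floor.comp (by fun_prop))).inter
    (measurableSet_lt (f := fun q : (Config × Plane) × Plane => label q.2)
      (g := fun q => label q.1.2) (hl.comp (by fun_prop)) (hl.comp (by fun_prop)))

attribute [irreducible] Config.number

section Fading

variable {μ : Measure ℝ} [IsProbabilityMeasure μ]

instance : IsProbabilityMeasure (fadingLaw μ) := by
  unfold fadingLaw; infer_instance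

/-- Expectations of shot noise can be computed with fading variables that are attached to the
numbers of the points instead of their positions. -/
lemma lintegral_shot_eq (φ : Config) (g : Plane → ℝ≥0∞) {Ψ : ℝ≥0∞ → ℝ≥0∞} (hΨ : Measurable Ψ) :
    ∫⁻ h, Ψ (shot φ g h) ∂fadingLaw μ =
      ∫⁻ k, Ψ (∑' x : φ.carrier, ENNReal.ofReal (k (φ.number x)) * g x)
        ∂(Measure.infinitePi fun _ : ℕ × ℕ => μ) := by
  have hm : Measurable fun k : φ.carrier → ℝ => Ψ (∑' x, ENNReal.ofReal (k x) * g x) :=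
    hΨ.comp (Measurable.tsum fun x => by fun_prop)
  have h1 := Measure.map_infinitePi_infinitePi_of_inj (P := fun _ : Plane => μ)
    (f := fun x : φ.carrier => (x : Plane)) Subtype.val_injective
  have h2 := Measure.map_infinitePi_infinitePi_of_inj (P := fun _ : ℕ × ℕ => μ)
    (f := fun x : φ.carrier => φ.number x) (fun x y h => Subtype.ext (φ.number_injOn x.2 y.2 h))
  have h3 := lintegral_map (μ := fadingLaw μ) hm
    (g := fun (ω : Plane → ℝ) (x : φ.carrier) => ω x) (by fun_prop)
  have h4 := lintegral_map (μ := Measure.infinitePi fun _ : ℕ × ℕ => μ) hm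
    (g := fun (ω : ℕ × ℕ → ℝ) (x : φ.carrier) => ω (φ.number x)) (by fun_prop)
  rw [h2] at h4
  rw [fadingLaw, h1] at h3
  exact h3.symm.trans h4

/-- Expectations of shot noise depend measurably on the point pattern and on parameters. -/
lemma measurable_lintegral_shot {β : Type*} [MeasurableSpace β] {Φ : β → Config}
    (hΦ : Measurable Φ) {g : β → Plane → ℝ≥0∞} (hg : Measurable (Function.uncurry g))
    {Ψ : β → ℝ≥0∞ → ℝ≥0∞} (hΨ : Measurable (Function.uncurry Ψ)) :
    Measurable fun b => ∫⁻ h, Ψ b (shot (Φ b) (g b) h) ∂fadingLaw μ := by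
  have heval : Measurable fun q : (ℕ × ℕ → ℝ) × (ℕ × ℕ) => q.1 q.2 :=
    measurable_from_prod_countable_left fun i => measurable_pi_apply i
  have hΦ' : Measurable fun q : (β × (ℕ × ℕ → ℝ)) × Plane => Φ q.1.1 :=
    hΦ.comp (measurable_fst.comp measurable_fst)
  have hnum : Measurable fun q : (β × (ℕ × ℕ → ℝ)) × Plane => (Φ q.1.1).number q.2 :=
    measurable_number.comp (hΦ'.prodMk measurable_snd)
  have hterm : Measurable fun q : (β × (ℕ × ℕ → ℝ)) × Plane =>
      ENNReal.ofReal (q.1.2 ((Φ q.1.1).number q.2)) * g q.1.1 q.2 :=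
    (heval.comp ((measurable_snd.comp measurable_fst).prodMk hnum)).ennreal_ofReal.mul
      (hg.comp ((measurable_fst.comp measurable_fst).prodMk measurable_snd))
  have hsum : Measurable fun p : β × (ℕ × ℕ → ℝ) => ∑' x : (Φ p.1).carrier,
      ENNReal.ofReal (p.2 ((Φ p.1).number x)) * g p.1 x :=
    measurable_tsum_points (Φ := fun p : β × (ℕ × ℕ → ℝ) => Φ p.1) (hΦ.comp measurable_fst) hterm
  have hcomp : Measurable fun p : β × (ℕ × ℕ → ℝ) => Ψ p.1 (∑' x : (Φ p.1).carrier,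
      ENNReal.ofReal (p.2 ((Φ p.1).number x)) * g p.1 x) :=
    hΨ.comp (f := fun p : β × (ℕ × ℕ → ℝ) => (p.1, ∑' x : (Φ p.1).carrier,
      ENNReal.ofReal (p.2 ((Φ p.1).number x)) * g p.1 x)) (measurable_fst.prodMk hsum)
  have heq : (fun b => ∫⁻ h, Ψ b (shot (Φ b) (g b) h) ∂fadingLaw μ) = fun b =>
      ∫⁻ k, Ψ b (∑' x : (Φ b).carrier, ENNReal.ofReal (k ((Φ b).number x)) * g b x)
        ∂(Measure.infinitePi fun _ : ℕ × ℕ => μ) :=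
    funext fun b => lintegral_shot_eq (Φ b) (g b) (Ψ := Ψ b)
      (hΨ.comp (measurable_prodMk_left (x := b)))
  rw [heq]
  exact hcomp.lintegral_prod_right' (ν := Measure.infinitePi fun _ : ℕ × ℕ => μ)

/-- The law of the fading variables does not depend on how the plane is relabelled. -/
lemma lintegral_shot_image (e : Plane ≃ᵢ Plane) (φ : Config) (g : Plane → ℝ≥0∞)
    {Ψ : ℝ≥0∞ → ℝ≥0∞} (hΨ : Measurable Ψ) :
    ∫⁻ h, Ψ (shot (φ.image e) g h) ∂fadingLaw μ =
      ∫⁻ h, Ψ (shot φ (fun x => g (e x)) h) ∂fadingLaw μ := by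
  have h1 := Measure.map_infinitePi_infinitePi_of_inj (P := fun _ : Plane => μ)
    (f := e) e.injective
  have h2 := lintegral_map (μ := fadingLaw μ) (hΨ.comp (measurable_shot φ fun x => g (e x)))
    (g := fun (ω : Plane → ℝ) (i : Plane) => ω (e i)) (by fun_prop)
  rw [fadingLaw, h1] at h2
  refine Eq.trans (lintegral_congr fun h => ?_) h2.symm
  simp only [Function.comp_apply]
  rw [shot, tsum_image e φ fun x => ENNReal.ofReal (h x) * g x]
  rfl

/-- The fading variable of `u` may be resampled independently of all others. -/
lemma lintegral_fadingLaw_update (u : Plane) {f : (Plane → ℝ) → ℝ≥0∞} (hf : Measurable f) :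
    ∫⁻ h, f h ∂fadingLaw μ =
      ∫⁻ h, ∫⁻ t, f (Function.update h u t) ∂μ ∂fadingLaw μ := by
  classical
  have hup : Measurable fun p : (Plane → ℝ) × ℝ => Function.update p.1 u p.2 := by
    refine measurable_pi_iff.2 fun x => ?_
    by_cases hx : x = u
    · subst hx; simpa using measurable_snd
    · simp only [Function.update_of_ne hx]; fun_prop
  have hmap : ((fadingLaw μ).prod μ).map (fun p => Function.update p.1 u p.2) = fadingLaw μ := by
    refine Measure.eq_infinitePi _ fun s t ht => ?_
    rw [Measure.map_apply hup (.pi s.countable_toSet fun i _ => ht i)]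
    by_cases hu : u ∈ s
    · have : (fun p : (Plane → ℝ) × ℝ => Function.update p.1 u p.2) ⁻¹' (Set.pi s t) =
          (Set.pi (s.erase u : Finset Plane) t) ×ˢ t u := by
        ext p
        simp only [mem_preimage, Set.mem_pi, Finset.mem_coe, mem_prod, Finset.mem_erase]
        constructor
        · intro H
          refine ⟨fun i hi => ?_, by simpa using H u hu⟩
          simpa [Function.update_of_ne hi.1] using H i hi.2
        · intro H i hi
          by_cases hiu : i = u
          · subst hiu; simpa using H.2
          · simpa [Function.update_of_ne hiu] using H.1 i ⟨hiu, hi⟩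
      rw [this, Measure.prod_prod, fadingLaw, Measure.infinitePi_pi _ fun i _ => ht i,
        Finset.prod_erase_mul _ _ hu]
    · have : (fun p : (Plane → ℝ) × ℝ => Function.update p.1 u p.2) ⁻¹' (Set.pi s t) =
          (Set.pi s t) ×ˢ univ := by
        ext p
        simp only [mem_preimage, Set.mem_pi, Finset.mem_coe, mem_prod, mem_univ, and_true]
        refine forall₂_congr fun i hi => ?_
        rw [Function.update_of_ne (by rintro rfl; exact hu hi)]
      rw [this, Measure.prod_prod, measure_univ, mul_one, fadingLaw,
        Measure.infinitePi_pi _ fun i _ => ht i]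
  conv_lhs => rw [← hmap]
  rw [lintegral_map hf hup]
  exact lintegral_prod _ (hf.comp hup).aemeasurable

/-- Jensen's inequality for sums: `(∑ wᵢ tᵢ)^(n+1) ≤ (∑ wᵢ)^n ∑ wᵢ tᵢ^(n+1)`. -/
lemma tsum_mul_pow_le {ι : Type*} (w t : ι → ℝ≥0∞) (n : ℕ) :
    (∑' i, w i * t i) ^ (n + 1) ≤ (∑' i, w i) ^ n * ∑' i, w i * t i ^ (n + 1) := by
  have hfin : ∀ s : Finset ι, (∑ i ∈ s, w i * t i) ^ (n + 1) ≤
      (∑' i, w i) ^ n * ∑' i, w i * t i ^ (n + 1) := by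
    intro s
    have hn : (0 : ℝ) < (n : ℝ) + 1 := by positivity
    have h := ENNReal.inner_le_weight_mul_Lp_of_nonneg s (p := (n : ℝ) + 1) (by simp) w t
    have h' := ENNReal.rpow_le_rpow h hn.le
    rw [ENNReal.mul_rpow_of_nonneg _ _ hn.le, ← ENNReal.rpow_mul, ← ENNReal.rpow_mul,
      inv_mul_cancel₀ hn.ne', ENNReal.rpow_one, sub_mul, inv_mul_cancel₀ hn.ne', one_mul,
      add_sub_cancel_right, ENNReal.rpow_natCast] at h'
    have e : ∀ x : ℝ≥0∞, x ^ ((n : ℝ) + 1) = x ^ (n + 1) := fun x => by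
      rw [← ENNReal.rpow_natCast]; norm_cast
    simp only [e] at h'
    refine h'.trans ?_
    gcongr <;> exact ENNReal.sum_le_tsum s
  have hlim : Tendsto (fun s : Finset ι => (∑ i ∈ s, w i * t i) ^ (n + 1)) atTop
      (𝓝 ((∑' i, w i * t i) ^ (n + 1))) :=
    ((ENNReal.continuous_pow (n + 1)).tendsto _).comp ENNReal.summable.hasSum
  exact le_of_tendsto hlim (Eventually.of_forall hfin)

lemma lintegral_eval_fadingLaw (x : Plane) {f : ℝ → ℝ≥0∞} (hf : Measurable f) :
    ∫⁻ h, f (h x) ∂fadingLaw μ = ∫⁻ t, f t ∂μ := by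
  have h := (measurePreserving_eval_infinitePi (fun _ : Plane => μ) x).map_eq
  conv_rhs => rw [← h, lintegral_map hf (measurable_pi_apply x)]
  rfl

/-- Moments of shot noise: independence is not needed for an upper bound. -/
lemma lintegral_shot_pow_le (φ : Config) (g : Plane → ℝ≥0∞) (n : ℕ) :
    ∫⁻ h, shot φ g h ^ n ∂fadingLaw μ ≤
      (∫⁻ t, ENNReal.ofReal t ^ n ∂μ) * (∑' x : φ.carrier, g x) ^ n := by
  cases n with
  | zero => simp
  | succ n =>
    calc ∫⁻ h, shot φ g h ^ (n + 1) ∂fadingLaw μ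
        ≤ ∫⁻ h, (∑' x : φ.carrier, g x) ^ n *
            ∑' x : φ.carrier, g x * ENNReal.ofReal (h x) ^ (n + 1) ∂fadingLaw μ := by
          refine lintegral_mono fun h => ?_
          refine le_trans (le_of_eq ?_) (tsum_mul_pow_le _ _ n)
          simp only [shot, mul_comm]
      _ = _ := by
          rw [lintegral_const_mul _ (Measurable.tsum fun x : φ.carrier => (((measurable_pi_apply
              x.1).ennreal_ofReal).pow_const (n + 1)).const_mul (g x)),
            lintegral_tsum fun x : φ.carrier =>
              ((((measurable_pi_apply x.1).ennreal_ofReal).pow_const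
                (n + 1)).const_mul (g x)).aemeasurable]
          have : ∀ x : φ.carrier, ∫⁻ h, g x * ENNReal.ofReal (h x) ^ (n + 1) ∂fadingLaw μ =
              g x * ∫⁻ t, ENNReal.ofReal t ^ (n + 1) ∂μ := fun x => by
            rw [lintegral_const_mul _ (by fun_prop), lintegral_eval_fadingLaw x.1
              (f := fun t => ENNReal.ofReal t ^ (n + 1)) (by fun_prop)]
          simp only [this]
          rw [ENNReal.tsum_mul_right]
          ring

end Fading

/-! ### Palm calculus -/

lemma measurableSet_unitSquare : MeasurableSet unitSquare := by
  have : unitSquare = ⋂ i, {x : Plane | x i ∈ Ico (0 : ℝ) 1} := by ext; simp [unitSquare]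
  rw [this]
  exact .iInter fun i => (by fun_prop : Measurable fun x : Plane => x i) measurableSet_Ico

lemma volume_unitSquare : volume unitSquare = 1 := by
  have h := (EuclideanSpace.volume_preserving_symm_measurableEquiv_toLp (Fin 2)).measure_preimage
    (s := univ.pi fun _ => Ico (0 : ℝ) 1)
    (MeasurableSet.univ_pi fun _ => measurableSet_Ico).nullMeasurableSet
  rw [Real.volume_pi_Ico] at h
  simp only [sub_zero, ENNReal.ofReal_one, Finset.prod_const_one] at h
  rw [← h]
  congr 1
  ext x
  simp [unitSquare]

/-- The measure `B × A ↦ E #{x ∈ Φ ∩ B : Φ - x ∈ A}` on the product of the plane and the space of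
point patterns. -/
def campbellMeasure (P : Measure Config) : Measure (Plane × Config) :=
  (P.compProd pointKernel).map fun p => (p.2, p.1.translate (-p.2))

/-- The (unnormalized) Palm measure `A ↦ E #{x ∈ Φ ∩ [0,1)² : Φ - x ∈ A}`. -/
def palmMeasure (P : Measure Config) : Measure Config :=
  ((campbellMeasure P).restrict (unitSquare ×ˢ univ)).map Prod.snd

lemma indicator_one_congr {α β : Type*} {S : Set α} {T : Set β} {a : α} {b : β}
    (h : a ∈ S ↔ b ∈ T) :
    S.indicator (fun _ => (1 : ℝ≥0∞)) a = T.indicator (fun _ => (1 : ℝ≥0∞)) b := by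
  classical
  simp only [indicator_apply, h]

lemma palmMeasure_apply {P : Measure Config} {A : Set Config} (hA : MeasurableSet A) :
    palmMeasure P A = campbellMeasure P (unitSquare ×ˢ A) := by
  rw [palmMeasure, Measure.map_apply measurable_snd hA,
    Measure.restrict_apply (measurable_snd hA)]
  congr 1
  ext p
  simp [and_comm]

lemma palmExp_mono {P : Measure Config} (lam : ℝ) (ζ : Plane) {F G : Config → ℝ≥0∞}
    (h : ∀ φ, F φ ≤ G φ) :
    palmExp P lam ζ F ≤ palmExp P lam ζ G := by
  unfold palmExp
  gcongr
  exact h _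

section Palm

variable {P : Measure Config} [IsProbabilityMeasure P]

lemma lintegral_tsum_points {f : Config × Plane → ℝ≥0∞} (hf : Measurable f) :
    ∫⁻ p, f p ∂(P.compProd pointKernel) = ∫⁻ φ, ∑' x : φ.carrier, f (φ, x) ∂P := by
  rw [Measure.lintegral_compProd hf]
  simp only [pointKernel_apply, Config.lintegral_pointMeasure]

lemma measurable_recenter :
    Measurable fun p : Config × Plane => (p.2, p.1.translate (-p.2)) :=
  measurable_snd.prodMk (measurable_translate.comp (measurable_fst.prodMk measurable_snd.neg))

lemma lintegral_campbellMeasure {F : Plane × Config → ℝ≥0∞} (hF : Measurable F) :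
    ∫⁻ p, F p ∂campbellMeasure P =
      ∫⁻ φ, ∑' x : φ.carrier, F (x, φ.translate (-x)) ∂P := by
  rw [campbellMeasure, lintegral_map hF measurable_recenter]
  exact lintegral_tsum_points (hF.comp measurable_recenter)

lemma campbellMeasure_prod {B : Set Plane} {A : Set Config} (hB : MeasurableSet B)
    (hA : MeasurableSet A) : campbellMeasure P (B ×ˢ A) =
      ∫⁻ φ, ∑' x : φ.carrier,
        (B ×ˢ A).indicator (fun _ => (1 : ℝ≥0∞)) ((x : Plane), φ.translate (-x)) ∂P := by
  rw [← lintegral_indicator_one (hB.prod hA)]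
  exact lintegral_campbellMeasure (measurable_const.indicator (hB.prod hA))

lemma campbellMeasure_prod_le {lam : ℝ} (hI : HasIntensity P lam) {B : Set Plane}
    {A : Set Config} (hB : MeasurableSet B) (hA : MeasurableSet A) :
    campbellMeasure P (B ×ˢ A) ≤ ENNReal.ofReal lam * volume B := by
  rw [campbellMeasure_prod hB hA, ← hI B hB]
  refine lintegral_mono fun φ => ?_
  rw [φ.count_eq_tsum]
  refine ENNReal.tsum_le_tsum fun x => ?_
  simp only [indicator, mem_prod]
  split_ifs <;> simp_all

/-- By stationarity, the Campbell measure is translation-invariant in its first component, hence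
proportional to Lebesgue measure. -/
lemma campbellMeasure_prod_eq {lam : ℝ} (hI : HasIntensity P lam)
    (hS : ∀ v : Plane, MeasurePreserving (Config.translate v) P P) {B : Set Plane}
    {A : Set Config} (hB : MeasurableSet B) (hA : MeasurableSet A) :
    campbellMeasure P (B ×ˢ A) = volume B * palmMeasure P A := by
  set ν : Measure Plane := ((campbellMeasure P).restrict (univ ×ˢ A)).map Prod.fst with hν
  have hνB : ∀ B, MeasurableSet B → ν B = campbellMeasure P (B ×ˢ A) := fun B hB => by
    rw [hν, Measure.map_apply measurable_fst hB, Measure.restrict_apply (measurable_fst hB)]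
    congr 1
    ext p
    simp
  have hfin : IsFiniteMeasureOnCompacts ν := ⟨fun K hK => by
    rw [hνB K hK.measurableSet]
    exact (campbellMeasure_prod_le hI hK.measurableSet hA).trans_lt
      (ENNReal.mul_lt_top ENNReal.ofReal_lt_top hK.measure_lt_top)⟩
  have hinv : ν.IsAddLeftInvariant := ⟨fun v => by
    ext B hB
    have hvB : MeasurableSet ((fun x => v + x) ⁻¹' B) := (measurable_const_add v) hB
    rw [Measure.map_apply (measurable_const_add v) hB, hνB _ hvB, hνB B hB,
      campbellMeasure_prod hvB hA, campbellMeasure_prod hB hA]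
    have hmeas : Measurable fun φ : Config => ∑' x : φ.carrier, (B ×ˢ A).indicator
        (fun _ => (1 : ℝ≥0∞)) ((x : Plane), φ.translate (-x)) :=
      measurable_tsum_points (f := fun p : Config × Plane => (B ×ˢ A).indicator
        (fun _ => (1 : ℝ≥0∞)) (p.2, p.1.translate (-p.2))) measurable_id
        ((measurable_const.indicator (hB.prod hA)).comp measurable_recenter)
    rw [← (hS v).lintegral_comp hmeas]
    refine lintegral_congr fun φ => ?_
    rw [tsum_translate v φ fun x => (B ×ˢ A).indicator
        (fun _ => (1 : ℝ≥0∞)) (x, (φ.translate v).translate (-x))]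
    refine tsum_congr fun x => ?_
    have : v + -((x : Plane) + v) = -x := by abel
    rw [Config.translate_translate, this]
    exact indicator_one_congr (by simp [add_comm])⟩
  -- Uniqueness of Haar measure; the factor is the value on the unit square.
  have heq := Measure.isAddLeftInvariant_eq_smul ν (volume : Measure Plane)
  have hU := hνB unitSquare measurableSet_unitSquare
  rw [← palmMeasure_apply hA] at hU
  rw [← hνB B hB, ← hU, heq]
  simp [volume_unitSquare, mul_comm]

lemma isFiniteMeasure_palmMeasure {lam : ℝ} (hI : HasIntensity P lam) :
    IsFiniteMeasure (palmMeasure P) := ⟨by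
  rw [palmMeasure_apply .univ]
  refine (campbellMeasure_prod_le hI measurableSet_unitSquare .univ).trans_lt ?_
  rw [volume_unitSquare]
  simp⟩

lemma campbellMeasure_eq {lam : ℝ} (hI : HasIntensity P lam)
    (hS : ∀ v : Plane, MeasurePreserving (Config.translate v) P P) :
    (volume : Measure Plane).prod (palmMeasure P) = campbellMeasure P := by
  have := isFiniteMeasure_palmMeasure hI
  exact Measure.prod_eq fun B A hB hA => campbellMeasure_prod_eq hI hS hB hA

/-- The law of `Φ^ζ`. -/
def palmLaw (P : Measure Config) (lam : ℝ) (ζ : Plane) : Measure Config :=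
  (ENNReal.ofReal lam)⁻¹ • (palmMeasure P).map (Config.translate ζ)

lemma measurable_translate_const (ζ : Plane) : Measurable (Config.translate ζ) :=
  measurable_translate.comp (measurable_id.prodMk measurable_const)

lemma palmExp_eq_palmMeasure (lam : ℝ) (ζ : Plane) {F : Config → ℝ≥0∞} (hF : Measurable F) :
    palmExp P lam ζ F =
      (ENNReal.ofReal lam)⁻¹ * ∫⁻ ψ, F (ψ.translate ζ) ∂palmMeasure P := by
  have hF' : Measurable fun ψ : Config => F (ψ.translate ζ) :=
    hF.comp (measurable_translate_const ζ)
  have hG : Measurable fun p : Plane × Config => F (p.2.translate ζ) := hF'.comp measurable_snd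
  rw [palmExp, palmMeasure, lintegral_map hF' measurable_snd,
    ← lintegral_indicator (measurableSet_unitSquare.prod .univ), lintegral_campbellMeasure
      (hG.indicator (measurableSet_unitSquare.prod .univ)), ENNReal.div_eq_inv_mul]
  congr 1
  refine lintegral_congr fun φ => ?_
  rw [tsum_inter_eq_indicator φ.carrier unitSquare fun x => F (φ.translate (ζ - x))]
  refine tsum_congr fun x => ?_
  have hx : ((x : Plane), φ.translate (-x)) ∈ unitSquare ×ˢ (univ : Set Config) ↔
      (x : Plane) ∈ unitSquare := by simp
  have hv : -(x : Plane) + ζ = ζ - x := by abel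
  by_cases h : (x : Plane) ∈ unitSquare
  · rw [indicator_of_mem h, indicator_of_mem (hx.2 h), Config.translate_translate, hv]
  · rw [indicator_of_notMem h, indicator_of_notMem (fun h' => h (hx.1 h'))]

lemma palmExp_eq (lam : ℝ) (ζ : Plane) {F : Config → ℝ≥0∞} (hF : Measurable F) :
    palmExp P lam ζ F = ∫⁻ φ, F φ ∂palmLaw P lam ζ := by
  rw [palmExp_eq_palmMeasure lam ζ hF, palmLaw, lintegral_smul_measure,
    lintegral_map hF (measurable_translate_const ζ), smul_eq_mul]

lemma measurable_palmExp {β : Type*} [MeasurableSpace β] {lam : ℝ} (hI : HasIntensity P lam)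
    {ζ : β → Plane} (hζ : Measurable ζ)
    {F : β → Config → ℝ≥0∞} (hF : Measurable (Function.uncurry F)) :
    Measurable fun b => palmExp P lam (ζ b) (F b) := by
  have := isFiniteMeasure_palmMeasure hI
  have h : ∀ b, palmExp P lam (ζ b) (F b) = _ :=
    fun b => palmExp_eq_palmMeasure lam (ζ b) (hF.comp (measurable_prodMk_left (x := b)))
  simp only [h]
  refine Measurable.const_mul ?_ _
  refine Measurable.lintegral_prod_right' (f := fun p : β × Config =>
    F p.1 (p.2.translate (ζ p.1))) ?_
  exact hF.comp (measurable_fst.prodMk (measurable_translate.comp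
    (measurable_snd.prodMk (hζ.comp measurable_fst))))

/-- The Campbell–Mecke formula. -/
lemma lintegral_tsum_eq_palmExp {lam : ℝ} (hlam : 0 < lam) (hI : HasIntensity P lam)
    (hS : ∀ v : Plane, MeasurePreserving (Config.translate v) P P)
    {H : Config → Plane → ℝ≥0∞} (hH : Measurable (Function.uncurry H)) :
    ∫⁻ φ, ∑' x : φ.carrier, H φ x ∂P =
      ENNReal.ofReal lam * ∫⁻ x, palmExp P lam x (fun φ => H φ x) := by
  have := isFiniteMeasure_palmMeasure hI
  have hG : Measurable fun p : Plane × Config => H (p.2.translate p.1) p.1 :=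
    hH.comp ((measurable_translate.comp measurable_swap).prodMk measurable_fst)
  have h1 := lintegral_campbellMeasure (P := P) hG
  rw [← campbellMeasure_eq hI hS, lintegral_prod _ hG.aemeasurable] at h1
  simp only [Config.translate_translate, neg_add_cancel, Config.translate_zero] at h1
  have hpalm : Measurable fun x => palmExp P lam x fun φ => H φ x :=
    measurable_palmExp hI measurable_id (F := fun x φ => H φ x) (hH.comp measurable_swap)
  rw [← h1, ← lintegral_const_mul _ hpalm]
  refine lintegral_congr fun x => ?_
  have hm : Measurable fun φ => H φ x := hH.comp measurable_prodMk_right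
  rw [palmExp_eq_palmMeasure lam x hm, ← mul_assoc, ENNReal.mul_inv_cancel
    (by simpa using hlam) ENNReal.ofReal_ne_top, one_mul]

/-! ### Isotropy and polar coordinates -/

lemma image_translate (R : Plane ≃ₗᵢ[ℝ] Plane) (φ : Config) (v : Plane) :
    (φ.translate v).image R.toIsometryEquiv = (φ.image R.toIsometryEquiv).translate (R v) := by
  ext x
  rw [Config.mem_image, Config.mem_translate, Config.mem_translate, Config.mem_image]
  have : R.toIsometryEquiv.symm (x - R v) = R.toIsometryEquiv.symm x - v := by
    apply R.injective
    change R (R.symm (x - R v)) = R (R.symm x - v)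
    simp
  rw [this]

lemma palmMeasure_map_image {lam : ℝ} (hI : HasIntensity P lam) (hP : MotionInvariant P)
    (R : Plane ≃ₗᵢ[ℝ] Plane)
    (hR : LinearMap.det (R.toLinearEquiv : Plane →ₗ[ℝ] Plane) = 1) :
    (palmMeasure P).map (Config.image R.toIsometryEquiv) = palmMeasure P := by
  ext A hA
  have hA' := measurable_image R.toIsometryEquiv hA
  have hB : MeasurableSet (R.symm ⁻¹' unitSquare) :=
    R.symm.continuous.measurable measurableSet_unitSquare
  have hvol : volume (R.symm ⁻¹' unitSquare) = 1 := by
    rw [R.symm.measurePreserving.measure_preimage measurableSet_unitSquare.nullMeasurableSet,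
      volume_unitSquare]
  have h := campbellMeasure_prod_eq hI hP.stationary hB hA
  rw [hvol, one_mul] at h
  rw [Measure.map_apply (measurable_image _) hA, palmMeasure_apply hA', ← h,
    campbellMeasure_prod measurableSet_unitSquare hA', campbellMeasure_prod hB hA]
  have hmeas : Measurable fun φ : Config =>
      ∑' x : φ.carrier, ((R.symm ⁻¹' unitSquare) ×ˢ A).indicator
      (fun _ => (1 : ℝ≥0∞)) ((x : Plane), φ.translate (-x)) :=
    measurable_tsum_points (f := fun p : Config × Plane => ((R.symm ⁻¹' unitSquare) ×ˢ A).indicator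
      (fun _ => (1 : ℝ≥0∞)) (p.2, p.1.translate (-p.2))) measurable_id
      ((measurable_const.indicator (hB.prod hA)).comp measurable_recenter)
  rw [← (hP.isotropic R hR).lintegral_comp hmeas]
  refine lintegral_congr fun φ => ?_
  rw [tsum_image R.toIsometryEquiv φ fun x => ((R.symm ⁻¹' unitSquare) ×ˢ A).indicator
      (fun _ => (1 : ℝ≥0∞)) (x, (φ.image R.toIsometryEquiv).translate (-x))]
  refine tsum_congr fun x => ?_
  have h2 : (φ.image R.toIsometryEquiv).translate (-R x) =
      (φ.translate (-x)).image R.toIsometryEquiv := by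
    rw [image_translate, map_neg]
  exact indicator_one_congr (by simp [h2])

lemma palmExp_rotate {lam : ℝ} (hI : HasIntensity P lam) (hP : MotionInvariant P)
    (R : Plane ≃ₗᵢ[ℝ] Plane)
    (hR : LinearMap.det (R.toLinearEquiv : Plane →ₗ[ℝ] Plane) = 1) (ζ : Plane)
    {F : Config → ℝ≥0∞} (hF : Measurable F) :
    palmExp P lam (R ζ) F = palmExp P lam ζ fun φ => F (φ.image R.toIsometryEquiv) := by
  have hFR : Measurable fun φ : Config => F (φ.image R.toIsometryEquiv) :=
    hF.comp (measurable_image _)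
  have hFt : Measurable fun ψ : Config => F (ψ.translate (R ζ)) :=
    hF.comp (measurable_translate_const _)
  rw [palmExp_eq_palmMeasure lam _ hF, palmExp_eq_palmMeasure lam _ hFR]
  conv_lhs => rw [← palmMeasure_map_image hI hP R hR, lintegral_map hFt (measurable_image _)]
  simp only [image_translate]

lemma norm_axis {y : ℝ} (hy : 0 ≤ y) : ‖(!₂[y, 0] : Plane)‖ = y := by
  simp [EuclideanSpace.norm_eq, Real.sqrt_sq hy]

lemma exists_rotation {x y : Plane} (h : ‖x‖ = ‖y‖) : ∃ R : Plane ≃ₗᵢ[ℝ] Plane,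
    LinearMap.det (R.toLinearEquiv : Plane →ₗ[ℝ] Plane) = 1 ∧ R x = y := by
  have : Fact (Module.finrank ℝ Plane = 2) := ⟨finrank_euclideanSpace_fin⟩
  let o : Orientation ℝ Plane (Fin 2) := (EuclideanSpace.basisFun (Fin 2) ℝ).toBasis.orientation
  exact ⟨o.rotation (o.oangle x y), o.det_rotation _, (o.rotation_oangle_eq_iff_norm_eq x y).2 h⟩

lemma lintegral_norm_plane {f : ℝ → ℝ≥0∞} (hf : Measurable f) :
    ∫⁻ x : Plane, f ‖x‖ =
      ENNReal.ofReal (2 * Real.pi) * ∫⁻ y in Ioi (0 : ℝ), ENNReal.ofReal y * f y := by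
  have h1 := Complex.orthonormalBasisOneI.measurePreserving_repr.lintegral_comp
    (f := fun x : Plane => f ‖x‖) (hf.comp measurable_norm)
  simp only [LinearIsometryEquiv.norm_map] at h1
  rw [← h1, ← Complex.lintegral_comp_polarCoord_symm]
  simp only [Complex.norm_polarCoord_symm, smul_eq_mul, polarCoord_target]
  rw [Measure.volume_eq_prod, ← Measure.prod_restrict,
    lintegral_prod _ (by fun_prop)]
  simp only [lintegral_const, Measure.restrict_apply .univ, univ_inter, Real.volume_Ioo]
  rw [lintegral_mul_const _ (by fun_prop), mul_comm]
  congr 1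
  · congr 1; ring
  · refine setLIntegral_congr_fun measurableSet_Ioi fun y hy => ?_
    simp only [abs_of_pos (mem_Ioi.1 hy)]

/-- Polar coordinates for a function that only depends on the norm. -/
lemma lintegral_radial {Φ : Plane → ℝ≥0∞} (hΦ : Measurable Φ)
    (hrad : ∀ x y, ‖x‖ = ‖y‖ → Φ x = Φ y) :
    ∫⁻ x, Φ x = ENNReal.ofReal (2 * Real.pi) *
      ∫⁻ y in Ioi (0 : ℝ), ENNReal.ofReal y * Φ !₂[y, 0] := by
  rw [← lintegral_norm_plane (f := fun y => Φ !₂[y, 0]) (hΦ.comp (by fun_prop))]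
  exact lintegral_congr fun x => hrad _ _ (norm_axis (norm_nonneg x)).symm

end Palm

/-! ### Factorial moments and moments of sums over the Palm version -/

/-- The sum of `f` over all `n`-tuples of distinct points of `φ`. -/
def distinctSum (φ : Config) (n : ℕ) (f : (Fin n → Plane) → ℝ≥0∞) : ℝ≥0∞ :=
  ∑' x : Fin n ↪ φ.carrier, f fun i => x i

/-- An `(n+1)`-tuple of distinct points is a point together with an `n`-tuple of distinct other
points. -/
def tupleEquiv (φ : Config) (n : ℕ) :
    (Fin (n + 1) ↪ φ.carrier) ≃ Σ x₀ : φ.carrier, Fin n ↪ (φ.erase x₀).carrier where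
  toFun x := ⟨x 0, ⟨fun i => ⟨x i.succ, (x i.succ).2, fun h => by
      have := x.injective (Subtype.ext h)
      exact (Fin.succ_ne_zero i) this⟩, fun i j h => by
      have h' : (x i.succ : Plane) = x j.succ :=
        congrArg (fun z : (φ.erase (x 0)).carrier => (z : Plane)) h
      exact Fin.succ_injective _ (x.injective (Subtype.ext h'))⟩⟩
  invFun p := ⟨Fin.cons p.1 fun i => ⟨(p.2 i).1, (p.2 i).2.1⟩, by
      rw [Fin.cons_injective_iff]
      refine ⟨?_, fun i j h => p.2.injective (Subtype.ext (by simpa using h))⟩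
      rintro ⟨i, hi⟩
      exact (p.2 i).2.2 (congrArg Subtype.val hi)⟩
  left_inv x := by
    refine DFunLike.ext _ _ fun i => ?_
    refine Fin.cases ?_ (fun j => ?_) i <;> rfl
  right_inv p := by
    obtain ⟨x₀, y⟩ := p
    rfl

lemma distinctSum_succ (φ : Config) (n : ℕ) (f : (Fin (n + 1) → Plane) → ℝ≥0∞) :
    distinctSum φ (n + 1) f = ∑' x₀ : φ.carrier,
      distinctSum (φ.erase x₀) n fun y => f (Fin.cons (x₀ : Plane) y) := by
  unfold distinctSum
  rw [← (tupleEquiv φ n).symm.tsum_eq, ENNReal.summable.tsum_sigma' fun _ => ENNReal.summable]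
  refine tsum_congr fun x₀ => tsum_congr fun y => ?_
  congr 1
  funext i
  refine Fin.cases ?_ (fun j => ?_) i <;> rfl

lemma measurable_finCons {n : ℕ} : Measurable fun p : Plane × (Fin n → Plane) =>
    (Fin.cons p.1 p.2 : Fin (n + 1) → Plane) := by
  refine measurable_pi_iff.2 fun i => ?_
  refine Fin.cases ?_ (fun j => ?_) i
  · simpa using measurable_fst
  · simp only [Fin.cons_succ]
    exact (measurable_pi_apply j).comp measurable_snd

lemma measurable_distinctSum {n : ℕ} : ∀ {β : Type} [MeasurableSpace β] {Φ : β → Config}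
    (_ : Measurable Φ) {f : β → (Fin n → Plane) → ℝ≥0∞} (_ : Measurable (Function.uncurry f)),
    Measurable fun b => distinctSum (Φ b) n (f b) := by
  induction n with
  | zero =>
    intro β _ Φ hΦ f hf
    have : ∀ b, distinctSum (Φ b) 0 (f b) = f b ![] := fun b => by
      unfold distinctSum
      rw [tsum_eq_single default fun x hx => (hx (Subsingleton.elim _ _)).elim]
      congr 1
      exact Subsingleton.elim _ _
    simp only [this]
    exact hf.comp (measurable_id.prodMk measurable_const)
  | succ n ih =>
    intro β _ Φ hΦ f hf
    simp only [distinctSum_succ]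
    refine measurable_tsum_points (f := fun p : β × Plane =>
      distinctSum ((Φ p.1).erase p.2) n fun y => f p.1 (Fin.cons p.2 y)) hΦ ?_
    refine ih (Φ := fun p : β × Plane => (Φ p.1).erase p.2)
      (f := fun p y => f p.1 (Fin.cons p.2 y))
      (measurable_erase.comp ((hΦ.comp measurable_fst).prodMk measurable_snd)) ?_
    exact hf.comp (f := fun q : (β × Plane) × (Fin n → Plane) =>
      (q.1.1, (Fin.cons q.1.2 q.2 : Fin (n + 1) → Plane)))
      ((measurable_fst.comp measurable_fst).prodMk (measurable_finCons.comp
        ((measurable_snd.comp measurable_fst).prodMk measurable_snd)))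

/-- The counting measure of the `n`-tuples of distinct points of a pattern. -/
def tupleMeasure (n : ℕ) (φ : Config) : Measure (Fin n → Plane) :=
  .sum fun x : Fin n ↪ φ.carrier => .dirac fun i => x i

lemma lintegral_tupleMeasure (n : ℕ) (φ : Config) (f : (Fin n → Plane) → ℝ≥0∞) :
    ∫⁻ x, f x ∂tupleMeasure n φ = distinctSum φ n f := by
  simp [tupleMeasure, lintegral_sum_measure, distinctSum]

lemma tupleMeasure_apply (n : ℕ) (φ : Config) {B : Set (Fin n → Plane)} (hB : MeasurableSet B) :
    tupleMeasure n φ B = distinctSum φ n (B.indicator fun _ => 1) := by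
  rw [← lintegral_tupleMeasure, ← lintegral_indicator_one hB]
  rfl

lemma measurable_tupleMeasure (n : ℕ) : Measurable (tupleMeasure n) := by
  refine Measure.measurable_of_measurable_coe _ fun B hB => ?_
  simp only [tupleMeasure_apply n _ hB]
  exact measurable_distinctSum measurable_id (f := fun _ => B.indicator fun _ => 1)
    ((measurable_const.indicator hB).comp measurable_snd)

/-- An injective tuple of points of `φ` is the same as an embedding of the index set into `φ`. -/
lemma factorialMoment_eq (P : Measure Config) (n : ℕ) (B : Set (Fin n → Plane)) :
    factorialMoment P n B = ∫⁻ φ, distinctSum φ n (B.indicator fun _ => 1) ∂P := by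
  refine lintegral_congr fun φ => ?_
  set S := {x : Fin n → Plane | Function.Injective x ∧ (∀ i, x i ∈ φ.carrier) ∧ x ∈ B}
  have hinj : Function.Injective fun (x : Fin n ↪ φ.carrier) (i : Fin n) => (x i : Plane) :=
    fun x y h => DFunLike.ext _ _ fun i => Subtype.ext (congrFun h i)
  rw [← ENNReal.tsum_set_one, tsum_subtype S fun _ => (1 : ℝ≥0∞), distinctSum, ← hinj.tsum_eq]
  · refine tsum_congr fun x =>
      indicator_one_congr ⟨fun h => h.2.2, fun h => ⟨?_, fun i => (x i).2, h⟩⟩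
    exact fun i j hij => x.injective (Subtype.ext hij)
  · intro x hx
    have hxS : x ∈ S := by
      by_contra h
      exact hx (indicator_of_notMem h _)
    exact ⟨⟨fun i => ⟨x i, hxS.2.1 i⟩, fun i j h => hxS.1 (congrArg Subtype.val h)⟩, rfl⟩

/-- All sums over `n`-tuples of distinct points have expectations that are bounded by a multiple
of the corresponding Lebesgue integrals, for `n ≥ 2`. -/
def BoundedMoments (P : Measure Config) : Prop :=
  ∀ n : ℕ, 2 ≤ n → ∃ q : ℝ≥0∞, q < ∞ ∧ ∀ f : (Fin n → Plane) → ℝ≥0∞, Measurable f →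
    ∫⁻ φ, distinctSum φ n f ∂P ≤ q * ∫⁻ x, f x

/-- Campbell's formula for tuples: the moment measure of order `n` integrates `f` to the
expectation of its sum over the `n`-tuples of distinct points. -/
lemma boundedMoments_of_density {P : Measure Config}
    (h : ∀ n : ℕ, 2 ≤ n → ∃ ρ : (Fin n → Plane) → ℝ≥0∞,
      IsMomentDensity P n ρ ∧ ∃ q : ℝ≥0∞, q < ∞ ∧ ∀ x, ρ x < q) : BoundedMoments P := by
  intro n hn
  obtain ⟨ρ, ⟨hρ, hd⟩, q, hq, hρq⟩ := h n hn
  refine ⟨q, hq, fun f hf => ?_⟩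
  have heq : P.bind (tupleMeasure n) = volume.withDensity ρ := by
    ext B hB
    rw [Measure.bind_apply hB (measurable_tupleMeasure n).aemeasurable, withDensity_apply _ hB,
      ← hd B hB, factorialMoment_eq]
    simp only [tupleMeasure_apply n _ hB]
  have h1 := Measure.lintegral_bind (m := P) (measurable_tupleMeasure n).aemeasurable
    (f := f) hf.aemeasurable
  simp only [lintegral_tupleMeasure] at h1
  rw [← h1, heq, lintegral_withDensity_eq_lintegral_mul _ hρ hf, ← lintegral_const_mul _ hf]
  refine lintegral_mono fun x => ?_
  simp only [Pi.mul_apply]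
  gcongr
  exact (hρq x).le

lemma lintegral_finCons {n : ℕ} {f : (Fin (n + 1) → Plane) → ℝ≥0∞} (hf : Measurable f) :
    ∫⁻ x, f x = ∫⁻ x₀ : Plane, ∫⁻ y : Fin n → Plane, f (Fin.cons x₀ y) := by
  have h := (volume_preserving_piFinSuccAbove (fun _ : Fin (n + 1) => Plane) 0).symm
  rw [← h.lintegral_comp hf, Measure.volume_eq_prod, lintegral_prod]
  · simp [MeasurableEquiv.piFinSuccAbove, Fin.insertNthEquiv]
  · exact (hf.comp (MeasurableEquiv.measurable _)).aemeasurable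

lemma lintegral_prod_translate {g : Plane → ℝ≥0∞} (hg : Measurable g) (v : Plane) (n : ℕ) :
    ∫⁻ y : Fin n → Plane, ∏ i, g (y i + v) = (∫⁻ x, g x) ^ n := by
  induction n with
  | zero => simp [volume_pi]
  | succ n ih =>
    rw [lintegral_finCons (by fun_prop)]
    simp only [Fin.prod_univ_succ, Fin.cons_zero, Fin.cons_succ]
    have : ∀ x₀ : Plane, ∫⁻ y : Fin n → Plane, g (x₀ + v) * ∏ i, g (y i + v) =
        g (x₀ + v) * (∫⁻ x, g x) ^ n := fun x₀ => by
      rw [lintegral_const_mul _ (by fun_prop), ih]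
    simp only [this]
    rw [lintegral_mul_const _ (by fun_prop), lintegral_add_right_eq_self g v, pow_succ']

/-- Powers of a sum are bounded by sums over tuples of distinct indices. -/
lemma tsum_pow_le {ι : Type*} (g : ι → ℝ≥0∞) (hg : ∀ z, g z ≤ 1) (n : ℕ) :
    (∑' z, g z) ^ n ≤
      n.factorial * ∑ j ∈ Finset.range (n + 1), ∑' x : Fin j ↪ ι, ∏ i, g (x i) := by
  set T : ℕ → ℝ≥0∞ := fun j => ∑' x : Fin j ↪ ι, ∏ i, g (x i) with hT
  -- A further index either differs from all of the `j` distinct ones or repeats one of them.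
  have step : ∀ j, (∑' z, g z) * T j ≤ T (j + 1) + j * T j := by
    classical
    intro j
    have h1 : T (j + 1) = ∑' x : Fin j ↪ ι, ∑' z : {z // z ∉ Set.range x},
        g z * ∏ i, g (x i) := by
      rw [hT]
      simp only
      rw [← (Equiv.embeddingFinSucc j ι).symm.tsum_eq,
        ENNReal.summable.tsum_sigma' fun _ => ENNReal.summable]
      refine tsum_congr fun x => tsum_congr fun z => ?_
      rw [Fin.prod_univ_succ]
      simp
    rw [h1, hT]
    simp only
    rw [← ENNReal.tsum_mul_left, ← ENNReal.tsum_mul_left, ← ENNReal.tsum_add]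
    refine ENNReal.tsum_le_tsum fun x => ?_
    have h2 : ∑' z, g z = ∑' z : {z // z ∉ Set.range x}, g z + ∑' z : Set.range x, g z := by
      rw [add_comm]
      exact (ENNReal.summable.tsum_add_tsum_compl ENNReal.summable).symm
    rw [h2, add_mul, ← ENNReal.tsum_mul_right]
    gcongr
    rw [show ∑' z : Set.range x, g z = ∑' i : Fin j, g (x i) from tsum_range g x.injective,
      tsum_fintype]
    calc ∑ i : Fin j, g (x i) ≤ ∑ i : Fin j, 1 := Finset.sum_le_sum fun i _ => hg _
      _ = j := by simp
  induction n with
  | zero =>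
    have : T 0 = 1 := by
      rw [hT]
      simp only
      rw [tsum_eq_single default fun x hx => (hx (Subsingleton.elim _ _)).elim]
      simp
    simp [this]
  | succ n ih =>
    calc (∑' z, g z) ^ (n + 1) = (∑' z, g z) * (∑' z, g z) ^ n := pow_succ' _ _
      _ ≤ (∑' z, g z) * (n.factorial * ∑ j ∈ Finset.range (n + 1), T j) := by gcongr
      _ = n.factorial * ∑ j ∈ Finset.range (n + 1), (∑' z, g z) * T j := by
          rw [mul_left_comm, Finset.mul_sum]
      _ ≤ n.factorial * ∑ j ∈ Finset.range (n + 1), (T (j + 1) + n * T j) := by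
          gcongr with j hj
          refine (step j).trans ?_
          gcongr
          exact Nat.lt_succ_iff.1 (Finset.mem_range.1 hj)
      _ = n.factorial * (∑ j ∈ Finset.range (n + 1), T (j + 1) +
            n * ∑ j ∈ Finset.range (n + 1), T j) := by
          rw [Finset.sum_add_distrib, Finset.mul_sum]
      _ ≤ n.factorial * (∑ j ∈ Finset.range (n + 2), T j +
            n * ∑ j ∈ Finset.range (n + 2), T j) := by
          gcongr
          · rw [Finset.sum_range_succ' T (n + 1)]
            exact le_self_add
          · exact Nat.le_succ _
      _ = (n + 1).factorial * ∑ j ∈ Finset.range (n + 2), T j := by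
          rw [Nat.factorial_succ]
          push_cast
          ring

/-- The sum over the other points of `Φ^ζ` of an integrable function bounded by one has moments
that are bounded uniformly in `ζ`. -/
lemma exists_palmExp_tsum_pow_le {P : Measure Config} {lam : ℝ} (hlam : 0 < lam)
    (hI : HasIntensity P lam) (hB : BoundedMoments P) {g : Plane → ℝ≥0∞} (hg : Measurable g)
    (hg1 : ∀ x, g x ≤ 1) (hgi : ∫⁻ x, g x < ∞) (n : ℕ) : ∃ C : ℝ≥0∞, C < ∞ ∧ ∀ ζ,
      palmExp P lam ζ (fun φ => (∑' x : (φ.erase ζ).carrier, g x) ^ n) ≤ C := by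
  classical
  have hterm : ∀ j : ℕ, ∃ C : ℝ≥0∞, C < ∞ ∧ ∀ ζ, ∫⁻ φ, ∑' x : φ.carrier,
      unitSquare.indicator (fun x => distinctSum (φ.erase x) j fun y => ∏ i, g (y i + (ζ - x)))
        (x : Plane) ∂P ≤ C := by
    intro j
    rcases Nat.eq_zero_or_pos j with rfl | hj
    · refine ⟨ENNReal.ofReal lam * volume unitSquare, by simp [volume_unitSquare], fun ζ => ?_⟩
      rw [← hI _ measurableSet_unitSquare]
      refine lintegral_mono fun φ => ?_
      rw [φ.count_eq_tsum]
      refine ENNReal.tsum_le_tsum fun x => indicator_le_indicator ?_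
      unfold distinctSum
      rw [tsum_eq_single default fun x hx => (hx (Subsingleton.elim _ _)).elim]
      simp
    -- The Palm point and `j` further points form a tuple of order `j + 1 ≥ 2`. The integral of its
    -- weight `f` does not depend on `ζ`, since Lebesgue measure is invariant.
    · obtain ⟨q, hq, hqf⟩ := hB (j + 1) (by lia)
      refine ⟨q * (∫⁻ x, g x) ^ j, ENNReal.mul_lt_top hq (ENNReal.pow_lt_top hgi), fun ζ => ?_⟩
      set f : (Fin (j + 1) → Plane) → ℝ≥0∞ := fun y =>
        unitSquare.indicator (fun _ => 1) (y 0) * ∏ i : Fin j, g (y i.succ + (ζ - y 0)) with hf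
      have hfm : Measurable f := by
        refine Measurable.mul ((measurable_const.indicator measurableSet_unitSquare).comp
          (measurable_pi_apply 0)) ?_
        fun_prop
      have hint : ∫⁻ x, f x = (∫⁻ x, g x) ^ j := by
        rw [lintegral_finCons hfm]
        simp only [hf, Fin.cons_zero, Fin.cons_succ]
        have : ∀ x₀ : Plane, ∫⁻ y : Fin j → Plane, unitSquare.indicator (fun _ => (1 : ℝ≥0∞)) x₀ *
            ∏ i, g (y i + (ζ - x₀)) =
            unitSquare.indicator (fun _ => (1 : ℝ≥0∞)) x₀ * (∫⁻ x, g x) ^ j := fun x₀ => by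
          rw [lintegral_const_mul _ (by fun_prop), lintegral_prod_translate hg]
        simp only [this]
        rw [lintegral_mul_const _ (measurable_const.indicator measurableSet_unitSquare),
          lintegral_indicator measurableSet_unitSquare]
        simp [volume_unitSquare]
      rw [← hint]
      refine le_trans (lintegral_mono fun φ => ?_) (hqf f hfm)
      rw [distinctSum_succ]
      refine ENNReal.tsum_le_tsum fun x => ?_
      by_cases hx : (x : Plane) ∈ unitSquare
      · rw [indicator_of_mem hx]
        simp [hf, hx]
      · rw [indicator_of_notMem hx]
        exact zero_le
  choose C hC hCb using hterm
  refine ⟨n.factorial * (∑ j ∈ Finset.range (n + 1), C j) / ENNReal.ofReal lam, ?_, fun ζ => ?_⟩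
  · refine ENNReal.div_lt_top (ENNReal.mul_ne_top (ENNReal.natCast_ne_top _)
      (ENNReal.sum_lt_top.2 fun j _ => hC j).ne) (by simpa using hlam)
  unfold palmExp
  gcongr
  have hmeas : ∀ j, Measurable fun φ : Config => ∑' x : φ.carrier,
      unitSquare.indicator (fun x => distinctSum (φ.erase x) j fun y => ∏ i, g (y i + (ζ - x)))
        (x : Plane) := by
    intro j
    refine measurable_tsum_points (f := fun p : Config × Plane =>
      unitSquare.indicator (fun x => distinctSum (p.1.erase x) j fun y => ∏ i, g (y i + (ζ - x)))
        p.2) measurable_id ?_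
    have hd : Measurable fun p : Config × Plane =>
        distinctSum (p.1.erase p.2) j fun y => ∏ i, g (y i + (ζ - p.2)) :=
      measurable_distinctSum (f := fun (p : Config × Plane) y => ∏ i, g (y i + (ζ - p.2)))
        measurable_erase (by unfold Function.uncurry; fun_prop)
    exact hd.indicator (measurable_snd measurableSet_unitSquare)
  calc ∫⁻ φ, ∑' x : ↥(φ.carrier ∩ unitSquare),
        (∑' z : ((φ.translate (ζ - x)).erase ζ).carrier, g z) ^ n ∂P
      ≤ ∫⁻ φ, n.factorial * ∑ j ∈ Finset.range (n + 1), ∑' x : φ.carrier,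
          unitSquare.indicator (fun x => distinctSum (φ.erase x) j
            fun y => ∏ i, g (y i + (ζ - x))) (x : Plane) ∂P := by
        refine lintegral_mono fun φ => ?_
        rw [tsum_inter_eq_indicator φ.carrier unitSquare fun x =>
          (∑' z : ((φ.translate (ζ - x)).erase ζ).carrier, g z) ^ n, ←
          Summable.tsum_finsetSum fun _ _ => ENNReal.summable, ← ENNReal.tsum_mul_left]
        refine ENNReal.tsum_le_tsum fun x => ?_
        by_cases hx : (x : Plane) ∈ unitSquare
        · simp only [indicator_of_mem hx]
          have he : (φ.translate (ζ - x)).erase ζ = (φ.erase x).translate (ζ - x) := by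
            ext z
            have hz : z = ζ ↔ z - (ζ - (x : Plane)) = x :=
              ⟨fun h => by rw [h]; abel, fun h => by rw [← sub_eq_zero, ← sub_eq_zero.2 h]; abel⟩
            simp only [Config.erase_carrier, Set.mem_sdiff, mem_singleton_iff,
              Config.mem_translate, hz]
          rw [he, tsum_translate]
          exact tsum_pow_le (fun z : (φ.erase x).carrier => g (z + (ζ - x))) (fun z => hg1 _) n
        · simp only [indicator_of_notMem hx]
          exact zero_le
    _ = n.factorial * ∑ j ∈ Finset.range (n + 1), ∫⁻ φ, ∑' x : φ.carrier,
          unitSquare.indicator (fun x => distinctSum (φ.erase x) j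
            fun y => ∏ i, g (y i + (ζ - x))) (x : Plane) ∂P := by
        rw [lintegral_const_mul _ (Finset.measurable_sum _ fun j _ => hmeas j),
          lintegral_finsetSum _ fun j _ => hmeas j]
    _ ≤ _ := by
        gcongr with j hj
        exact hCb j ζ

/-! ### The nearest point and the contact distance -/

lemma Config.mem_nearest {φ : Config} {u : Plane} :
    u ∈ φ.nearest ↔ u ∈ φ.carrier ∧ φ ∈ emptyDisk ‖u‖ := by
  refine and_congr_right fun _ => ?_
  simp only [emptyDisk, mem_ofPred_eq, eq_empty_iff_forall_notMem, mem_inter_iff,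
    mem_ball_zero_iff, not_and, not_lt]

/-- The functional `H φ u` where `u` is nearest to the origin, and zero elsewhere. -/
def onNearest (H : Config → Plane → ℝ≥0∞) (φ : Config) (u : Plane) : ℝ≥0∞ :=
  (emptyDisk ‖u‖).indicator (fun φ => H φ u) φ

lemma onNearest_apply (H : Config → Plane → ℝ≥0∞) (φ : Config) (u : Plane) :
    onNearest H φ u = (emptyDisk ‖u‖).indicator (fun φ => H φ u) φ := rfl

lemma measurable_uncurry_swap {α β γ : Type*} [MeasurableSpace α] [MeasurableSpace β]
    [MeasurableSpace γ] {H : α → β → γ} (hH : Measurable (Function.uncurry H)) :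
    Measurable (Function.uncurry fun y x => H x y) := hH.comp measurable_swap

lemma tsum_nearest (H : Config → Plane → ℝ≥0∞) (φ : Config) :
    ∑' u : φ.nearest, H φ u = ∑' u : φ.carrier, onNearest H φ u := by
  have h : φ.nearest = φ.carrier ∩ {u | φ ∈ emptyDisk ‖u‖} := by
    ext u; exact Config.mem_nearest
  rw [h, tsum_inter_eq_indicator φ.carrier _ (H φ)]
  refine tsum_congr fun u => ?_
  by_cases hu : φ ∈ emptyDisk ‖(u : Plane)‖
  · rw [onNearest, indicator_of_mem hu, indicator_of_mem (by exact hu)]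
  · rw [onNearest, indicator_of_notMem hu, indicator_of_notMem (by exact hu)]

lemma Config.exists_nearest {φ : Config} (h : φ.carrier.Nonempty) : ∃ u, u ∈ φ.nearest := by
  obtain ⟨x, hx⟩ := h
  obtain ⟨u, ⟨hu, hux⟩, hmin⟩ := exists_min_image (φ.carrier ∩ Metric.closedBall 0 ‖x‖) norm
    (φ.locallyFinite _ (isCompact_closedBall _ _)) ⟨x, hx, by simp⟩
  refine ⟨u, hu, fun v hv => ?_⟩
  by_cases hvx : ‖v‖ ≤ ‖x‖
  · exact hmin v ⟨hv, by simpa using hvx⟩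
  · exact (by simpa using hux : ‖u‖ ≤ ‖x‖).trans (not_le.1 hvx).le

lemma Config.infEDist_eq {φ : Config} {u : Plane} (hu : u ∈ φ.nearest) :
    Metric.infEDist 0 φ.carrier = ‖u‖ₑ := by
  refine le_antisymm ?_ (Metric.le_infEDist.2 fun v hv => ?_)
  · have h := Metric.infEDist_le_edist_of_mem (x := (0 : Plane)) hu.1
    rwa [edist_comm, edist_eq_enorm_sub, sub_zero] at h
  · rw [edist_comm, edist_eq_enorm_sub, sub_zero]
    exact enorm_le_iff_norm_le.2 (hu.2 v hv)

lemma Config.infDist_eq {φ : Config} {u : Plane} (hu : u ∈ φ.nearest) :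
    Metric.infDist 0 φ.carrier = ‖u‖ := by
  rw [Metric.infDist, Config.infEDist_eq hu, toReal_enorm]

lemma measurable_infEDist : Measurable fun φ : Config => Metric.infEDist 0 φ.carrier := by
  refine measurable_of_Iio fun r => ?_
  have : (fun φ : Config => Metric.infEDist 0 φ.carrier) ⁻¹' Iio r =
      {φ | φ.count (Metric.eball 0 r) = 0}ᶜ := by
    ext φ
    simp only [mem_preimage, mem_Iio, Metric.infEDist_lt_iff, mem_compl_iff, mem_ofPred_eq,
      Config.count_eq_zero, eq_empty_iff_forall_notMem, not_forall, not_not, mem_inter_iff,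
      Metric.mem_eball, edist_comm]
  rw [this]
  exact (measurable_count Metric.isOpen_eball.measurableSet (measurableSet_singleton 0)).compl

lemma measurable_infDist : Measurable fun φ : Config => Metric.infDist 0 φ.carrier :=
  measurable_infEDist.ennreal_toReal

lemma measurableSet_emptyDisk_comp {β : Type*} [MeasurableSpace β] {Φ : β → Config}
    (hΦ : Measurable Φ) {r : β → ℝ} (hr : Measurable r) :
    MeasurableSet {b | Φ b ∈ emptyDisk (r b)} :=
  (hΦ.prodMk hr) measurableSet_emptyDisk'

/-- The assumptions on a point process that the analysis of its success probability uses. -/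
structure RegularLaw (ℓ : Plane → ℝ≥0∞) (μ : Measure ℝ) (lam : ℝ) (P : Measure Config) :
    Prop where
  intensity : HasIntensity P lam
  motionInvariant : MotionInvariant P
  boundedMoments : BoundedMoments P
  dominance : ∃ y₀ : ℝ, 0 < y₀ ∧ ∀ ζ : Plane, y₀ < ‖ζ‖ → ∀ z : ℝ≥0,
    nearestExp P lam ζ (fun φ =>
        fadingLaw μ {h | (z : ℝ≥0∞) < interference ℓ (φ.carrier \ {ζ}) h}) ≤
      palmExp P lam ζ (fun φ =>
        fadingLaw μ {h | (z : ℝ≥0∞) <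
          interference ℓ ((φ.carrier ∩ (Metric.ball 0 (‖ζ‖ / 2))ᶜ) \ {ζ}) h})
  contactMoments : ∀ n : ℕ, ∫⁻ φ, Metric.infEDist 0 φ.carrier ^ n ∂P < ∞

lemma ClassA.regularLaw {ℓ : Plane → ℝ≥0∞} {μ : Measure ℝ} {lam : ℝ} {P : Measure Config}
    (h : ClassA ℓ μ lam P) : RegularLaw ℓ μ lam P :=
  ⟨h.intensity, h.motionInvariant, boundedMoments_of_density h.boundedDensities, h.dominance,
    h.contactMoments⟩

section Almost

variable {P : Measure Config}

lemma ae_zero_notMem {lam : ℝ} (hI : HasIntensity P lam) : ∀ᵐ φ ∂P, (0 : Plane) ∉ φ.carrier := by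
  have h := hI {0} (measurableSet_singleton 0)
  rw [measure_singleton, mul_zero,
    lintegral_eq_zero_iff (measurable_count (measurableSet_singleton 0))] at h
  filter_upwards [h] with φ hφ h0
  have := Config.count_eq_zero.1 hφ
  exact (this ▸ (⟨h0, rfl⟩ : (0 : Plane) ∈ φ.carrier ∩ {0}) : (0 : Plane) ∈ (∅ : Set Plane))

lemma ae_nonempty (h : ∀ n : ℕ, ∫⁻ φ, Metric.infEDist 0 φ.carrier ^ n ∂P < ∞) :
    ∀ᵐ φ ∂P, φ.carrier.Nonempty := by
  have h1 := h 1
  simp only [pow_one] at h1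
  filter_upwards [ae_lt_top measurable_infEDist h1.ne] with φ hφ
  by_contra hne
  rw [not_nonempty_iff_eq_empty] at hne
  rw [hne, Metric.infEDist_empty] at hφ
  exact lt_irrefl _ hφ

/-- Pairs of points at equal distances from the origin are negligible, as circles are null sets. -/
lemma volume_norm_eq : volume {x : Fin 2 → Plane | ‖x 0‖ = ‖x 1‖} = 0 := by
  have hm : MeasurableSet {x : Fin 2 → Plane | ‖x 0‖ = ‖x 1‖} :=
    measurableSet_eq_fun (by fun_prop) (by fun_prop)
  rw [← lintegral_indicator_one hm]
  change ∫⁻ x, {x : Fin 2 → Plane | ‖x 0‖ = ‖x 1‖}.indicator (fun _ => (1 : ℝ≥0∞)) x = 0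
  rw [lintegral_finCons (measurable_const.indicator hm)]
  refine (lintegral_congr fun x₀ => ?_).trans lintegral_zero
  have hS : ∀ᵐ z : Plane, ‖x₀‖ ≠ ‖z‖ := by
    have := Measure.addHaar_sphere (volume : Measure Plane) 0 ‖x₀‖
    filter_upwards [measure_eq_zero_iff_ae_notMem.1 this] with z hz
    simpa [eq_comm] using hz
  have hmp := measurePreserving_funUnique (volume : Measure Plane) (Fin 1)
  have h2 := hmp.quasiMeasurePreserving.ae hS
  have hmy : Measurable fun y : Fin 1 → Plane => {x : Fin 2 → Plane | ‖x 0‖ = ‖x 1‖}.indicator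
      (fun _ => (1 : ℝ≥0∞)) (Fin.cons x₀ y) :=
    (measurable_const.indicator hm).comp
      (measurable_finCons.comp (measurable_const.prodMk measurable_id))
  rw [lintegral_eq_zero_iff hmy]
  filter_upwards [h2] with y hy
  refine indicator_of_notMem (fun h => hy ?_) _
  simpa using h

/-- No two points of the process are at the same distance from the origin. -/
lemma ae_norm_injOn (hB : BoundedMoments P) : ∀ᵐ φ ∂P, InjOn norm φ.carrier := by
  have hm : MeasurableSet {x : Fin 2 → Plane | ‖x 0‖ = ‖x 1‖} :=
    measurableSet_eq_fun (by fun_prop) (by fun_prop)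
  have hf : Measurable ({x : Fin 2 → Plane | ‖x 0‖ = ‖x 1‖}.indicator fun _ => (1 : ℝ≥0∞)) :=
    measurable_const.indicator hm
  obtain ⟨q, -, hqf⟩ := hB 2 le_rfl
  have h := hqf _ hf
  have hdm : Measurable fun φ : Config => distinctSum φ 2
      ({x : Fin 2 → Plane | ‖x 0‖ = ‖x 1‖}.indicator fun _ => (1 : ℝ≥0∞)) :=
    measurable_distinctSum measurable_id
      (f := fun _ => {x : Fin 2 → Plane | ‖x 0‖ = ‖x 1‖}.indicator fun _ => (1 : ℝ≥0∞))
      (hf.comp measurable_snd)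
  rw [lintegral_indicator hm, setLIntegral_const, volume_norm_eq, mul_zero, mul_zero,
    nonpos_iff_eq_zero, lintegral_eq_zero_iff hdm] at h
  filter_upwards [h] with φ hφ x hx y hy hxy
  by_contra hne
  have h0 := ENNReal.tsum_eq_zero.1 hφ ⟨![⟨x, hx⟩, ⟨y, hy⟩], by
    intro i j hij
    fin_cases i <;> fin_cases j <;> simp_all⟩
  rw [indicator_of_mem (by exact hxy)] at h0
  exact one_ne_zero h0

lemma nearest_eq_singleton {φ : Config} (hφ : InjOn norm φ.carrier) {u : Plane}
    (hu : u ∈ φ.nearest) : φ.nearest = {u} := by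
  refine eq_singleton_iff_unique_mem.2 ⟨hu, fun v hv => hφ hv.1 hu.1 ?_⟩
  exact le_antisymm (hv.2 u hu.1) (hu.2 v hv.1)

/-- Almost surely, the station nearest to the origin is unique and is not at the origin. -/
lemma RegularLaw.ae_nearest {ℓ : Plane → ℝ≥0∞} {μ : Measure ℝ} {lam : ℝ}
    (h : RegularLaw ℓ μ lam P) : ∀ᵐ φ ∂P, ∃ u : Plane, u ≠ 0 ∧ u ∈ φ.nearest ∧ φ.nearest = {u} := by
  filter_upwards [ae_zero_notMem h.intensity, ae_nonempty h.contactMoments,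
    ae_norm_injOn h.boundedMoments] with φ h0 hne hinj
  obtain ⟨u, hu⟩ := Config.exists_nearest hne
  exact ⟨u, fun h => h0 (h ▸ hu.1), hu, nearest_eq_singleton hinj hu⟩

end Almost

section Polar

variable {P : Measure Config} [IsProbabilityMeasure P]

lemma measurable_onNearest {H : Config → Plane → ℝ≥0∞}
    (hH : Measurable (Function.uncurry H)) : Measurable (Function.uncurry (onNearest H)) := by
  classical
  have heq : Function.uncurry (onNearest H) =
      {p : Config × Plane | p.1 ∈ emptyDisk ‖p.2‖}.indicator (Function.uncurry H) := by
    funext p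
    simp only [Function.uncurry, onNearest, indicator_apply, mem_ofPred_eq]
  rw [heq]
  exact hH.indicator (measurableSet_emptyDisk_comp measurable_fst measurable_snd.norm)

attribute [irreducible] onNearest

/-- The expectation of a rotation-invariant functional of the nearest point, in polar
coordinates. -/
lemma lintegral_tsum_nearest {lam : ℝ} (hlam : 0 < lam) (hI : HasIntensity P lam)
    (hP : MotionInvariant P) {H : Config → Plane → ℝ≥0∞} (hH : Measurable (Function.uncurry H))
    (hrot : ∀ (R : Plane ≃ₗᵢ[ℝ] Plane) φ x, H (φ.image R.toIsometryEquiv) (R x) = H φ x) :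
    ∫⁻ φ, ∑' u : φ.nearest, H φ u ∂P =
      ∫⁻ y in Ioi (0 : ℝ), ENNReal.ofReal (2 * Real.pi * lam * y) *
        palmExp P lam !₂[y, 0] ((emptyDisk y).indicator fun φ => H φ !₂[y, 0]) := by
  have hK := measurable_onNearest hH
  have hKm : ∀ x, Measurable fun φ => onNearest H φ x :=
    fun x => Measurable.of_uncurry_right (f := onNearest H) hK
  have hΦ : Measurable fun x => palmExp P lam x fun φ => onNearest H φ x :=
    measurable_palmExp hI (ζ := fun x => x) measurable_id (F := fun x φ => onNearest H φ x)
      (measurable_uncurry_swap hK)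
  have hrad : ∀ x x' : Plane, ‖x‖ = ‖x'‖ →
      palmExp P lam x (fun φ => onNearest H φ x) = palmExp P lam x' fun φ => onNearest H φ x' := by
    classical
    intro x x' hxx
    obtain ⟨R, hR, rfl⟩ := exists_rotation hxx
    rw [palmExp_rotate hI hP R hR x (hKm _)]
    congr 1
    funext φ
    have hmem : φ.image R.toIsometryEquiv ∈ emptyDisk ‖x‖ ↔ φ ∈ emptyDisk ‖x‖ := by
      simp only [emptyDisk, mem_ofPred_eq, eq_empty_iff_forall_notMem, mem_inter_iff, not_and,
        Config.mem_image, mem_ball_zero_iff]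
      refine ⟨fun h z hz => ?_, fun h z hz => ?_⟩
      · have h2 : R.toIsometryEquiv.symm (R z) = z := R.symm_apply_apply z
        have h3 := h (R z) (by rwa [h2])
        rwa [R.norm_map] at h3
      · have h2 := h _ hz
        change ¬ ‖R.symm z‖ < ‖x‖ at h2
        rwa [R.symm.norm_map] at h2
    simp only [onNearest_apply, indicator_apply, R.norm_map, hrot, hmem]
  simp only [tsum_nearest]
  rw [lintegral_tsum_eq_palmExp hlam hI hP.stationary hK, lintegral_radial hΦ hrad,
    ← mul_assoc, ← lintegral_const_mul]
  · refine setLIntegral_congr_fun measurableSet_Ioi fun y hy => ?_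
    have hy' : 0 < y := hy
    have hc : ENNReal.ofReal (2 * Real.pi * lam * y) =
        ENNReal.ofReal lam * ENNReal.ofReal (2 * Real.pi) * ENNReal.ofReal y := by
      rw [← ENNReal.ofReal_mul hlam.le, ← ENNReal.ofReal_mul (by positivity)]
      congr 1
      ring
    rw [hc]
    have : (fun φ => onNearest H φ !₂[y, 0]) = (emptyDisk y).indicator fun φ => H φ !₂[y, 0] := by
      funext φ
      rw [onNearest_apply, norm_axis hy'.le]
    rw [this]
    simp only [mul_assoc]
  · refine Measurable.mul (by fun_prop) ?_
    exact hΦ.comp (by fun_prop : Measurable fun y : ℝ => (!₂[y, 0] : Plane))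

/-- The density of the contact distance: the nearest point is in `dx` with probability
`lam P(Φ^x(b(o, ‖x‖)) = 0) dx`. -/
lemma contactPDF_ae_eq {ℓ : Plane → ℝ≥0∞} {μ : Measure ℝ} {lam : ℝ} (hlam : 0 < lam)
    (h : RegularLaw ℓ μ lam P) : ∀ᵐ y ∂volume.restrict (Ioi (0 : ℝ)),
      contactPDF P y = ENNReal.ofReal (2 * Real.pi * lam * y) *
        palmExp P lam !₂[y, 0] ((emptyDisk y).indicator fun _ => 1) := by
  set D : ℝ → ℝ≥0∞ := fun y => ENNReal.ofReal (2 * Real.pi * lam * y) *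
    palmExp P lam !₂[y, 0] ((emptyDisk y).indicator fun _ => 1) with hD
  have hDm : Measurable D := by
    refine Measurable.mul (by fun_prop) (measurable_palmExp h.intensity
      (ζ := fun y : ℝ => !₂[y, 0]) (by fun_prop)
      (F := fun y => (emptyDisk y).indicator fun _ => 1) ?_)
    exact measurable_const.indicator (measurableSet_emptyDisk_comp measurable_snd measurable_fst)
  have hmap : P.map (fun φ : Config => Metric.infDist 0 φ.carrier) =
      volume.withDensity ((Ioi (0 : ℝ)).indicator D) := by
    ext B hB
    rw [Measure.map_apply measurable_infDist hB, withDensity_apply _ hB,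
      ← lintegral_indicator_one (measurable_infDist hB)]
    have h1 : ∫⁻ φ, ((fun φ : Config => Metric.infDist 0 φ.carrier) ⁻¹' B).indicator 1 φ ∂P =
        ∫⁻ φ, ∑' u : φ.nearest, B.indicator (fun _ => (1 : ℝ≥0∞)) ‖(u : Plane)‖ ∂P := by
      refine lintegral_congr_ae ?_
      filter_upwards [h.ae_nearest] with φ ⟨u, _, hu, hs⟩
      rw [hs, tsum_singleton u fun u => B.indicator (fun _ => (1 : ℝ≥0∞)) ‖u‖]
      exact indicator_one_congr (by rw [mem_preimage, Config.infDist_eq hu])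
    rw [h1, lintegral_tsum_nearest hlam h.intensity h.motionInvariant
      (H := fun _ u => B.indicator (fun _ => (1 : ℝ≥0∞)) ‖u‖)
      ((measurable_const.indicator hB).comp measurable_snd.norm) (fun R φ x => by simp),
      lintegral_indicator measurableSet_Ioi, Measure.restrict_restrict measurableSet_Ioi,
      inter_comm, ← Measure.restrict_restrict hB, ← lintegral_indicator hB]
    refine setLIntegral_congr_fun measurableSet_Ioi fun y hy => ?_
    have hy' : 0 < y := hy
    simp only [norm_axis hy'.le]
    by_cases hyB : y ∈ B
    · simp [hyB, hD]
    · simp [hyB, palmExp]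
  have h2 := Measure.rnDeriv_withDensity volume (hDm.indicator (measurableSet_Ioi (a := (0 : ℝ))))
  rw [← hmap] at h2
  filter_upwards [ae_restrict_of_ae h2, ae_restrict_mem measurableSet_Ioi] with y hy hy0
  rw [contactPDF, pdf, hy, indicator_of_mem hy0]

end Polar

/-! ### The constant `κ` as an expectation over the point process -/

section Kappa

variable {P : Measure Config} [IsProbabilityMeasure P] {μ : Measure ℝ}

/-- The expectation, over the fading, of a functional of the interference from the stations
other than `u`. -/
def fadingExp (μ : Measure ℝ) (ℓ : Plane → ℝ≥0∞) (Ψ : Plane → ℝ≥0∞ → ℝ≥0∞) (φ : Config)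
    (u : Plane) : ℝ≥0∞ :=
  ∫⁻ h, Ψ u (interference ℓ (φ.carrier \ {u}) h) ∂fadingLaw μ

lemma measurable_fadingExp [IsProbabilityMeasure μ] {ℓ : Plane → ℝ≥0∞} (hℓ : Measurable ℓ)
    {Ψ : Plane → ℝ≥0∞ → ℝ≥0∞} (hΨ : Measurable (Function.uncurry Ψ)) :
    Measurable (Function.uncurry (fadingExp μ ℓ Ψ)) := by
  have heq : Function.uncurry (fadingExp μ ℓ Ψ) = fun p : Config × Plane =>
      ∫⁻ h, Ψ p.2 (shot p.1 (({p.2}ᶜ : Set Plane).indicator ℓ) h) ∂fadingLaw μ := by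
    funext p
    simp only [Function.uncurry, fadingExp, interference_diff]
  rw [heq]
  have hS : MeasurableSet {q : (Config × Plane) × Plane | q.2 ≠ q.1.2} :=
    (measurableSet_eq_fun (by fun_prop) (by fun_prop)).compl
  have hg : Measurable (Function.uncurry fun p : Config × Plane =>
      ({p.2}ᶜ : Set Plane).indicator ℓ) := (hℓ.comp measurable_snd).indicator hS
  exact measurable_lintegral_shot measurable_fst hg (Ψ := fun p => Ψ p.2)
    (hΨ.comp ((measurable_snd.comp measurable_fst).prodMk measurable_snd))

lemma fadingExp_rotate [IsProbabilityMeasure μ] {ℓ : Plane → ℝ≥0∞}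
    (hrad : ∀ x y : Plane, ‖x‖ = ‖y‖ → ℓ x = ℓ y)
    {Ψ : Plane → ℝ≥0∞ → ℝ≥0∞} (hΨ : ∀ u, Measurable (Ψ u))
    (hΨrad : ∀ x y : Plane, ‖x‖ = ‖y‖ → Ψ x = Ψ y) (R : Plane ≃ₗᵢ[ℝ] Plane) (φ : Config)
    (x : Plane) :
    fadingExp μ ℓ Ψ (φ.image R.toIsometryEquiv) (R x) = fadingExp μ ℓ Ψ φ x := by
  simp only [fadingExp, interference_diff]
  rw [lintegral_shot_image R.toIsometryEquiv φ _ (hΨ _), hΨrad (R x) x (R.norm_map x)]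
  have : (fun z => ({R x}ᶜ : Set Plane).indicator ℓ (R.toIsometryEquiv z)) =
      ({x}ᶜ : Set Plane).indicator ℓ := by
    funext z
    have h1 : R.toIsometryEquiv z = R z := rfl
    by_cases hz : z = x
    · subst hz
      simp [h1]
    · rw [h1, indicator_of_mem (by simpa using hz), indicator_of_mem (by simpa using hz)]
      exact hrad _ _ (R.norm_map z)
  rw [this]

lemma palmExp_one_le {lam : ℝ} (hlam : 0 < lam) (hI : HasIntensity P lam) (ζ : Plane) :
    palmExp P lam ζ (fun _ => 1) ≤ 1 := by
  rw [palmExp_eq_palmMeasure lam ζ measurable_const, lintegral_one, palmMeasure_apply .univ]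
  calc _ ≤ (ENNReal.ofReal lam)⁻¹ * (ENNReal.ofReal lam * volume unitSquare) := by
        gcongr
        exact campbellMeasure_prod_le hI measurableSet_unitSquare .univ
    _ = 1 := by
        rw [volume_unitSquare, mul_one, ENNReal.inv_mul_cancel (by simpa using hlam)
          ENNReal.ofReal_ne_top]

/-- Multiplication by the probability of the conditioning event. If this is zero, so are both
sides. -/
lemma nearestExp_mul_palmExp {lam : ℝ} (hlam : 0 < lam) (hI : HasIntensity P lam) (ζ : Plane)
    {F : Config → ℝ≥0∞} (hF : Measurable F) :
    nearestExp P lam ζ F * palmExp P lam ζ ((emptyDisk ‖ζ‖).indicator fun _ => 1) =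
      palmExp P lam ζ ((emptyDisk ‖ζ‖).indicator F) := by
  set c := palmExp P lam ζ ((emptyDisk ‖ζ‖).indicator fun _ => 1)
  have hE := measurableSet_emptyDisk ‖ζ‖
  have hc : c ≠ ∞ := ((palmExp_mono lam ζ fun φ => indicator_le_self' (fun _ _ => zero_le) φ).trans
    (palmExp_one_le hlam hI ζ)).trans_lt ENNReal.one_lt_top |>.ne
  by_cases h0 : c = 0
  · have h1 := h0
    simp only [c] at h1
    rw [palmExp_eq lam ζ (measurable_const.indicator hE), lintegral_indicator hE,
      setLIntegral_one] at h1
    rw [h0, mul_zero, palmExp_eq lam ζ (hF.indicator hE), lintegral_indicator hE,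
      Measure.restrict_eq_zero.2 h1, lintegral_zero_measure]
  · exact ENNReal.div_mul_cancel h0 hc

/-- Integrating over the law of the process conditioned on the location of its nearest point,
and over the contact distance, gives the expectation over the process itself. -/
lemma lintegral_nearestExp_mul_contactPDF {ℓ : Plane → ℝ≥0∞} {lam : ℝ} (hlam : 0 < lam)
    (h : RegularLaw ℓ μ lam P) {H : Config → Plane → ℝ≥0∞} (hH : Measurable (Function.uncurry H))
    (hrot : ∀ (R : Plane ≃ₗᵢ[ℝ] Plane) φ x, H (φ.image R.toIsometryEquiv) (R x) = H φ x) :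
    ∫⁻ y in Ioi (0 : ℝ), nearestExp P lam !₂[y, 0] (fun φ => H φ !₂[y, 0]) * contactPDF P y =
      ∫⁻ φ, ∑' u : φ.nearest, H φ u ∂P := by
  rw [lintegral_tsum_nearest hlam h.intensity h.motionInvariant hH hrot]
  refine lintegral_congr_ae ?_
  filter_upwards [contactPDF_ae_eq hlam h, ae_restrict_mem measurableSet_Ioi] with y hy hy0
  have hm : Measurable fun φ => H φ !₂[y, 0] := hH.of_uncurry_right
  have := nearestExp_mul_palmExp hlam h.intensity !₂[y, 0] hm
  rw [norm_axis (mem_Ioi.1 hy0).le] at this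
  rw [hy, mul_left_comm, this]

end Kappa

/-! ### Path loss -/

/-- The properties of the two path loss functions that are used. -/
structure IsPathLoss (α : ℝ) (ℓ : Plane → ℝ≥0∞) : Prop where
  measurable : Measurable ℓ
  antitone : ∀ x y : Plane, ‖x‖ ≤ ‖y‖ → ℓ y ≤ ℓ x
  ne_zero : ∀ x, ℓ x ≠ 0
  ne_top : ∀ x, x ≠ 0 → ℓ x ≠ ∞
  le_rpow : ∀ x, ℓ x ≤ ‖x‖ₑ ^ (-α)
  inv_le : ∀ x, (ℓ x)⁻¹ ≤ 1 + ‖x‖ₑ ^ α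

lemma IsPathLoss.radial {α : ℝ} {ℓ : Plane → ℝ≥0∞} (h : IsPathLoss α ℓ) (x y : Plane)
    (hxy : ‖x‖ = ‖y‖) : ℓ x = ℓ y :=
  le_antisymm (h.antitone _ _ hxy.ge) (h.antitone _ _ hxy.le)

lemma isPathLoss_nonsingular {α : ℝ} (hα : 0 < α) : IsPathLoss α (pathLossNonsingular α) where
  measurable := by unfold pathLossNonsingular; fun_prop
  antitone x y h := by
    unfold pathLossNonsingular
    gcongr
    exact enorm_le_iff_norm_le.2 h
  ne_zero x := ENNReal.inv_ne_zero.2 (ENNReal.add_ne_top.2 ⟨ENNReal.one_ne_top,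
    ENNReal.rpow_ne_top_of_nonneg hα.le enorm_ne_top⟩)
  ne_top x _ := ENNReal.inv_ne_top.2 (by simp)
  le_rpow x := by
    unfold pathLossNonsingular
    rw [ENNReal.rpow_neg]
    exact ENNReal.inv_le_inv.2 le_add_self
  inv_le x := by simp [pathLossNonsingular]

lemma isPathLoss_singular {α : ℝ} (hα : 0 < α) : IsPathLoss α (pathLossSingular α) where
  measurable := by unfold pathLossSingular; fun_prop
  antitone x y h := by
    simp only [pathLossSingular, ENNReal.rpow_neg]
    refine ENNReal.inv_le_inv.2 (ENNReal.rpow_le_rpow ?_ hα.le)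
    exact enorm_le_iff_norm_le.2 h
  ne_zero x := by
    simp only [pathLossSingular, ENNReal.rpow_neg]
    exact ENNReal.inv_ne_zero.2 (ENNReal.rpow_ne_top_of_nonneg hα.le enorm_ne_top)
  ne_top x hx := by
    simp only [pathLossSingular, ENNReal.rpow_neg]
    refine ENNReal.inv_ne_top.2 ?_
    simp [ENNReal.rpow_eq_zero_iff, hx]
  le_rpow x := le_rfl
  inv_le x := by
    simp only [pathLossSingular, ENNReal.rpow_neg, inv_inv]
    exact le_add_self

/-- The integrable weight `(1 + ‖x‖)^(-α)`, which dominates the path loss away from the origin. -/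
def decay (α : ℝ) (x : Plane) : ℝ≥0∞ := ENNReal.ofReal ((1 + ‖x‖) ^ (-α))

lemma measurable_decay (α : ℝ) : Measurable (decay α) := by unfold decay; fun_prop

lemma decay_le_one {α : ℝ} (hα : 0 < α) (x : Plane) : decay α x ≤ 1 := by
  rw [decay, ENNReal.ofReal_le_one]
  exact Real.rpow_le_one_of_one_le_of_nonpos (by simp) (by linarith)

lemma lintegral_decay {α : ℝ} (hα : 2 < α) : ∫⁻ x, decay α x < ∞ := by
  refine (integrable_one_add_norm (E := Plane) (μ := volume) (r := α) ?_).lintegral_lt_top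
  simpa using hα

lemma exists_rpow_le_decay {α : ℝ} (hα : 0 < α) {r : ℝ} (hr : 0 < r) :
    ∃ K : ℝ≥0∞, K < ∞ ∧ ∀ x : Plane, r ≤ ‖x‖ → ‖x‖ₑ ^ (-α) ≤ K * decay α x := by
  refine ⟨ENNReal.ofReal ((1 + 1 / r) ^ α), ENNReal.ofReal_lt_top, fun x hx => ?_⟩
  have hx0 : 0 < ‖x‖ := hr.trans_le hx
  rw [← ofReal_norm, ENNReal.ofReal_rpow_of_pos hx0, decay, ← ENNReal.ofReal_mul (by positivity)]
  refine ENNReal.ofReal_le_ofReal ?_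
  have h1 : 1 + ‖x‖ ≤ (1 + 1 / r) * ‖x‖ := by
    have : 1 ≤ 1 / r * ‖x‖ := by rw [one_div, ← div_eq_inv_mul, one_le_div hr]; exact hx
    linarith
  have h2 : (1 + ‖x‖) ^ α ≤ (1 + 1 / r) ^ α * ‖x‖ ^ α := by
    rw [← Real.mul_rpow (by positivity) hx0.le]
    gcongr
  rw [Real.rpow_neg hx0.le, Real.rpow_neg (by positivity), ← div_eq_mul_inv,
    le_div_iff₀ (by positivity), ← div_eq_inv_mul, div_le_iff₀ (by positivity)]
  exact h2

lemma IsPathLoss.exists_le_decay_mul {α : ℝ} (hα : 0 < α) {ℓ : Plane → ℝ≥0∞}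
    (hℓ : IsPathLoss α ℓ) (y₀ : ℝ) : ∃ K : ℝ≥0∞, K < ∞ ∧ ∀ x u : Plane,
      ‖u‖ ≤ ‖x‖ → ‖u‖ ≤ y₀ → ℓ x ≤ K * decay α x * ℓ u := by
  obtain ⟨K, hK, hKx⟩ := exists_rpow_le_decay hα one_pos
  set c : ℝ≥0∞ := 1 + ENNReal.ofReal y₀ ^ α with hc
  have hcu : ∀ u : Plane, ‖u‖ ≤ y₀ → 1 ≤ c * ℓ u := by
    intro u hu
    have h1 : (ℓ u)⁻¹ ≤ c := (hℓ.inv_le u).trans (by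
      rw [hc]
      gcongr
      rw [← ofReal_norm]
      exact ENNReal.ofReal_le_ofReal hu)
    by_cases h : ℓ u = ∞
    · rw [h, ENNReal.mul_top (by simp [hc])]
      exact le_top
    · calc (1 : ℝ≥0∞) = (ℓ u)⁻¹ * ℓ u := (ENNReal.inv_mul_cancel (hℓ.ne_zero u) h).symm
        _ ≤ c * ℓ u := by gcongr
  have hcT : c < ∞ := by
    rw [hc]
    exact ENNReal.add_lt_top.2 ⟨ENNReal.one_lt_top,
      ENNReal.rpow_lt_top_of_nonneg hα.le ENNReal.ofReal_ne_top⟩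
  refine ⟨K * c + ENNReal.ofReal (2 ^ α), ENNReal.add_lt_top.2 ⟨ENNReal.mul_lt_top hK hcT,
    ENNReal.ofReal_lt_top⟩, fun x u hux hu => ?_⟩
  rcases le_total 1 ‖x‖ with hx | hx
  · calc ℓ x ≤ K * decay α x := (hℓ.le_rpow x).trans (hKx x hx)
      _ ≤ K * decay α x * (c * ℓ u) := le_mul_of_one_le_right zero_le (hcu u hu)
      _ = K * c * decay α x * ℓ u := by ring
      _ ≤ _ := by gcongr; exact le_self_add
  · have h1 : 1 ≤ ENNReal.ofReal (2 ^ α) * decay α x := by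
      rw [decay, ← ENNReal.ofReal_mul (by positivity), ENNReal.one_le_ofReal,
        Real.rpow_neg (by positivity), ← div_eq_mul_inv, one_le_div (by positivity)]
      gcongr
      linarith
    calc ℓ x ≤ ℓ u := hℓ.antitone _ _ hux
      _ ≤ ENNReal.ofReal (2 ^ α) * decay α x * ℓ u := le_mul_of_one_le_left zero_le h1
      _ ≤ _ := by gcongr; exact le_add_self

/-! ### Finiteness and positivity of `κ` -/

lemma rpow_le_one_add_pow (x : ℝ≥0∞) {m : ℝ} (hm : 0 ≤ m) {N : ℕ} (hN : m ≤ N) :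
    x ^ m ≤ (1 + x) ^ N := by
  calc x ^ m ≤ (1 + x) ^ m := ENNReal.rpow_le_rpow le_add_self hm
    _ ≤ (1 + x) ^ (N : ℝ) := ENNReal.rpow_le_rpow_of_exponent_le le_self_add hN
    _ = (1 + x) ^ N := ENNReal.rpow_natCast _ _

lemma add_pow_le_two_pow_mul (x y : ℝ≥0∞) (N : ℕ) : (x + y) ^ N ≤ 2 ^ N * (x ^ N + y ^ N) := by
  calc (x + y) ^ N ≤ (2 * max x y) ^ N := by
        gcongr
        rw [two_mul]
        gcongr
        · exact le_max_left _ _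
        · exact le_max_right _ _
    _ = 2 ^ N * max x y ^ N := mul_pow _ _ _
    _ ≤ _ := by
        gcongr
        rcases le_total x y with h | h
        · rw [max_eq_right h]; exact le_add_self
        · rw [max_eq_left h]; exact le_self_add

lemma FadingCondition.lintegral_pow_lt_top {μ : Measure ℝ} {m a : ℝ} (h : FadingCondition μ m a)
    (n : ℕ) : ∫⁻ t, ENNReal.ofReal t ^ n ∂μ < ∞ := by
  have h1 := (h.moments n).lintegral_lt_top
  refine lt_of_le_of_lt (le_of_eq (lintegral_congr_ae ?_)) h1
  filter_upwards [h.nonneg] with t ht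
  rw [ENNReal.ofReal_pow ht]

lemma palmExp_const_mul {P : Measure Config} (lam : ℝ) (ζ : Plane) {c : ℝ≥0∞} (hc : c ≠ ∞)
    (F : Config → ℝ≥0∞) : palmExp P lam ζ (fun φ => c * F φ) = c * palmExp P lam ζ F := by
  unfold palmExp
  simp only [ENNReal.tsum_mul_left]
  rw [lintegral_const_mul' _ _ hc, mul_div_assoc]

section Finite

variable {P : Measure Config} [IsProbabilityMeasure P] {μ : Measure ℝ} [IsProbabilityMeasure μ]

/-- All moments of the shot noise under the Palm version are bounded, uniformly in its base
point. -/
lemma exists_palmExp_shot_pow_le {lam : ℝ} (hlam : 0 < lam) (hI : HasIntensity P lam)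
    (hB : BoundedMoments P) {m a : ℝ} (hμ : FadingCondition μ m a) {α : ℝ} (hα : 2 < α) (N : ℕ)
    {K b : ℝ≥0∞} (hK : K < ∞) (hb : b < ∞) : ∃ C : ℝ≥0∞, C < ∞ ∧ ∀ ζ,
      palmExp P lam ζ (fun φ =>
        ∫⁻ h, (K * shot (φ.erase ζ) (decay α) h + b) ^ N ∂fadingLaw μ) ≤ C := by
  obtain ⟨C, hC, hCb⟩ := exists_palmExp_tsum_pow_le hlam hI hB (measurable_decay α)
    (decay_le_one (by linarith)) (lintegral_decay hα) N
  set M := ∫⁻ t, ENNReal.ofReal t ^ N ∂μ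
  have hM : M < ∞ := hμ.lintegral_pow_lt_top N
  refine ⟨2 ^ N * (K ^ N * (M * C) + b ^ N), ?_, fun ζ => ?_⟩
  · refine ENNReal.mul_lt_top (ENNReal.pow_lt_top (by simp)) (ENNReal.add_lt_top.2 ⟨?_,
      ENNReal.pow_lt_top hb⟩)
    exact ENNReal.mul_lt_top (ENNReal.pow_lt_top hK) (ENNReal.mul_lt_top hM hC)
  have hXm : Measurable fun φ : Config => ∑' x : (φ.erase ζ).carrier, decay α x :=
    measurable_tsum_points (f := fun p : Config × Plane => decay α p.2)
      (measurable_erase.comp (measurable_id.prodMk measurable_const))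
      ((measurable_decay α).comp measurable_snd)
  calc palmExp P lam ζ (fun φ => ∫⁻ h, (K * shot (φ.erase ζ) (decay α) h + b) ^ N ∂fadingLaw μ)
      ≤ palmExp P lam ζ (fun φ => 2 ^ N * (K ^ N * (M * (∑' x : (φ.erase ζ).carrier,
          decay α x) ^ N) + b ^ N)) := by
        refine palmExp_mono lam ζ fun φ => ?_
        calc ∫⁻ h, (K * shot (φ.erase ζ) (decay α) h + b) ^ N ∂fadingLaw μ
            ≤ ∫⁻ h, 2 ^ N * (K ^ N * shot (φ.erase ζ) (decay α) h ^ N + b ^ N) ∂fadingLaw μ := by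
              refine lintegral_mono fun h => (add_pow_le_two_pow_mul _ _ N).trans ?_
              rw [mul_pow]
          _ = 2 ^ N * (K ^ N * ∫⁻ h, shot (φ.erase ζ) (decay α) h ^ N ∂fadingLaw μ + b ^ N) := by
              have hs := measurable_shot (φ.erase ζ) (decay α)
              rw [lintegral_const_mul _ (by fun_prop), lintegral_add_right _ measurable_const,
                lintegral_const_mul _ (by fun_prop), lintegral_const, measure_univ, mul_one]
          _ ≤ _ := by
              gcongr
              exact lintegral_shot_pow_le _ _ N
    _ = 2 ^ N * (K ^ N * (M * palmExp P lam ζ fun φ => (∑' x : (φ.erase ζ).carrier,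
          decay α x) ^ N) + b ^ N * palmExp P lam ζ fun _ => 1) := by
        rw [palmExp_const_mul _ _ (by simp), palmExp_eq _ _ (by fun_prop),
          lintegral_add_right _ measurable_const, lintegral_const_mul _ (by fun_prop),
          lintegral_const_mul _ (by fun_prop), palmExp_eq _ _ (by fun_prop),
          palmExp_eq _ _ measurable_const, lintegral_const, lintegral_one]
    _ ≤ _ := by
        gcongr
        · exact hCb ζ
        · exact mul_le_of_le_one_right zero_le (palmExp_one_le hlam hI ζ)

/-- The law of `Φ` conditioned on its point nearest to the origin being `ζ`. If the condition has
probability zero, this is the zero measure. -/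
def nearestLaw (P : Measure Config) (lam : ℝ) (ζ : Plane) : Measure Config :=
  (palmExp P lam ζ ((emptyDisk ‖ζ‖).indicator fun _ => 1))⁻¹ •
    (palmLaw P lam ζ).restrict (emptyDisk ‖ζ‖)

lemma nearestExp_eq (lam : ℝ) (ζ : Plane) {F : Config → ℝ≥0∞} (hF : Measurable F) :
    nearestExp P lam ζ F = ∫⁻ φ, F φ ∂nearestLaw P lam ζ := by
  rw [nearestExp, palmExp_eq lam ζ (hF.indicator (measurableSet_emptyDisk _)),
    lintegral_indicator (measurableSet_emptyDisk _), nearestLaw, lintegral_smul_measure,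
    smul_eq_mul, ENNReal.div_eq_inv_mul]

lemma nearestLaw_univ_le (lam : ℝ) (ζ : Plane) : nearestLaw P lam ζ univ ≤ 1 := by
  rw [← lintegral_one, ← nearestExp_eq lam ζ (F := fun _ => 1) measurable_const, nearestExp]
  exact ENNReal.div_self_le_one

/-- A discrete layer cake bound, with weights `(k + 2 + b)^m`. -/
lemma add_rpow_le_tsum {b : ℝ≥0∞} {m : ℝ} (hm : 0 < m) (i : ℝ≥0∞) :
    (i + b) ^ m ≤ (1 + b) ^ m + ∑' k : ℕ, ((k : ℝ≥0∞) + 2 + b) ^ m *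
      (Ioi (k : ℝ≥0∞)).indicator (fun _ => 1) i := by
  by_cases hi : i = ∞
  · subst hi
    refine le_top.trans (le_of_eq (Eq.symm ?_))
    rw [ENNReal.add_eq_top]
    right
    rw [eq_top_iff, ← ENNReal.tsum_const_eq_top_of_ne_zero (α := ℕ) one_ne_zero]
    refine ENNReal.tsum_le_tsum fun k => ?_
    rw [indicator_of_mem (by simp), mul_one]
    refine ENNReal.one_le_rpow ?_ hm
    exact le_add_right (le_add_left one_le_two)
  · lift i to ℝ≥0 using hi
    by_cases h1 : i ≤ 1
    · refine le_add_right (ENNReal.rpow_le_rpow ?_ hm.le)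
      gcongr
      exact_mod_cast h1
    · obtain ⟨k, hk⟩ : ∃ k, ⌈i⌉₊ = k + 1 := Nat.exists_eq_succ_of_ne_zero
        (Nat.ceil_pos.2 (zero_lt_one.trans (not_le.1 h1))).ne'
      have hik : i ≤ k + 1 := by
        have := Nat.le_ceil i
        rw [hk] at this
        exact_mod_cast this
      have hki : (k : ℝ≥0) < i := Nat.lt_ceil.1 (by omega)
      refine le_add_left (le_trans ?_ (ENNReal.le_tsum k))
      rw [indicator_of_mem (by simpa using (by exact_mod_cast hki : ((k : ℝ≥0) : ℝ≥0∞) < i)),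
        mul_one]
      refine ENNReal.rpow_le_rpow ?_ hm.le
      gcongr
      calc (i : ℝ≥0∞) ≤ ((k + 1 : ℝ≥0) : ℝ≥0∞) := by exact_mod_cast hik
        _ ≤ k + 2 := by push_cast; gcongr; exact one_le_two

/-- The converse of `add_rpow_le_tsum` up to the exponent: the sum has at most `⌈i⌉` terms, each of
them at most `(i + 2 + b)^m`. -/
lemma tsum_le_add_pow {b : ℝ≥0∞} {m : ℝ} (hm : 0 < m) {N : ℕ} (hN : m ≤ N) (i : ℝ≥0∞) :
    ∑' k : ℕ, ((k : ℝ≥0∞) + 2 + b) ^ m * (Ioi (k : ℝ≥0∞)).indicator (fun _ => 1) i ≤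
      (i + (2 + b)) ^ (N + 1) := by
  by_cases hi : i = ∞
  · subst hi
    simp
  · lift i to ℝ≥0 using hi
    rw [tsum_eq_sum (s := Finset.range ⌈i⌉₊)]
    · have hterm : ∀ k ∈ Finset.range ⌈i⌉₊, ((k : ℝ≥0∞) + 2 + b) ^ m *
          (Ioi (k : ℝ≥0∞)).indicator (fun _ => 1) (i : ℝ≥0∞) ≤ (i + (2 + b)) ^ N := by
        intro k hk
        have hki : (k : ℝ≥0) < i := Nat.lt_ceil.1 (Finset.mem_range.1 hk)
        have hki' : (k : ℝ≥0∞) ≤ i := by exact_mod_cast hki.le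
        calc _ ≤ ((k : ℝ≥0∞) + 2 + b) ^ m := by
              refine mul_le_of_le_one_right zero_le ?_
              exact indicator_le_self' (fun _ _ => zero_le) _
          _ ≤ (i + (2 + b)) ^ m := by
              refine ENNReal.rpow_le_rpow ?_ hm.le
              rw [← add_assoc]
              gcongr
          _ ≤ (i + (2 + b)) ^ (N : ℝ) := ENNReal.rpow_le_rpow_of_exponent_le
              (le_add_left (le_add_right one_le_two)) hN
          _ = _ := ENNReal.rpow_natCast _ _
      refine (Finset.sum_le_sum hterm).trans ?_
      rw [Finset.sum_const, Finset.card_range, nsmul_eq_mul, pow_succ']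
      gcongr
      have h2 : (⌈i⌉₊ : ℝ≥0) ≤ i + 1 := (Nat.ceil_lt_add_one zero_le).le
      calc (⌈i⌉₊ : ℝ≥0∞) ≤ i + 1 := by exact_mod_cast h2
        _ ≤ i + (2 + b) := by gcongr; exact le_add_right one_le_two
    · intro k hk
      rw [Finset.mem_range, not_lt, Nat.ceil_le] at hk
      rw [indicator_of_notMem, mul_zero]
      simp only [mem_Ioi, not_lt]
      exact_mod_cast hk

end Finite

/-- The integrand `a ℓ(u)^(-m) (i + W)^m` of `κ`: the limit of `θ^(-m)` times the probability that
the SINR is below `θ` if the serving station is `u` and the interference is `i`. -/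
def outageWeight (ℓ : Plane → ℝ≥0∞) (W m a : ℝ) (u : Plane) (i : ℝ≥0∞) : ℝ≥0∞ :=
  ENNReal.ofReal a * ℓ u ^ (-m) * (i + ENNReal.ofReal W) ^ m

lemma measurable_outageWeight {ℓ : Plane → ℝ≥0∞} (hℓ : Measurable ℓ) (W m a : ℝ) :
    Measurable (Function.uncurry (outageWeight ℓ W m a)) := by
  have : Function.uncurry (outageWeight ℓ W m a) = fun p : Plane × ℝ≥0∞ =>
    ENNReal.ofReal a * ℓ p.1 ^ (-m) * (p.2 + ENNReal.ofReal W) ^ m := rfl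
  rw [this]
  fun_prop

lemma outageWeight_radial {ℓ : Plane → ℝ≥0∞} (hℓ : ∀ x y : Plane, ‖x‖ = ‖y‖ → ℓ x = ℓ y)
    (W m a : ℝ) (x y : Plane) (h : ‖x‖ = ‖y‖) :
    outageWeight ℓ W m a x = outageWeight ℓ W m a y := by
  funext i
  rw [outageWeight, outageWeight, hℓ x y h]

/-- Only an inequality, as `contactPDF` is the density of the absolutely continuous part of the law
of the contact distance. -/
lemma lintegral_comp_infDist_le {P : Measure Config} {g : ℝ → ℝ≥0∞} (hg : Measurable g) :
    ∫⁻ y, g y * contactPDF P y ≤ ∫⁻ φ, g (Metric.infDist 0 φ.carrier) ∂P := by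
  rw [← lintegral_map hg measurable_infDist]
  set ν := P.map fun φ : Config => Metric.infDist 0 φ.carrier
  have hpdf : contactPDF P = ν.rnDeriv volume := rfl
  calc ∫⁻ y, g y * contactPDF P y = ∫⁻ y, (contactPDF P * g) y := by simp [mul_comm]
    _ = ∫⁻ y, g y ∂volume.withDensity (ν.rnDeriv volume) := by
        rw [hpdf, lintegral_withDensity_eq_lintegral_mul _ (Measure.measurable_rnDeriv _ _) hg]
    _ ≤ ∫⁻ y, g y ∂ν := lintegral_mono' (Measure.withDensity_rnDeriv_le _ _) le_rfl

section Kappa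

variable {P : Measure Config} [IsProbabilityMeasure P] {μ : Measure ℝ} [IsProbabilityMeasure μ]
  {ℓ : Plane → ℝ≥0∞} {α W m a lam : ℝ}

lemma kappa_eq (ℓ : Plane → ℝ≥0∞) (μ : Measure ℝ) (W m a lam : ℝ) (P : Measure Config) :
    kappa ℓ μ W m a lam P = ∫⁻ y in Ioi (0 : ℝ), nearestExp P lam !₂[y, 0]
      (fun φ => fadingExp μ ℓ (outageWeight ℓ W m a) φ !₂[y, 0]) * contactPDF P y := rfl

/-- `κ` as an expectation over the point process. -/
lemma kappa_eq_lintegral (hlam : 0 < lam) (h : RegularLaw ℓ μ lam P) (hℓ : IsPathLoss α ℓ) :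
    kappa ℓ μ W m a lam P =
      ∫⁻ φ, ∑' u : φ.nearest, fadingExp μ ℓ (outageWeight ℓ W m a) φ u ∂P := by
  rw [kappa_eq]
  exact lintegral_nearestExp_mul_contactPDF hlam h
    (measurable_fadingExp hℓ.measurable (measurable_outageWeight hℓ.measurable W m a))
    (fun R φ x => fadingExp_rotate hℓ.radial
      (fun u => (measurable_outageWeight hℓ.measurable W m a).of_uncurry_left)
      (outageWeight_radial hℓ.radial W m a) R φ x)

lemma shot_erase (φ : Config) (ζ : Plane) (g : Plane → ℝ≥0∞) (h : Plane → ℝ) :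
    shot (φ.erase ζ) g h = shot φ (({ζ}ᶜ : Set Plane).indicator g) h := shot_inter φ _ g h

/-- The fading is almost surely positive, since `F_h(t) → 0` as `t ↓ 0`. -/
lemma FadingCondition.measure_Iic_zero {μ : Measure ℝ} [IsProbabilityMeasure μ]
    (h : FadingCondition μ m a) : μ (Iic 0) = 0 := by
  have h1 : Tendsto (fun t : ℝ => a * t ^ m) (𝓝[>] 0) (𝓝 0) := by
    have : Tendsto (fun t : ℝ => a * t ^ m) (𝓝 0) (𝓝 (a * 0 ^ m)) :=
      ((Real.continuousAt_rpow_const 0 m (Or.inr h.m_pos.le)).const_mul a)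
    rw [Real.zero_rpow h.m_pos.ne', mul_zero] at this
    exact this.mono_left nhdsWithin_le_nhds
  have h2 : Tendsto (fun t => cdf μ t) (𝓝[>] (0 : ℝ)) (𝓝 0) := h.near_zero.symm.tendsto_nhds h1
  have h3 : cdf μ 0 ≤ 0 := ge_of_tendsto h2 (by
    filter_upwards [self_mem_nhdsWithin] with t ht
    exact monotone_cdf μ (mem_Ioi.1 ht).le)
  rw [← ofReal_cdf, ENNReal.ofReal_eq_zero]
  exact h3

lemma lintegral_weight_contactPDF_lt_top
    (hc : ∀ n : ℕ, ∫⁻ φ, Metric.infEDist 0 φ.carrier ^ n ∂P < ∞) (hα : 0 < α) (hm : 0 < m) :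
    ∫⁻ y, (1 + ENNReal.ofReal y ^ α) ^ m * contactPDF P y < ∞ := by
  obtain ⟨N, hN⟩ := exists_nat_ge m
  obtain ⟨A, hA⟩ := exists_nat_ge α
  refine (lintegral_comp_infDist_le (by fun_prop)).trans_lt ?_
  have hb : ∀ x : ℝ≥0∞, (1 + x ^ α) ^ m ≤ 3 ^ N * (2 ^ (A * N) * (1 + x ^ (A * N))) := by
    intro x
    have h1 : (1 : ℝ≥0∞) ≤ (1 + x) ^ A := one_le_pow₀ le_self_add
    calc (1 + x ^ α) ^ m ≤ (1 + (1 + x ^ α)) ^ N := rpow_le_one_add_pow _ hm.le hN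
      _ ≤ ((1 + x) ^ A + ((1 + x) ^ A + (1 + x) ^ A)) ^ N := by
          gcongr
          exact rpow_le_one_add_pow _ hα.le hA
      _ = 3 ^ N * (1 + x) ^ (A * N) := by
          rw [pow_mul, ← mul_pow]; congr 1; ring
      _ ≤ _ := by
          gcongr
          simpa using add_pow_le_two_pow_mul 1 x (A * N)
  calc ∫⁻ φ, (1 + ENNReal.ofReal (Metric.infDist 0 φ.carrier) ^ α) ^ m ∂P
      ≤ ∫⁻ φ, 3 ^ N * (2 ^ (A * N) * (1 + Metric.infEDist 0 φ.carrier ^ (A * N))) ∂P := by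
        refine lintegral_mono fun φ => le_trans ?_ (hb _)
        gcongr
        exact ENNReal.ofReal_toReal_le
    _ = 3 ^ N * (2 ^ (A * N) * (1 + ∫⁻ φ, Metric.infEDist 0 φ.carrier ^ (A * N) ∂P)) := by
        have := measurable_infEDist
        rw [lintegral_const_mul _ (by fun_prop), lintegral_const_mul _ (by fun_prop),
          lintegral_add_left measurable_const, lintegral_const, measure_univ, mul_one]
    _ < ∞ := by
        refine ENNReal.mul_lt_top (ENNReal.pow_lt_top (by simp)) (ENNReal.mul_lt_top
          (ENNReal.pow_lt_top (by simp)) (ENNReal.add_lt_top.2 ⟨by simp, hc _⟩))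

/-- If all stations are at least as far away as the nearest station `ζ`, and `ζ` is not too far
away, the weight is bounded by a power of an integrable shot noise. -/
lemma exists_outageWeight_le (hα : 0 < α) (hℓ : IsPathLoss α ℓ) (hm : 0 < m) (W a y₀ : ℝ) {N : ℕ}
    (hN : m ≤ N) : ∃ K b : ℝ≥0∞, K < ∞ ∧ b < ∞ ∧ ∀ (ζ : Plane) (φ : Config) (h : Plane → ℝ),
      ζ ≠ 0 → ‖ζ‖ ≤ y₀ → φ ∈ emptyDisk ‖ζ‖ →
        outageWeight ℓ W m a ζ (interference ℓ (φ.carrier \ {ζ}) h) ≤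
          ENNReal.ofReal a * (K * shot (φ.erase ζ) (decay α) h + b) ^ N := by
  obtain ⟨K, hK, hKx⟩ := hℓ.exists_le_decay_mul hα y₀
  set b : ℝ≥0∞ := ENNReal.ofReal W * (1 + ENNReal.ofReal y₀ ^ α) with hb
  have hbT : b < ∞ := ENNReal.mul_lt_top ENNReal.ofReal_lt_top (ENNReal.add_lt_top.2
    ⟨ENNReal.one_lt_top, ENNReal.rpow_lt_top_of_nonneg hα.le ENNReal.ofReal_ne_top⟩)
  refine ⟨K, 1 + b, hK, ENNReal.add_lt_top.2 ⟨ENNReal.one_lt_top, hbT⟩,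
    fun ζ φ h hζ hζy hφ => ?_⟩
  have h0 := hℓ.ne_zero ζ
  have hT := hℓ.ne_top ζ hζ
  have hI : interference ℓ (φ.carrier \ {ζ}) h ≤ ℓ ζ * (K * shot (φ.erase ζ) (decay α) h) := by
    rw [← mul_assoc, ← shot_const_mul, interference_diff, ← shot_erase]
    refine shot_mono _ (fun x hx => ?_) h
    have hxφ : x ∈ φ.carrier := (Config.erase_carrier φ ζ ▸ hx : x ∈ φ.carrier \ {ζ}).1
    have hxn : ‖ζ‖ ≤ ‖x‖ := by
      by_contra hlt
      have : x ∈ φ.carrier ∩ Metric.ball 0 ‖ζ‖ := ⟨hxφ, by simpa using hlt⟩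
      rw [show φ.carrier ∩ Metric.ball 0 ‖ζ‖ = ∅ from hφ] at this
      exact this
    refine (hKx x ζ hxn hζy).trans (le_of_eq (by ring))
  have hWb : (ℓ ζ)⁻¹ * ENNReal.ofReal W ≤ b := by
    rw [hb, mul_comm]
    gcongr
    refine (hℓ.inv_le ζ).trans ?_
    gcongr
    rw [← ofReal_norm]
    exact ENNReal.ofReal_le_ofReal hζy
  rw [outageWeight, mul_assoc, ENNReal.rpow_neg, ← ENNReal.inv_rpow,
    ← ENNReal.mul_rpow_of_nonneg _ _ hm.le]
  gcongr
  calc ((ℓ ζ)⁻¹ * (interference ℓ (φ.carrier \ {ζ}) h + ENNReal.ofReal W)) ^ m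
      ≤ (K * shot (φ.erase ζ) (decay α) h + b) ^ m := by
        refine ENNReal.rpow_le_rpow ?_ hm.le
        rw [mul_add]
        refine add_le_add ?_ hWb
        calc _ ≤ (ℓ ζ)⁻¹ * (ℓ ζ * (K * shot (φ.erase ζ) (decay α) h)) := by gcongr
          _ = _ := by rw [← mul_assoc, ENNReal.inv_mul_cancel h0 hT, one_mul]
    _ ≤ (1 + (K * shot (φ.erase ζ) (decay α) h + b)) ^ N := rpow_le_one_add_pow _ hm.le hN
    _ = _ := by congr 1; ring

/-- Conditioned on the nearest station being at a large distance, the moments of the interference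
are bounded: the discrete layer cake formula expresses them by tail probabilities, to which the
assumed domination applies, and beyond `b(o, ‖ζ‖ / 2)` the path loss is at most a multiple of
`decay`. -/
lemma exists_nearestExp_interference_le (hlam : 0 < lam) (h : RegularLaw ℓ μ lam P)
    (hμ : FadingCondition μ m a) (hα : 2 < α) (hℓ : IsPathLoss α ℓ) (W : ℝ) :
    ∃ y₀ : ℝ, ∃ C : ℝ≥0∞, C < ∞ ∧ ∀ ζ : Plane, y₀ < ‖ζ‖ →
      nearestExp P lam ζ (fun φ => fadingExp μ ℓ (fun _ i => (i + ENNReal.ofReal W) ^ m) φ ζ) ≤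
        C := by
  obtain ⟨y₀, hy₀, hdom⟩ := h.dominance
  obtain ⟨N, hN⟩ := exists_nat_ge m
  obtain ⟨K, hK, hKx⟩ := exists_rpow_le_decay (α := α) (by linarith) (half_pos hy₀)
  set b := ENNReal.ofReal W
  obtain ⟨C, hC, hCb⟩ := exists_palmExp_shot_pow_le hlam h.intensity h.boundedMoments hμ hα
    (N + 1) hK (b := 2 + b) (ENNReal.add_lt_top.2 ⟨by simp, ENNReal.ofReal_lt_top⟩)
  refine ⟨y₀, (1 + b) ^ m + C, ENNReal.add_lt_top.2 ⟨ENNReal.rpow_lt_top_of_nonneg hμ.m_pos.le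
    (by simp [b]), hC⟩, fun ζ hζ => ?_⟩
  -- `G k` and `G' k` are the conditional probabilities, given the pattern, that the interference
  -- exceeds `k`, with and without the stations in `b(o, ‖ζ‖ / 2)`.
  set w : ℕ → ℝ≥0∞ := fun k => ((k : ℝ≥0∞) + 2 + b) ^ m with hw
  set G : ℕ → Config → ℝ≥0∞ := fun k φ =>
    fadingLaw μ {h | (k : ℝ≥0∞) < interference ℓ (φ.carrier \ {ζ}) h} with hG
  set S : Set Plane := (Metric.ball 0 (‖ζ‖ / 2))ᶜ with hS
  set G' : ℕ → Config → ℝ≥0∞ := fun k φ =>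
    fadingLaw μ {h | (k : ℝ≥0∞) < interference ℓ ((φ.carrier ∩ S) \ {ζ}) h} with hG'
  have hSm : MeasurableSet S := Metric.isOpen_ball.measurableSet.compl
  have hgm : Measurable (({ζ}ᶜ : Set Plane).indicator ℓ) :=
    hℓ.measurable.indicator (measurableSet_singleton ζ).compl
  have hgm' : Measurable ((S ∩ {ζ}ᶜ).indicator ℓ) :=
    hℓ.measurable.indicator (hSm.inter (measurableSet_singleton ζ).compl)
  have hGs : ∀ k φ, G k φ = ∫⁻ h, (Ioi (k : ℝ≥0∞)).indicator (fun _ => 1)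
      (shot φ (({ζ}ᶜ : Set Plane).indicator ℓ) h) ∂fadingLaw μ := by
    intro k φ
    simp only [hG, interference_diff]
    exact (lintegral_indicator_one (measurableSet_lt measurable_const (measurable_shot _ _))).symm
  have hGs' : ∀ k φ, G' k φ = ∫⁻ h, (Ioi (k : ℝ≥0∞)).indicator (fun _ => 1)
      (shot φ ((S ∩ {ζ}ᶜ).indicator ℓ) h) ∂fadingLaw μ := by
    intro k φ
    simp only [hG', sdiff_eq, inter_assoc, interference_inter]
    exact (lintegral_indicator_one (measurableSet_lt measurable_const (measurable_shot _ _))).symm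
  have hind : ∀ k : ℕ, Measurable ((Ioi (k : ℝ≥0∞)).indicator fun _ => (1 : ℝ≥0∞)) :=
    fun k => measurable_const.indicator measurableSet_Ioi
  have hGm : ∀ k, Measurable (G k) := by
    intro k
    rw [show G k = _ from funext (hGs k)]
    exact measurable_lintegral_shot (Φ := fun φ : Config => φ) measurable_id
      (g := fun _ => ({ζ}ᶜ : Set Plane).indicator ℓ) (hgm.comp measurable_snd)
      (Ψ := fun _ => (Ioi (k : ℝ≥0∞)).indicator fun _ => 1) ((hind k).comp measurable_snd)
  have hGm' : ∀ k, Measurable (G' k) := by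
    intro k
    rw [show G' k = _ from funext (hGs' k)]
    exact measurable_lintegral_shot (Φ := fun φ : Config => φ) measurable_id
      (g := fun _ => (S ∩ {ζ}ᶜ).indicator ℓ) (hgm'.comp measurable_snd)
      (Ψ := fun _ => (Ioi (k : ℝ≥0∞)).indicator fun _ => 1) ((hind k).comp measurable_snd)
  have hFm : Measurable fun φ => fadingExp μ ℓ (fun _ i => (i + b) ^ m) φ ζ :=
    Measurable.of_uncurry_right (f := fadingExp μ ℓ fun _ i => (i + b) ^ m)
      (measurable_fadingExp hℓ.measurable (by
        change Measurable fun p : Plane × ℝ≥0∞ => (p.2 + b) ^ m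
        fun_prop))
  have hFle : ∀ φ, fadingExp μ ℓ (fun _ i => (i + b) ^ m) φ ζ ≤
      (1 + b) ^ m + ∑' k, w k * G k φ := by
    intro φ
    have hterm : ∀ k : ℕ, Measurable fun h : Plane → ℝ => (Ioi (k : ℝ≥0∞)).indicator
        (fun _ => (1 : ℝ≥0∞)) (shot φ (({ζ}ᶜ : Set Plane).indicator ℓ) h) :=
      fun k => (hind k).comp (measurable_shot _ _)
    calc fadingExp μ ℓ (fun _ i => (i + b) ^ m) φ ζ
        ≤ ∫⁻ h, ((1 + b) ^ m + ∑' k, w k * (Ioi (k : ℝ≥0∞)).indicator (fun _ => 1)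
            (shot φ (({ζ}ᶜ : Set Plane).indicator ℓ) h)) ∂fadingLaw μ := by
          refine lintegral_mono fun h => ?_
          simp only [interference_diff]
          exact add_rpow_le_tsum hμ.m_pos _
      _ = (1 + b) ^ m + ∑' k, w k * G k φ := by
          rw [lintegral_add_left measurable_const, lintegral_const, measure_univ, mul_one,
            lintegral_tsum fun k => ((hterm k).const_mul _).aemeasurable]
          congr 1
          refine tsum_congr fun k => ?_
          rw [hGs, lintegral_const_mul _ (hterm k)]
  calc nearestExp P lam ζ (fun φ => fadingExp μ ℓ (fun _ i => (i + b) ^ m) φ ζ)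
      ≤ ∫⁻ φ, ((1 + b) ^ m + ∑' k, w k * G k φ) ∂nearestLaw P lam ζ := by
        rw [nearestExp_eq lam ζ hFm]
        exact lintegral_mono hFle
    _ = (1 + b) ^ m * nearestLaw P lam ζ univ + ∑' k, w k * nearestExp P lam ζ (G k) := by
        rw [lintegral_add_left measurable_const, lintegral_const,
          lintegral_tsum fun k => ((hGm k).const_mul _).aemeasurable]
        congr 1
        refine tsum_congr fun k => ?_
        rw [lintegral_const_mul _ (hGm k), nearestExp_eq lam ζ (hGm k)]
    _ ≤ (1 + b) ^ m + ∑' k, w k * palmExp P lam ζ (G' k) := by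
        refine add_le_add (mul_le_of_le_one_right zero_le (nearestLaw_univ_le lam ζ)) ?_
        refine ENNReal.tsum_le_tsum fun k => ?_
        gcongr
        have := hdom ζ hζ k
        simpa only [ENNReal.coe_natCast] using this
    _ ≤ (1 + b) ^ m + C := by
        refine add_le_add_right (le_trans (le_of_eq ?_) (le_trans (palmExp_mono lam ζ
          (F := fun φ => ∑' k, w k * G' k φ) ?_) (hCb ζ))) _
        · rw [palmExp_eq lam ζ (Measurable.tsum fun k => (hGm' k).const_mul _),
            lintegral_tsum fun k => ((hGm' k).const_mul _).aemeasurable]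
          refine tsum_congr fun k => ?_
          rw [lintegral_const_mul _ (hGm' k), palmExp_eq lam ζ (hGm' k)]
        · intro φ
          have hterm : ∀ k : ℕ, Measurable fun h : Plane → ℝ => (Ioi (k : ℝ≥0∞)).indicator
              (fun _ => (1 : ℝ≥0∞)) (shot φ ((S ∩ {ζ}ᶜ).indicator ℓ) h) :=
            fun k => (hind k).comp (measurable_shot _ _)
          calc ∑' k, w k * G' k φ = ∫⁻ h, ∑' k, w k * (Ioi (k : ℝ≥0∞)).indicator (fun _ => 1)
                (shot φ ((S ∩ {ζ}ᶜ).indicator ℓ) h) ∂fadingLaw μ := by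
                rw [lintegral_tsum fun k => ((hterm k).const_mul _).aemeasurable]
                refine tsum_congr fun k => ?_
                rw [hGs', lintegral_const_mul _ (hterm k)]
            _ ≤ _ := by
                refine lintegral_mono fun h => (tsum_le_add_pow hμ.m_pos hN _).trans ?_
                gcongr
                rw [← shot_const_mul, shot_erase]
                refine shot_mono φ (fun x _ => ?_) h
                by_cases hx : x ∈ S ∩ {ζ}ᶜ
                · rw [indicator_of_mem hx, indicator_of_mem hx.2]
                  refine (hℓ.le_rpow x).trans (hKx x ?_)
                  have h1 : ‖ζ‖ / 2 ≤ ‖x‖ := by simpa [hS] using hx.1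
                  linarith
                · rw [indicator_of_notMem hx]
                  exact zero_le

/-- Beyond a distance `y₀` of the nearest station, `ℓ(y)^(-m) ≤ (1 + y^α)^m` is integrable against
the density of the contact distance and the remaining factor is bounded. Up to `y₀` the whole
integrand is bounded. -/
lemma kappa_lt_top (hlam : 0 < lam) (h : RegularLaw ℓ μ lam P) (hμ : FadingCondition μ m a)
    (hα : 2 < α) (hℓ : IsPathLoss α ℓ) (W : ℝ) : kappa ℓ μ W m a lam P < ∞ := by
  have hα0 : 0 < α := by linarith
  obtain ⟨N, hN⟩ := exists_nat_ge m
  obtain ⟨y₀, C₂, hC₂, hlarge⟩ := exists_nearestExp_interference_le hlam h hμ hα hℓ W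
  obtain ⟨K, b, hK, hb, hsmall⟩ := exists_outageWeight_le hα0 hℓ hμ.m_pos W a y₀ hN
  obtain ⟨C₁, hC₁, hC₁b⟩ := exists_palmExp_shot_pow_le hlam h.intensity h.boundedMoments hμ hα N
    hK hb
  have hFm : ∀ ζ, Measurable fun φ => fadingExp μ ℓ (outageWeight ℓ W m a) φ ζ := fun ζ =>
    Measurable.of_uncurry_right (f := fadingExp μ ℓ (outageWeight ℓ W m a))
      (measurable_fadingExp hℓ.measurable (measurable_outageWeight hℓ.measurable W m a))
  set c₁ : ℝ≥0∞ := ENNReal.ofReal (2 * Real.pi * lam * y₀) * (ENNReal.ofReal a * C₁) with hc₁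
  set c₂ : ℝ≥0∞ := ENNReal.ofReal a * C₂ with hc₂
  have hpt : ∀ᵐ y ∂volume.restrict (Ioi (0 : ℝ)), nearestExp P lam !₂[y, 0]
      (fun φ => fadingExp μ ℓ (outageWeight ℓ W m a) φ !₂[y, 0]) * contactPDF P y ≤
        (Iic y₀).indicator (fun _ => c₁) y +
          c₂ * ((1 + ENNReal.ofReal y ^ α) ^ m * contactPDF P y) := by
    filter_upwards [contactPDF_ae_eq hlam h, ae_restrict_mem measurableSet_Ioi] with y hy hy0
    have hy0 : 0 < y := hy0
    have hn : ‖(!₂[y, 0] : Plane)‖ = y := norm_axis hy0.le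
    have hne : (!₂[y, 0] : Plane) ≠ 0 := by
      rw [← norm_ne_zero_iff, hn]
      exact hy0.ne'
    by_cases hyy : y ≤ y₀
    -- The conditioning probability may be small here, but it cancels against the density.
    · refine le_add_right ?_
      have h1 := nearestExp_mul_palmExp hlam h.intensity !₂[y, 0] (hFm !₂[y, 0])
      rw [hn] at h1
      rw [hy, mul_left_comm, h1, indicator_of_mem (by exact hyy), hc₁]
      gcongr
      calc palmExp P lam !₂[y, 0] ((emptyDisk y).indicator fun φ =>
            fadingExp μ ℓ (outageWeight ℓ W m a) φ !₂[y, 0])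
          ≤ palmExp P lam !₂[y, 0] (fun φ => ENNReal.ofReal a * ∫⁻ h,
              (K * shot (φ.erase !₂[y, 0]) (decay α) h + b) ^ N ∂fadingLaw μ) := by
            refine palmExp_mono lam _ (fun φ => ?_)
            refine (indicator_le (f := fun φ => fadingExp μ ℓ (outageWeight ℓ W m a) φ !₂[y, 0])
              (g := fun φ => ENNReal.ofReal a * ∫⁻ h, (K * shot (φ.erase !₂[y, 0]) (decay α) h +
                b) ^ N ∂fadingLaw μ) fun φ hφ => ?_) φ
            have hs := measurable_shot (φ.erase !₂[y, 0]) (decay α)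
            rw [← lintegral_const_mul _ (by fun_prop)]
            exact lintegral_mono fun h => hsmall _ φ h hne (hn.trans_le hyy) (hn.symm ▸ hφ)
        _ ≤ ENNReal.ofReal a * C₁ := by
            rw [palmExp_const_mul _ _ ENNReal.ofReal_ne_top]
            gcongr
            exact hC₁b _
    · refine le_add_left ?_
      rw [← mul_assoc]
      gcongr
      have hfe : (fun φ => fadingExp μ ℓ (outageWeight ℓ W m a) φ !₂[y, 0]) = fun φ =>
          (ENNReal.ofReal a * ℓ !₂[y, 0] ^ (-m)) *
            fadingExp μ ℓ (fun _ i => (i + ENNReal.ofReal W) ^ m) φ !₂[y, 0] := by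
        funext φ
        rw [fadingExp, fadingExp, ← lintegral_const_mul]
        · rfl
        · simp only [interference_diff]
          have := measurable_shot φ (({!₂[y, 0]}ᶜ : Set Plane).indicator ℓ)
          fun_prop
      have hFm' : Measurable fun φ =>
          fadingExp μ ℓ (fun _ i => (i + ENNReal.ofReal W) ^ m) φ !₂[y, 0] :=
        Measurable.of_uncurry_right (f := fadingExp μ ℓ fun _ i => (i + ENNReal.ofReal W) ^ m)
          (measurable_fadingExp hℓ.measurable (by
            change Measurable fun p : Plane × ℝ≥0∞ => (p.2 + ENNReal.ofReal W) ^ m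
            fun_prop))
      rw [hfe, nearestExp_eq lam _ (hFm'.const_mul _), lintegral_const_mul _ hFm',
        ← nearestExp_eq lam _ hFm', hc₂]
      calc ENNReal.ofReal a * ℓ !₂[y, 0] ^ (-m) * nearestExp P lam !₂[y, 0] (fun φ =>
            fadingExp μ ℓ (fun _ i => (i + ENNReal.ofReal W) ^ m) φ !₂[y, 0])
          ≤ ENNReal.ofReal a * (1 + ENNReal.ofReal y ^ α) ^ m * C₂ := by
            gcongr
            · rw [ENNReal.rpow_neg, ← ENNReal.inv_rpow]
              refine ENNReal.rpow_le_rpow ((hℓ.inv_le _).trans ?_) hμ.m_pos.le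
              rw [← ofReal_norm, hn]
            · exact hlarge _ (by rw [hn]; exact not_le.1 hyy)
        _ = _ := by ring
  rw [kappa_eq]
  refine (lintegral_mono_ae hpt).trans_lt ?_
  rw [lintegral_add_left (measurable_const.indicator measurableSet_Iic),
    lintegral_indicator measurableSet_Iic, setLIntegral_const,
    Measure.restrict_apply measurableSet_Iic, Iic_inter_Ioi, Real.volume_Ioc,
    lintegral_const_mul' _ _ (ENNReal.mul_lt_top ENNReal.ofReal_lt_top hC₂).ne]
  refine ENNReal.add_lt_top.2 ⟨?_, ?_⟩
  · exact ENNReal.mul_lt_top (ENNReal.mul_lt_top ENNReal.ofReal_lt_top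
      (ENNReal.mul_lt_top ENNReal.ofReal_lt_top hC₁)) ENNReal.ofReal_lt_top
  · refine ENNReal.mul_lt_top (ENNReal.mul_lt_top ENNReal.ofReal_lt_top hC₂) ?_
    exact (setLIntegral_le_lintegral _ _).trans_lt
      (lintegral_weight_contactPDF_lt_top h.contactMoments hα0 hμ.m_pos)

/-- If `κ = 0`, the interference vanishes almost surely. As the fading and the path loss are
positive, the nearest station is then the only one, while the expected number of points is
infinite. -/
lemma kappa_pos (hlam : 0 < lam) (h : RegularLaw ℓ μ lam P) (hμ : FadingCondition μ m a)
    (hℓ : IsPathLoss α ℓ) (W : ℝ) : 0 < kappa ℓ μ W m a lam P := by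
  refine pos_iff_ne_zero.2 fun h0 => ?_
  have hm := measurable_onNearest
    (measurable_fadingExp (μ := μ) hℓ.measurable (measurable_outageWeight hℓ.measurable W m a))
  rw [kappa_eq_lintegral hlam h hℓ] at h0
  simp only [tsum_nearest] at h0
  have hm' : Measurable fun φ : Config => ∑' u : φ.carrier,
      onNearest (fadingExp μ ℓ (outageWeight ℓ W m a)) φ u :=
    measurable_tsum_points (Φ := fun φ : Config => φ) measurable_id hm
  rw [lintegral_eq_zero_iff hm'] at h0
  have hone : ∀ᵐ φ ∂P, φ.count univ ≤ 1 := by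
    filter_upwards [h0, h.ae_nearest] with φ hφ ⟨u, hu0, hu, hs⟩
    rw [Pi.zero_apply] at hφ
    have hφ' : ∑' u : φ.nearest, fadingExp μ ℓ (outageWeight ℓ W m a) φ u = 0 :=
      (tsum_nearest _ φ).trans hφ
    rw [hs, tsum_singleton u fun u => fadingExp μ ℓ (outageWeight ℓ W m a) φ u, fadingExp,
      lintegral_eq_zero_iff (by
        simp only [interference_diff]
        exact ((measurable_outageWeight hℓ.measurable W m a).of_uncurry_left).comp
          (measurable_shot φ (({u}ᶜ : Set Plane).indicator ℓ)))] at hφ'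
    have hsub : φ.carrier ⊆ {u} := by
      intro x hx
      by_contra hxu
      have hpos : ∀ᵐ h' ∂fadingLaw μ, 0 < h' x := by
        have hmx : Measurable fun h' : Plane → ℝ =>
            (Iic (0 : ℝ)).indicator (fun _ => (1 : ℝ≥0∞)) (h' x) :=
          (measurable_const.indicator measurableSet_Iic).comp (measurable_pi_apply x)
        have := lintegral_eval_fadingLaw (μ := μ) x (f := (Iic (0 : ℝ)).indicator fun _ => 1)
          (measurable_const.indicator measurableSet_Iic)
        rw [lintegral_indicator measurableSet_Iic, setLIntegral_one, hμ.measure_Iic_zero,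
          lintegral_eq_zero_iff hmx] at this
        filter_upwards [this] with h' hh'
        by_contra hle
        rw [indicator_of_mem (by exact not_lt.1 hle)] at hh'
        exact one_ne_zero hh'
      obtain ⟨h', hh', hx'⟩ := (hφ'.and hpos).exists
      have hint : interference ℓ (φ.carrier \ {u}) h' ≠ 0 := by
        intro hz
        have := ENNReal.tsum_eq_zero.1 hz ⟨x, hx, hxu⟩
        rw [mul_eq_zero, ENNReal.ofReal_eq_zero] at this
        rcases this with h1 | h1
        · exact absurd hx' (not_lt.2 h1)
        · exact hℓ.ne_zero x h1
      simp only [outageWeight, Pi.zero_apply, mul_eq_zero, ENNReal.ofReal_eq_zero,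
        ENNReal.rpow_eq_zero_iff] at hh'
      have := hμ.a_pos
      have := hμ.m_pos
      have := hℓ.ne_zero u
      have := hℓ.ne_top u hu0
      rcases hh' with (h1 | ⟨h1, -⟩ | ⟨h1, -⟩) | ⟨h1, -⟩ | ⟨-, h1⟩
      · linarith
      · contradiction
      · contradiction
      · exact hint (add_eq_zero.1 h1).1
      · linarith
    rw [Config.count, inter_univ]
    exact_mod_cast (encard_le_encard hsub).trans_eq (encard_singleton u)
  have h1 := h.intensity univ .univ
  rw [measure_univ_of_isAddLeftInvariant, ENNReal.mul_top (by simpa using hlam)] at h1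
  have h2 := lintegral_mono_ae hone
  rw [h1, lintegral_one, measure_univ] at h2
  exact absurd h2 (by simp)

end Kappa

/-! ### The Poisson process: uniqueness in law -/

lemma measurableSet_counts {ι : Type*} [Countable ι] {D : ι → Set Plane}
    (hD : ∀ i, MeasurableSet (D i)) (k : ι → ℕ) :
    MeasurableSet {φ : Config | ∀ i, φ.count (D i) = k i} := by
  have : {φ : Config | ∀ i, φ.count (D i) = k i} = ⋂ i, {φ : Config | φ.count (D i) = k i} := by
    ext; simp
  rw [this]
  exact .iInter fun i => measurable_count (hD i) (measurableSet_singleton _)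

/-- The event that the patterns have prescribed numbers of points in the sets of a list. -/
def countEvent (L : List (Set Plane × ℕ)) : Set Config := {φ | ∀ p ∈ L, φ.count p.1 = p.2}

/-- The counting events of lists of bounded Borel sets. -/
def countEvents : Set (Set Config) :=
  {S | ∃ L : List (Set Plane × ℕ), (∀ p ∈ L, MeasurableSet p.1 ∧ Bornology.IsBounded p.1) ∧
    S = countEvent L}

lemma isPiSystem_countEvents : IsPiSystem countEvents := by
  rintro _ ⟨L, hL, rfl⟩ _ ⟨L', hL', rfl⟩ -
  refine ⟨L ++ L', fun p hp => ?_, ?_⟩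
  · rcases List.mem_append.1 hp with h | h
    exacts [hL p h, hL' p h]
  · ext φ
    simp only [countEvent, mem_inter_iff, mem_ofPred_eq, List.mem_append]
    exact ⟨fun h p hp => hp.elim (h.1 p) (h.2 p), fun h => ⟨fun p hp => h p (.inl hp),
      fun p hp => h p (.inr hp)⟩⟩

lemma iUnion_annulus : ⋃ n, annulus n = univ := by
  ext x
  simp [annulus]

lemma pairwise_disjoint_annulus : Pairwise (Function.onFun Disjoint annulus) := fun _ _ hij =>
  Set.disjoint_left.2 fun _ hx hx' => hij (hx.symm.trans hx')

lemma generateFrom_countEvents :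
    (inferInstance : MeasurableSpace Config) = MeasurableSpace.generateFrom countEvents := by
  refine le_antisymm ?_ (MeasurableSpace.generateFrom_le ?_)
  · have hbdd : ∀ B : Set Plane, MeasurableSet B → Bornology.IsBounded B →
        @Measurable _ _ (MeasurableSpace.generateFrom countEvents) _
          fun φ : Config => φ.count B := by
      intro B hB hb U _
      have : (fun φ : Config => φ.count B) ⁻¹' U =
          ⋃ k ∈ {k : ℕ | (k : ℝ≥0∞) ∈ U}, countEvent [(B, k)] := by
        ext φ
        obtain ⟨N, hN⟩ := φ.count_eq_natCast hb
        simp [countEvent, hN]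
      rw [this]
      refine .biUnion (to_countable _) fun k _ => MeasurableSpace.measurableSet_generateFrom
        ⟨[(B, k)], by simp [hB, hb], rfl⟩
    refine iSup_le fun B => ?_
    rw [← measurable_iff_comap_le]
    have : (fun φ : Config => φ.count B.1) = fun φ => ∑' n, φ.count (B.1 ∩ annulus n) := by
      funext φ
      have hm : ∀ n, MeasurableSet (B.1 ∩ annulus n) := fun n => B.2.inter (measurableSet_annulus n)
      simp only [← φ.pointMeasure_apply B.2, ← φ.pointMeasure_apply (hm _)]
      rw [← measure_iUnion (fun i j hij => (pairwise_disjoint_annulus hij).mono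
        inter_subset_right inter_subset_right) hm, ← inter_iUnion, iUnion_annulus, inter_univ]
    rw [this]
    refine @Measurable.tsum _ _ _ (MeasurableSpace.generateFrom countEvents) _ _ _ _ _ _ _ _ _ _ _
      _ fun n => hbdd _ (B.2.inter (measurableSet_annulus n))
      ((isBounded_annulus n).subset inter_subset_right)
  · rintro _ ⟨L, hL, rfl⟩
    have : countEvent L = ⋂ p ∈ {p | p ∈ L}, {φ : Config | φ.count p.1 = p.2} := by
      ext; simp [countEvent]
    rw [this]
    exact .biInter (List.finite_toSet L).countable fun p hp =>
      measurable_count (hL p hp).1 (measurableSet_singleton _)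

/-- The atom of a finite family of sets that consists of the points that belong exactly to the sets
with index in `T`. -/
def atom {n : ℕ} (B : Fin n → Set Plane) (T : Finset (Fin n)) : Set Plane :=
  {x | ∀ i, x ∈ B i ↔ i ∈ T}

lemma measurableSet_atom {n : ℕ} {B : Fin n → Set Plane} (hB : ∀ i, MeasurableSet (B i))
    (T : Finset (Fin n)) : MeasurableSet (atom B T) := by
  have : atom B T = ⋂ i, {x | x ∈ B i ↔ i ∈ T} := by ext; simp [atom]
  rw [this]
  refine .iInter fun i => ?_
  by_cases h : i ∈ T
  · simpa [h] using hB i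
  · simp only [h, iff_false]
    exact (hB i).compl

lemma disjoint_atom {n : ℕ} (B : Fin n → Set Plane) {T T' : Finset (Fin n)} (h : T ≠ T') :
    Disjoint (atom B T) (atom B T') :=
  Set.disjoint_left.2 fun _ hx hx' => h (Finset.ext fun i => (hx i).symm.trans (hx' i))

lemma exists_mem_atom {n : ℕ} (B : Fin n → Set Plane) (x : Plane) : ∃ T, x ∈ atom B T := by
  classical
  exact ⟨Finset.univ.filter fun i => x ∈ B i, fun i => by simp⟩

lemma Config.count_eq_sum_atom {n : ℕ} {B : Fin n → Set Plane} (hB : ∀ i, MeasurableSet (B i))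
    (φ : Config) (i : Fin n) : φ.count (B i) =
      ∑ T : {T : Finset (Fin n) // T.Nonempty}, if i ∈ T.1 then φ.count (atom B T) else 0 := by
  classical
  have hu : B i = ⋃ T ∈ Finset.univ.filter (fun T : {T : Finset (Fin n) // T.Nonempty} => i ∈ T.1),
      atom B T := by
    ext x
    simp only [Finset.mem_filter, Finset.mem_univ, true_and, mem_iUnion, exists_prop]
    constructor
    · intro hx
      obtain ⟨T, hT⟩ := exists_mem_atom B x
      exact ⟨⟨T, i, (hT i).1 hx⟩, (hT i).1 hx, hT⟩
    · rintro ⟨T, hi, hT⟩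
      exact (hT i).2 hi
  rw [← Finset.sum_filter, ← φ.pointMeasure_apply (hB i)]
  conv_lhs => rw [hu]
  rw [measure_biUnion_finset]
  · exact Finset.sum_congr rfl fun T _ => φ.pointMeasure_apply (measurableSet_atom hB _)
  · exact fun T _ T' _ h => disjoint_atom B fun h' => h (Subtype.ext h')
  · exact fun T _ => measurableSet_atom hB _

/-- The law of a point process is determined by the joint laws of its counts in finitely many
disjoint bounded sets, each of them contained in or disjoint from a given set. -/
lemma ext_of_counts {ν ν' : Measure Config} [IsFiniteMeasure ν'] {B : Set Plane}
    (hB : MeasurableSet B) (hBb : Bornology.IsBounded B)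
    (H : ∀ (ι : Type) [Fintype ι] (D : ι → Set Plane), (∀ i, MeasurableSet (D i)) →
      (∀ i, Bornology.IsBounded (D i)) → Pairwise (Function.onFun Disjoint D) →
      (∀ i, D i ⊆ B ∨ Disjoint (D i) B) → B ⊆ ⋃ i, D i → ∀ k : ι → ℕ,
        ν {φ | ∀ i, φ.count (D i) = k i} = ν' {φ | ∀ i, φ.count (D i) = k i}) : ν = ν' := by
  classical
  have key : ∀ L : List (Set Plane × ℕ),
      (∀ p ∈ L, MeasurableSet p.1 ∧ Bornology.IsBounded p.1) →
        ν (countEvent L) = ν' (countEvent L) := by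
    intro L hL
    -- The counts of the sets in `L` are sums of the counts of the atoms. Including `B` in the family
    -- makes each atom a subset of `B` or disjoint from it.
    let C : Fin (L.length + 1) → Set Plane := Fin.cons B fun i => (L.get i).1
    have hC : ∀ i, MeasurableSet (C i) := Fin.cases hB fun i => (hL _ (L.get_mem i)).1
    have hCb : ∀ i, Bornology.IsBounded (C i) := Fin.cases hBb fun i => (hL _ (L.get_mem i)).2
    let ι := {T : Finset (Fin (L.length + 1)) // T.Nonempty}
    let D : ι → Set Plane := fun T => atom C T
    have hD : ∀ T, MeasurableSet (D T) := fun T => measurableSet_atom hC _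
    have hDb : ∀ T, Bornology.IsBounded (D T) := fun T => by
      obtain ⟨i, hi⟩ := T.2
      exact (hCb i).subset fun x hx => (hx i).2 hi
    let V : Set (ι → ℕ) := {c | ∀ i : Fin L.length,
      ∑ T : ι, (if i.succ ∈ T.1 then c T else 0) = (L.get i).2}
    have hS : countEvent L = ⋃ c ∈ V, {φ : Config | ∀ T, φ.count (D T) = c T} := by
      ext φ
      choose c hc using fun T => φ.count_eq_natCast (hDb T)
      have hcount : ∀ i : Fin L.length, φ.count (L.get i).1 =
          ((∑ T : ι, (if i.succ ∈ T.1 then c T else 0) : ℕ) : ℝ≥0∞) := by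
        intro i
        have := φ.count_eq_sum_atom hC i.succ
        simp only [C, Fin.cons_succ] at this
        rw [this]
        push_cast
        exact Finset.sum_congr rfl fun T _ => by rw [← hc T]
      simp only [mem_iUnion, exists_prop]
      constructor
      · intro h
        refine ⟨c, fun i => ?_, hc⟩
        have := h _ (L.get_mem i)
        rw [hcount] at this
        exact_mod_cast this
      · rintro ⟨c', hc', hφ⟩ p hp
        obtain ⟨i, rfl⟩ := List.get_of_mem hp
        have hcc : c' = c := funext fun T => by
          have := (hφ T).symm.trans (hc T)
          exact_mod_cast this
        rw [hcount, ← hc' i, hcc]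
    have hdisj : V.PairwiseDisjoint fun c => {φ : Config | ∀ T, φ.count (D T) = c T} := by
      refine fun c _ c' _ hcc => Set.disjoint_left.2 fun φ h h' => hcc (funext fun T => ?_)
      have := (h T).symm.trans (h' T)
      exact_mod_cast this
    rw [hS, measure_biUnion (to_countable V) hdisj fun c _ => measurableSet_counts hD c,
      measure_biUnion (to_countable V) hdisj fun c _ => measurableSet_counts hD c]
    refine tsum_congr fun c => H ι D hD hDb ?_ ?_ ?_ c
    · exact fun T T' h => disjoint_atom C fun h' => h (Subtype.ext h')
    · intro T
      by_cases h : (0 : Fin (L.length + 1)) ∈ T.1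
      · exact .inl fun x hx => (hx 0).2 h
      · exact .inr (Set.disjoint_left.2 fun x hx hxB => h ((hx 0).1 hxB))
    · intro x hx
      obtain ⟨T, hT⟩ := exists_mem_atom C x
      exact mem_iUnion.2 ⟨⟨T, 0, (hT 0).1 hx⟩, hT⟩
  refine (ext_of_generate_finite countEvents generateFrom_countEvents isPiSystem_countEvents
    ?_ ?_).symm
  · rintro _ ⟨L, hL, rfl⟩
    exact (key L hL).symm
  · simpa [countEvent] using (key [] (by simp)).symm

/-! ### The Poisson process: invariance and the Mecke formula -/

/-- The probability that a Poisson variable of mean `lam * v` equals `k`. -/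
def poissonWeight (lam v : ℝ) (k : ℕ) : ℝ≥0∞ :=
  ENNReal.ofReal (Real.exp (-(lam * v)) * (lam * v) ^ k / k.factorial)

lemma poissonWeight_succ {lam v : ℝ} (h : 0 ≤ lam * v) (k : ℕ) :
    ((k : ℝ≥0∞) + 1) * poissonWeight lam v (k + 1) =
      ENNReal.ofReal (lam * v) * poissonWeight lam v k := by
  have hk : ((k : ℝ≥0∞) + 1) = ENNReal.ofReal ((k : ℝ) + 1) := by
    rw [ENNReal.ofReal_add (by positivity) zero_le_one, ENNReal.ofReal_natCast, ENNReal.ofReal_one]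
  rw [poissonWeight, poissonWeight, hk, ← ENNReal.ofReal_mul (by positivity),
    ← ENNReal.ofReal_mul h]
  congr 1
  rw [Nat.factorial_succ]
  push_cast
  field_simp
  ring

section Poisson

variable {Q : Measure Config} {lam : ℝ}

lemma IsPoissonProcess.measure_counts (hQ : IsPoissonProcess Q lam) {ι : Type*} [Fintype ι]
    {D : ι → Set Plane} (hD : ∀ i, MeasurableSet (D i)) (hb : ∀ i, Bornology.IsBounded (D i))
    (hd : Pairwise (Function.onFun Disjoint D)) (k : ι → ℕ) :
    Q {φ | ∀ i, φ.count (D i) = k i} = ∏ i, poissonWeight lam (volume.real (D i)) (k i) := by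
  let e := Fintype.equivFin ι
  have h := hQ _ (fun j => D (e.symm j)) (fun j => hD _) (fun j => hb _)
    (fun i j hij => hd fun h => hij (e.symm.injective h)) fun j => k (e.symm j)
  rw [← e.symm.prod_comp]
  refine Eq.trans (congrArg Q ?_) h
  ext φ
  exact ⟨fun h j => h _, fun h i => by simpa using h (e i)⟩

lemma IsPoissonProcess.measure_counts_finset (hQ : IsPoissonProcess Q lam) {ι : Type*}
    {D : ι → Set Plane} (hD : ∀ i, MeasurableSet (D i)) (hb : ∀ i, Bornology.IsBounded (D i))
    (hd : Pairwise (Function.onFun Disjoint D)) (k : ι → ℕ) (s : Finset ι) :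
    Q {φ | ∀ i ∈ s, φ.count (D i) = k i} =
      ∏ i ∈ s, poissonWeight lam (volume.real (D i)) (k i) := by
  have h := hQ.measure_counts (D := fun i : s => D i) (fun i => hD _) (fun i => hb _)
    (fun i j hij => hd fun h => hij (Subtype.ext h)) fun i => k i
  rw [Finset.prod_coe_sort s fun i => poissonWeight lam (volume.real (D i)) (k i)] at h
  rw [← h]
  congr 1
  ext φ
  simp

/-- A Poisson process is invariant in law under isometries that preserve the area. -/
lemma IsPoissonProcess.map_image [IsProbabilityMeasure Q] (hQ : IsPoissonProcess Q lam)
    (e : Plane ≃ᵢ Plane) (he : MeasurePreserving e (volume : Measure Plane) volume) :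
    MeasurePreserving (Config.image e) Q Q := by
  refine ⟨measurable_image e, ext_of_counts (B := ∅) .empty Bornology.isBounded_empty ?_⟩
  intro ι _ D hD hb hd _ _ k
  rw [Measure.map_apply (measurable_image e) (measurableSet_counts hD k),
    hQ.measure_counts hD hb hd]
  have hcount : ∀ (φ : Config) (A : Set Plane), (φ.image e).count A = φ.count (e ⁻¹' A) := by
    intro φ A
    simp only [Config.count_eq_tsum, tsum_image]
    rfl
  have h := hQ.measure_counts (D := fun i => e ⁻¹' D i)
    (fun i => e.continuous.measurable (hD i))
    (fun i => by
      have := e.symm.isometry.lipschitz.isBounded_image (hb i)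
      rwa [e.image_symm] at this)
    (fun i j hij => (hd hij).preimage e) k
  simp only [preimage_ofPred_eq, hcount, h]
  refine Finset.prod_congr rfl fun i _ => ?_
  rw [measureReal_def, he.measure_preimage (hD i).nullMeasurableSet, measureReal_def]

lemma IsPoissonProcess.motionInvariant [IsProbabilityMeasure Q] (hQ : IsPoissonProcess Q lam) :
    MotionInvariant Q where
  stationary v := hQ.map_image _ (measurePreserving_add_right volume v)
  isotropic R _ := hQ.map_image _ R.measurePreserving

lemma Config.count_eq_count_erase_add_one {φ : Config} {x : Plane} (hx : x ∈ φ.carrier)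
    {D : Set Plane} (hxD : x ∈ D) : φ.count D = (φ.erase x).count D + 1 := by
  have h : φ.carrier ∩ D = insert x ((φ.erase x).carrier ∩ D) := by
    ext y
    rw [Config.erase_carrier]
    by_cases hy : y = x
    · subst hy; simp [hx, hxD]
    · simp [hy]
  rw [Config.count, h, encard_insert_of_notMem (by simp [Config.erase_carrier]), Config.count]
  push_cast
  rfl

lemma Config.count_erase_of_notMem (φ : Config) {x : Plane} {D : Set Plane} (hxD : x ∉ D) :
    (φ.erase x).count D = φ.count D := by
  have h : (φ.erase x).carrier ∩ D = φ.carrier ∩ D := by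
    ext y
    rw [Config.erase_carrier]
    by_cases hy : y = x
    · subst hy; simp [hxD]
    · simp [hy]
  rw [Config.count, h, Config.count]

/-- The measure `B × A ↦ E #{x ∈ Φ ∩ B : Φ \ {x} ∈ A}`. -/
def reducedCampbell (Q : Measure Config) : Measure (Plane × Config) :=
  (Q.compProd pointKernel).map fun p => (p.2, p.1.erase p.2)

lemma measurable_snd_erase : Measurable fun p : Config × Plane => (p.2, p.1.erase p.2) :=
  measurable_snd.prodMk measurable_erase

lemma lintegral_reducedCampbell [IsProbabilityMeasure Q] {F : Plane × Config → ℝ≥0∞}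
    (hF : Measurable F) : ∫⁻ p, F p ∂reducedCampbell Q =
      ∫⁻ φ, ∑' x : φ.carrier, F (x, φ.erase x) ∂Q := by
  rw [reducedCampbell, lintegral_map hF measurable_snd_erase]
  exact lintegral_tsum_points (hF.comp measurable_snd_erase)

/-- The Mecke formula on the counting events: given that there are `k + 1` points in `D i`, each
of them can be the removed one, and `(k + 1) p(k + 1) = lam |D i| p(k)` for the Poisson weights. -/
lemma IsPoissonProcess.reducedCampbell_counts [IsProbabilityMeasure Q]
    (hQ : IsPoissonProcess Q lam) (hlam : 0 < lam) {ι : Type*} [Fintype ι] {D : ι → Set Plane}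
    (hD : ∀ i, MeasurableSet (D i)) (hb : ∀ i, Bornology.IsBounded (D i))
    (hd : Pairwise (Function.onFun Disjoint D)) (k : ι → ℕ) (i : ι) :
    reducedCampbell Q (D i ×ˢ {φ : Config | ∀ j, φ.count (D j) = k j}) =
      ENNReal.ofReal lam * volume (D i) * Q {φ | ∀ j, φ.count (D j) = k j} := by
  classical
  set k' : ι → ℕ := Function.update k i (k i + 1) with hk'
  have hE := measurableSet_counts hD k
  have hE' := measurableSet_counts hD k'
  have hmem : ∀ (φ : Config) (x : φ.carrier), (x : Plane) ∈ D i →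
      ((∀ j, (φ.erase x).count (D j) = k j) ↔ ∀ j, φ.count (D j) = k' j) := by
    intro φ x hx
    refine forall_congr' fun j => ?_
    by_cases hj : j = i
    · subst hj
      rw [Config.count_eq_count_erase_add_one x.2 hx, hk', Function.update_self]
      obtain ⟨N, hN⟩ := (φ.erase x).count_eq_natCast (hb j)
      rw [hN]
      norm_cast
      omega
    · rw [φ.count_erase_of_notMem (Set.disjoint_left.1 (hd (Ne.symm hj)) hx), hk',
        Function.update_of_ne hj]
  have hpt : ∀ φ : Config, ∑' x : φ.carrier,
      (D i ×ˢ {φ : Config | ∀ j, φ.count (D j) = k j}).indicator (fun _ => (1 : ℝ≥0∞))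
        ((x : Plane), φ.erase x) =
      ((k i : ℝ≥0∞) + 1) * {φ : Config | ∀ j, φ.count (D j) = k' j}.indicator (fun _ => 1) φ := by
    intro φ
    by_cases hφ : ∀ j, φ.count (D j) = k' j
    · rw [indicator_of_mem (by exact hφ), mul_one]
      have h1 := hφ i
      rw [φ.count_eq_tsum, hk', Function.update_self] at h1
      push_cast at h1
      rw [← h1]
      refine tsum_congr fun x => indicator_one_congr ?_
      rw [mem_prod]
      exact ⟨fun h => h.1, fun h => ⟨h, (hmem φ x h).2 hφ⟩⟩
    · rw [indicator_of_notMem (by exact hφ), mul_zero, ENNReal.tsum_eq_zero]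
      intro x
      refine indicator_of_notMem (fun h => hφ ?_) _
      exact (hmem φ x h.1).1 h.2
  have hv : 0 ≤ lam * volume.real (D i) := mul_nonneg hlam.le measureReal_nonneg
  have hvol : ENNReal.ofReal (lam * volume.real (D i)) = ENNReal.ofReal lam * volume (D i) := by
    rw [ENNReal.ofReal_mul hlam.le, measureReal_def,
      ENNReal.ofReal_toReal (hb i).measure_lt_top.ne]
  rw [← lintegral_indicator_one ((hD i).prod hE)]
  refine (lintegral_reducedCampbell (measurable_const.indicator ((hD i).prod hE))).trans ?_
  refine (lintegral_congr hpt).trans ?_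
  rw [lintegral_const_mul _ (measurable_const.indicator hE'), lintegral_indicator hE',
    setLIntegral_one, hQ.measure_counts hD hb hd, hQ.measure_counts hD hb hd,
    ← Finset.mul_prod_erase _ _ (Finset.mem_univ i), ← Finset.mul_prod_erase Finset.univ
      (fun j => poissonWeight lam (volume.real (D j)) (k j)) (Finset.mem_univ i), ← mul_assoc,
    ← mul_assoc, ← hvol, ← poissonWeight_succ hv, hk', Function.update_self]
  congr 1
  refine Finset.prod_congr rfl fun j hj => ?_
  rw [Function.update_of_ne (Finset.ne_of_mem_erase hj)]

/-- The Mecke formula as an identity of measures. On `B ×ˢ A` with bounded `B` both sides are finite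
measures in `A`, determined by their values on counting events. -/
lemma IsPoissonProcess.reducedCampbell_eq [IsProbabilityMeasure Q]
    (hQ : IsPoissonProcess Q lam) (hlam : 0 < lam) :
    (volume : Measure Plane).prod (ENNReal.ofReal lam • Q) = reducedCampbell Q := by
  classical
  have hbdd : ∀ (B : Set Plane), MeasurableSet B → Bornology.IsBounded B →
      ∀ A : Set Config, MeasurableSet A →
        reducedCampbell Q (B ×ˢ A) = ENNReal.ofReal lam * volume B * Q A := by
    intro B hB hBb
    set ν : Measure Config := ((reducedCampbell Q).restrict (B ×ˢ univ)).map Prod.snd with hν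
    have hνA : ∀ A, MeasurableSet A → ν A = reducedCampbell Q (B ×ˢ A) := fun A hA => by
      rw [hν, Measure.map_apply measurable_snd hA, Measure.restrict_apply (measurable_snd hA)]
      congr 1
      ext p
      simp [and_comm]
    have hfin : IsFiniteMeasure ((ENNReal.ofReal lam * volume B) • Q) := by
      refine Measure.smul_finite Q (ENNReal.mul_lt_top ENNReal.ofReal_lt_top ?_).ne
      exact hBb.measure_lt_top
    have heq : ν = (ENNReal.ofReal lam * volume B) • Q := by
      refine ext_of_counts hB hBb ?_
      intro ι _ D hD hb hd hor hcov k
      set J : Finset ι := Finset.univ.filter fun i => D i ⊆ B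
      have hBJ : B = ⋃ i ∈ J, D i := by
        ext x
        simp only [J, Finset.mem_filter, Finset.mem_univ, true_and, mem_iUnion, exists_prop]
        constructor
        · intro hx
          obtain ⟨i, hi⟩ := mem_iUnion.1 (hcov hx)
          refine ⟨i, (hor i).resolve_right fun h => Set.disjoint_left.1 h hi hx, hi⟩
        · rintro ⟨i, hi, hx⟩
          exact hi hx
      have hE := measurableSet_counts hD k
      rw [hνA _ hE, Measure.smul_apply, smul_eq_mul]
      have h1 : B ×ˢ {φ : Config | ∀ i, φ.count (D i) = k i} =
          ⋃ i ∈ J, D i ×ˢ {φ : Config | ∀ i, φ.count (D i) = k i} := by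
        ext p
        rw [hBJ]
        simp only [mem_prod, mem_iUnion, exists_prop]
        tauto
      have h2 : volume B = ∑ i ∈ J, volume (D i) := by
        conv_lhs => rw [hBJ]
        exact measure_biUnion_finset (fun i _ j _ hij => hd hij) fun i _ => hD i
      rw [h1, measure_biUnion_finset, h2, Finset.mul_sum, Finset.sum_mul]
      · exact Finset.sum_congr rfl fun i _ => hQ.reducedCampbell_counts hlam hD hb hd k i
      · intro i _ j _ hij
        exact Set.disjoint_left.2 fun p hp hp' => Set.disjoint_left.1 (hd hij) hp.1 hp'.1
      · exact fun i _ => (hD i).prod hE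
    intro A hA
    rw [← hνA A hA, heq, Measure.smul_apply, smul_eq_mul]
  have := Measure.smul_finite Q (c := ENNReal.ofReal lam) ENNReal.ofReal_ne_top
  refine Measure.prod_eq fun B A hB hA => ?_
  have hm : ∀ n, MeasurableSet (B ∩ annulus n) := fun n => hB.inter (measurableSet_annulus n)
  have hdis : Pairwise (Function.onFun Disjoint fun n => B ∩ annulus n) := fun i j hij =>
    (pairwise_disjoint_annulus hij).mono inter_subset_right inter_subset_right
  have hBU : B = ⋃ n, B ∩ annulus n := by rw [← inter_iUnion, iUnion_annulus, inter_univ]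
  have h1 : B ×ˢ A = ⋃ n, (B ∩ annulus n) ×ˢ A := by
    conv_lhs => rw [hBU]
    rw [iUnion_prod_const]
  rw [h1, measure_iUnion (fun i j hij => Set.disjoint_left.2 fun p hp hp' =>
    Set.disjoint_left.1 (hdis hij) hp.1 hp'.1) fun n => (hm n).prod hA]
  simp only [fun n => hbdd _ (hm n) ((isBounded_annulus n).subset inter_subset_right) A hA]
  rw [ENNReal.tsum_mul_right, ENNReal.tsum_mul_left, ← measure_iUnion hdis hm, ← hBU,
    Measure.smul_apply, smul_eq_mul]
  ring

/-- The Mecke formula. -/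
lemma IsPoissonProcess.lintegral_tsum_erase [IsProbabilityMeasure Q]
    (hQ : IsPoissonProcess Q lam) (hlam : 0 < lam) {F : Plane × Config → ℝ≥0∞}
    (hF : Measurable F) : ∫⁻ φ, ∑' x : φ.carrier, F (x, φ.erase x) ∂Q =
      ENNReal.ofReal lam * ∫⁻ x, ∫⁻ φ, F (x, φ) ∂Q := by
  have := Measure.smul_finite Q (c := ENNReal.ofReal lam) ENNReal.ofReal_ne_top
  rw [← lintegral_reducedCampbell hF, ← hQ.reducedCampbell_eq hlam,
    lintegral_prod _ hF.aemeasurable, ← lintegral_const_mul' _ _ ENNReal.ofReal_ne_top]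
  simp only [lintegral_smul_measure, smul_eq_mul]

end Poisson

/-! ### The Poisson process: Palm version, empty disks and regularity -/

lemma fadingLaw_shot_lt (μ : Measure ℝ) (φ : Config) (g : Plane → ℝ≥0∞) (z : ℝ≥0∞) :
    fadingLaw μ {h | z < shot φ g h} =
      ∫⁻ h, (Ioi z).indicator (fun _ => 1) (shot φ g h) ∂fadingLaw μ :=
  (lintegral_indicator_one (measurableSet_lt measurable_const (measurable_shot _ _))).symm

lemma IsPoissonProcess.measure_emptyDisk {Q : Measure Config} {lam : ℝ}
    (hQ : IsPoissonProcess Q lam) {r : ℝ} (hr : 0 ≤ r) :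
    Q (emptyDisk r) = ENNReal.ofReal (Real.exp (-(lam * Real.pi * r ^ 2))) := by
  have h := hQ.measure_counts (ι := Unit) (D := fun _ => Metric.ball 0 r)
    (fun _ => Metric.isOpen_ball.measurableSet) (fun _ => Metric.isBounded_ball)
    (fun _ _ h => absurd (Subsingleton.elim _ _) h) fun _ => 0
  have h1 : emptyDisk r = {φ : Config | ∀ _ : Unit, φ.count (Metric.ball 0 r) = (0 : ℕ)} := by
    ext φ
    simp [emptyDisk, Config.count_eq_zero]
  have hv : volume.real (Metric.ball (0 : Plane) r) = r ^ 2 * Real.pi := by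
    rw [measureReal_def, EuclideanSpace.volume_ball_fin_two, ENNReal.toReal_mul,
      ENNReal.toReal_pow, ENNReal.toReal_ofReal hr]
    simp [Real.pi_nonneg]
  rw [h1, h]
  simp only [Finset.univ_unique, Finset.prod_singleton, poissonWeight, hv, pow_zero, mul_one,
    Nat.factorial_zero, Nat.cast_one, div_one]
  congr 2
  ring

section Poisson

variable {Q : Measure Config} [IsProbabilityMeasure Q] {lam : ℝ}

lemma IsPoissonProcess.hasIntensity (hQ : IsPoissonProcess Q lam) (hlam : 0 < lam) :
    HasIntensity Q lam := by
  intro B hB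
  have h := hQ.lintegral_tsum_erase hlam (F := fun p => B.indicator (fun _ => 1) p.1)
    ((measurable_const.indicator hB).comp measurable_fst)
  simp only [lintegral_const, measure_univ, mul_one] at h
  rw [lintegral_indicator hB, setLIntegral_one] at h
  rw [← h]
  exact lintegral_congr fun φ => φ.count_eq_tsum B

/-- Slivnyak's theorem: the reduced Palm version of a Poisson process is the process itself. -/
lemma IsPoissonProcess.palmExp_erase (hQ : IsPoissonProcess Q lam) (hlam : 0 < lam) (ζ : Plane)
    {F : Config → ℝ≥0∞} (hF : Measurable F) :
    palmExp Q lam ζ (fun φ => F (φ.erase ζ)) = ∫⁻ φ, F φ ∂Q := by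
  have hte : ∀ (φ : Config) (x : Plane),
      (φ.translate (ζ - x)).erase ζ = (φ.erase x).translate (ζ - x) := by
    intro φ x
    ext y
    simp only [Config.erase_carrier, Set.mem_sdiff, Config.mem_translate, mem_singleton_iff]
    have : y = ζ ↔ y - (ζ - x) = x := by
      rw [sub_eq_iff_eq_add, add_sub_cancel]
    rw [this]
  have hv : Measurable fun p : Plane × Config => (p.2, ζ - p.1) :=
    measurable_snd.prodMk (measurable_const.sub measurable_fst)
  have ht := measurable_translate.comp hv
  have hFt : Measurable fun p : Plane × Config => F (p.2.translate (ζ - p.1)) := hF.comp ht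
  have hU : Measurable (unitSquare.indicator fun _ => (1 : ℝ≥0∞)) :=
    measurable_const.indicator measurableSet_unitSquare
  have hU' : Measurable fun p : Plane × Config => unitSquare.indicator (fun _ => (1 : ℝ≥0∞)) p.1 :=
    hU.comp measurable_fst
  have hG : Measurable fun p : Plane × Config =>
      unitSquare.indicator (fun _ => 1) p.1 * F (p.2.translate (ζ - p.1)) := hU'.mul hFt
  have h := hQ.lintegral_tsum_erase hlam hG
  -- By stationarity the translation does not change the expectation.
  have h1 : ∀ x, ∫⁻ φ, unitSquare.indicator (fun _ => 1) x * F (φ.translate (ζ - x)) ∂Q =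
      unitSquare.indicator (fun _ => ∫⁻ φ, F φ ∂Q) x := by
    intro x
    by_cases hx : x ∈ unitSquare
    · simp only [indicator_of_mem hx, one_mul]
      exact (hQ.motionInvariant.stationary (ζ - x)).lintegral_comp hF
    · simp only [indicator_of_notMem hx, zero_mul, lintegral_zero]
  simp only [h1] at h
  rw [lintegral_indicator measurableSet_unitSquare, setLIntegral_const, volume_unitSquare,
    mul_one] at h
  have h2 : ∀ φ : Config, ∑' x : ↥(φ.carrier ∩ unitSquare),
      F ((φ.translate (ζ - (x : Plane))).erase ζ) = ∑' x : φ.carrier,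
        unitSquare.indicator (fun _ => 1) (x : Plane) * F ((φ.erase x).translate (ζ - x)) := by
    intro φ
    rw [tsum_inter_eq_indicator φ.carrier unitSquare fun x =>
      F ((φ.translate (ζ - x)).erase ζ)]
    congr 1
    funext x
    by_cases hx : (x : Plane) ∈ unitSquare
    · rw [indicator_of_mem hx, indicator_of_mem hx, one_mul, hte]
    · rw [indicator_of_notMem hx, indicator_of_notMem hx, zero_mul]
  rw [palmExp, lintegral_congr h2, h, mul_div_assoc, mul_comm, ENNReal.div_mul_cancel]
  · simpa using hlam
  · exact ENNReal.ofReal_ne_top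

/-- The moment densities of a Poisson process are constant. -/
lemma IsPoissonProcess.lintegral_distinctSum (hQ : IsPoissonProcess Q lam) (hlam : 0 < lam)
    (n : ℕ) : ∀ f : (Fin n → Plane) → ℝ≥0∞, Measurable f →
      ∫⁻ φ, distinctSum φ n f ∂Q = ENNReal.ofReal lam ^ n * ∫⁻ x, f x := by
  induction n with
  | zero =>
    intro f hf
    have : ∀ φ : Config, distinctSum φ 0 f = f default := by
      intro φ
      have : Unique (Fin 0 ↪ φ.carrier) := Function.Embedding.instUniqueOfIsEmpty
      rw [distinctSum, tsum_fintype, Fintype.sum_unique]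
      congr 1
      exact Subsingleton.elim _ _
    simp only [this, lintegral_const, measure_univ, mul_one, pow_zero, one_mul, volume_pi]
    rw [Measure.pi_of_empty _ default, lintegral_dirac' _ hf]
  | succ n ih =>
    intro f hf
    have hfc : Measurable fun p : Plane × (Fin n → Plane) => f (Fin.cons p.1 p.2) :=
      hf.comp measurable_finCons
    have hm : Measurable fun p : Plane × Config =>
        distinctSum p.2 n fun y => f (Fin.cons p.1 y) :=
      measurable_distinctSum measurable_snd (f := fun (p : Plane × Config) y => f (Fin.cons p.1 y))
        (hfc.comp ((measurable_fst.comp measurable_fst).prodMk measurable_snd))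
    simp only [distinctSum_succ]
    rw [hQ.lintegral_tsum_erase hlam hm, lintegral_finCons hf, pow_succ', mul_assoc]
    congr 1
    rw [← lintegral_const_mul _ hfc.lintegral_prod_right']
    exact lintegral_congr fun x => ih _ (hfc.comp measurable_prodMk_left)

lemma IsPoissonProcess.boundedMoments (hQ : IsPoissonProcess Q lam) (hlam : 0 < lam) :
    BoundedMoments Q := fun n _ =>
  ⟨ENNReal.ofReal lam ^ n, ENNReal.pow_lt_top ENNReal.ofReal_lt_top, fun f hf =>
    (hQ.lintegral_distinctSum hlam n f hf).le⟩

/-- The patterns inside and outside of a disk are independent. -/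
lemma IsPoissonProcess.measure_emptyDisk_inter (hQ : IsPoissonProcess Q lam) (r : ℝ)
    {A : Set Config} (hA : MeasurableSet A) :
    Q (emptyDisk r ∩ {φ | φ.inter (Metric.ball 0 r)ᶜ ∈ A}) =
      Q (emptyDisk r) * Q {φ | φ.inter (Metric.ball 0 r)ᶜ ∈ A} := by
  classical
  set S : Set Plane := Metric.ball 0 r
  have hS : MeasurableSet S := Metric.isOpen_ball.measurableSet
  have hin : Measurable fun φ : Config => φ.inter Sᶜ :=
    measurable_inter measurable_id (S := fun _ => Sᶜ) (measurable_snd hS.compl)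
  have heq : (Q.restrict (emptyDisk r)).map (fun φ => φ.inter Sᶜ) =
      Q (emptyDisk r) • Q.map (fun φ => φ.inter Sᶜ) := by
    have hfin : IsFiniteMeasure (Q (emptyDisk r) • Q.map fun φ : Config => φ.inter Sᶜ) :=
      Measure.smul_finite _ (measure_ne_top Q _)
    refine ext_of_counts hS Metric.isBounded_ball ?_
    intro ι _ D hD hb hd hor hcov k
    have hE := measurableSet_counts hD k
    rw [Measure.smul_apply, Measure.map_apply hin hE, Measure.map_apply hin hE,
      Measure.restrict_apply (hin hE), smul_eq_mul]
    set J : Finset ι := Finset.univ.filter fun i => D i ⊆ S with hJ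
    have hin0 : ∀ (φ : Config) (i), i ∈ J → (φ.inter Sᶜ).count (D i) = 0 := by
      intro φ i hi
      rw [Config.count_eq_zero, Config.inter, eq_empty_iff_forall_notMem]
      rintro x ⟨⟨_, hx⟩, hxD⟩
      exact hx ((Finset.mem_filter.1 hi).2 hxD)
    have hin1 : ∀ (φ : Config) (i), i ∉ J → (φ.inter Sᶜ).count (D i) = φ.count (D i) := by
      intro φ i hi
      have hdis : Disjoint (D i) S := (hor i).resolve_left fun h => hi (by simp [hJ, h])
      rw [Config.count, Config.count, Config.inter, inter_assoc,
        inter_eq_right.2 hdis.subset_compl_right]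
    -- Outside of the disk, the sets with index in `J` are empty. So the event is impossible unless
    -- their prescribed counts vanish, in which case these counts describe `emptyDisk r`.
    by_cases hk : ∀ i ∈ J, k i = 0
    · have hpre : (fun φ : Config => φ.inter Sᶜ) ⁻¹' {φ | ∀ i, φ.count (D i) = k i} =
          {φ : Config | ∀ i ∈ Jᶜ, φ.count (D i) = k i} := by
        ext φ
        simp only [mem_preimage, mem_ofPred_eq, Finset.mem_compl]
        refine ⟨fun h i hi => (hin1 φ i hi).symm.trans (h i), fun h i => ?_⟩
        by_cases hi : i ∈ J
        · rw [hin0 φ i hi, hk i hi, Nat.cast_zero]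
        · rw [hin1 φ i hi, h i hi]
      have hempty : emptyDisk r = {φ : Config | ∀ i ∈ J, φ.count (D i) = k i} := by
        ext φ
        simp only [emptyDisk, mem_ofPred_eq]
        constructor
        · intro h i hi
          rw [hk i hi, Nat.cast_zero, Config.count_eq_zero]
          refine subset_empty_iff.1 (h ▸ inter_subset_inter_right _ (Finset.mem_filter.1 hi).2)
        · intro h
          refine eq_empty_iff_forall_notMem.2 fun x hx => ?_
          obtain ⟨i, hi⟩ := mem_iUnion.1 (hcov hx.2)
          have hiJ : i ∈ J := Finset.mem_filter.2 ⟨Finset.mem_univ _,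
            (hor i).resolve_right fun h => Set.disjoint_left.1 h hi hx.2⟩
          have := h i hiJ
          rw [hk i hiJ, Nat.cast_zero, Config.count_eq_zero] at this
          exact (this ▸ (⟨hx.1, hi⟩ : x ∈ φ.carrier ∩ D i) : x ∈ (∅ : Set Plane))
      have hboth : {φ : Config | ∀ i ∈ Jᶜ, φ.count (D i) = k i} ∩
          {φ : Config | ∀ i ∈ J, φ.count (D i) = k i} =
          {φ : Config | ∀ i, φ.count (D i) = k i} := by
        ext φ
        simp only [mem_inter_iff, mem_ofPred_eq, Finset.mem_compl]
        exact ⟨fun h i => if hi : i ∈ J then h.2 i hi else h.1 i hi,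
          fun h => ⟨fun i _ => h i, fun i _ => h i⟩⟩
      rw [hpre, hempty, hboth, hQ.measure_counts hD hb hd,
        hQ.measure_counts_finset hD hb hd k J, hQ.measure_counts_finset hD hb hd k Jᶜ,
        Finset.prod_mul_prod_compl]
    · push Not at hk
      obtain ⟨i, hi, hki⟩ := hk
      have hpre : (fun φ : Config => φ.inter Sᶜ) ⁻¹' {φ | ∀ i, φ.count (D i) = k i} = ∅ := by
        refine eq_empty_iff_forall_notMem.2 fun φ h => hki ?_
        have := h i
        rw [hin0 φ i hi] at this
        exact_mod_cast this.symm
      rw [hpre]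
      simp
  have h := congrArg (fun ν => ν A) heq
  simp only [Measure.smul_apply, smul_eq_mul] at h
  rw [Measure.map_apply hin hA, Measure.map_apply hin hA, Measure.restrict_apply (hin hA)] at h
  rw [inter_comm]
  exact h

lemma IsPoissonProcess.setLIntegral_emptyDisk (hQ : IsPoissonProcess Q lam) (r : ℝ)
    {F : Config → ℝ≥0∞} (hF : Measurable F) :
    ∫⁻ φ in emptyDisk r, F φ ∂Q =
      Q (emptyDisk r) * ∫⁻ φ, F (φ.inter (Metric.ball 0 r)ᶜ) ∂Q := by
  have hS : MeasurableSet (Metric.ball (0 : Plane) r) := Metric.isOpen_ball.measurableSet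
  have hin : Measurable fun φ : Config => φ.inter (Metric.ball 0 r)ᶜ :=
    measurable_inter measurable_id (S := fun _ => (Metric.ball 0 r)ᶜ) (measurable_snd hS.compl)
  have heq : (Q.restrict (emptyDisk r)).map (fun φ => φ.inter (Metric.ball 0 r)ᶜ) =
      Q (emptyDisk r) • Q.map (fun φ => φ.inter (Metric.ball 0 r)ᶜ) := by
    ext A hA
    rw [Measure.smul_apply, Measure.map_apply hin hA, Measure.map_apply hin hA,
      Measure.restrict_apply (hin hA), smul_eq_mul, inter_comm]
    exact hQ.measure_emptyDisk_inter r hA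
  have h1 : ∫⁻ φ in emptyDisk r, F φ ∂Q =
      ∫⁻ φ in emptyDisk r, F (φ.inter (Metric.ball 0 r)ᶜ) ∂Q := by
    refine setLIntegral_congr_fun (measurableSet_emptyDisk r) fun φ hφ => ?_
    have : φ.inter (Metric.ball 0 r)ᶜ = φ := by
      ext x
      refine ⟨fun h => h.1, fun h => ⟨h, fun hx => ?_⟩⟩
      exact ((show φ.carrier ∩ Metric.ball 0 r = ∅ from hφ) ▸
        (⟨h, hx⟩ : x ∈ φ.carrier ∩ Metric.ball 0 r) : x ∈ (∅ : Set Plane))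
    simp only [this]
  rw [h1, ← lintegral_map hF hin, heq, lintegral_smul_measure, smul_eq_mul, lintegral_map hF hin]

lemma palmExp_emptyDisk (hQ : IsPoissonProcess Q lam) (hlam : 0 < lam) (ζ : Plane)
    {F : Config → ℝ≥0∞} (hF : Measurable F) :
    palmExp Q lam ζ ((emptyDisk ‖ζ‖).indicator fun φ => F (φ.erase ζ)) =
      Q (emptyDisk ‖ζ‖) * ∫⁻ φ, F (φ.inter (Metric.ball 0 ‖ζ‖)ᶜ) ∂Q := by
  have h1 : ((emptyDisk ‖ζ‖).indicator fun φ => F (φ.erase ζ)) =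
      fun φ => (emptyDisk ‖ζ‖).indicator F (φ.erase ζ) := by
    funext φ
    have hmem : φ ∈ emptyDisk ‖ζ‖ ↔ φ.erase ζ ∈ emptyDisk ‖ζ‖ := by
      have : φ.carrier ∩ Metric.ball 0 ‖ζ‖ = (φ.erase ζ).carrier ∩ Metric.ball 0 ‖ζ‖ := by
        ext x
        rw [Config.erase_carrier]
        by_cases hx : x = ζ
        · subst hx; simp
        · simp [hx]
      simp only [emptyDisk, mem_ofPred_eq, this]
    by_cases hφ : φ ∈ emptyDisk ‖ζ‖
    · rw [indicator_of_mem hφ, indicator_of_mem (hmem.1 hφ)]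
    · rw [indicator_of_notMem hφ, indicator_of_notMem fun h => hφ (hmem.2 h)]
  have hE := measurableSet_emptyDisk ‖ζ‖
  rw [h1, hQ.palmExp_erase hlam ζ (hF.indicator hE), lintegral_indicator hE,
    hQ.setLIntegral_emptyDisk _ hF]

/-- Conditioned on its nearest point being `ζ`, the other points of a Poisson process form a
Poisson process outside of `b(o, ‖ζ‖)`. -/
lemma IsPoissonProcess.nearestExp_erase (hQ : IsPoissonProcess Q lam) (hlam : 0 < lam) (ζ : Plane)
    {F : Config → ℝ≥0∞} (hF : Measurable F) :
    nearestExp Q lam ζ (fun φ => F (φ.erase ζ)) =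
      ∫⁻ φ, F (φ.inter (Metric.ball 0 ‖ζ‖)ᶜ) ∂Q := by
  have h1 := palmExp_emptyDisk hQ hlam ζ (F := fun _ => 1) measurable_const
  rw [lintegral_one, measure_univ, mul_one] at h1
  have h0 : Q (emptyDisk ‖ζ‖) ≠ 0 := by
    rw [hQ.measure_emptyDisk (norm_nonneg ζ)]
    simpa using Real.exp_pos _
  rw [nearestExp, palmExp_emptyDisk hQ hlam ζ hF, h1, mul_comm, mul_div_assoc,
    ENNReal.div_self h0 (measure_ne_top Q _), mul_one]

variable {μ : Measure ℝ} [IsProbabilityMeasure μ] {ℓ : Plane → ℝ≥0∞} {α : ℝ}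

lemma interference_erase (φ : Config) (ζ : Plane) (ℓ : Plane → ℝ≥0∞) (h : Plane → ℝ) :
    interference ℓ (φ.carrier \ {ζ}) h = shot (φ.erase ζ) ℓ h := rfl

lemma measurable_lintegral_shot_config {g : Plane → ℝ≥0∞} (hg : Measurable g) {Ψ : ℝ≥0∞ → ℝ≥0∞}
    (hΨ : Measurable Ψ) : Measurable fun φ : Config => ∫⁻ h, Ψ (shot φ g h) ∂fadingLaw μ :=
  measurable_lintegral_shot (Φ := fun φ : Config => φ) measurable_id (g := fun _ => g)
    (hg.comp measurable_snd) (Ψ := fun _ => Ψ) (hΨ.comp measurable_snd)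

lemma IsPoissonProcess.regularLaw (hQ : IsPoissonProcess Q lam) (hlam : 0 < lam)
    (hℓ : Measurable ℓ) : RegularLaw ℓ μ lam Q where
  intensity := hQ.hasIntensity hlam
  motionInvariant := hQ.motionInvariant
  boundedMoments := hQ.boundedMoments hlam
  dominance := by
    refine ⟨1, one_pos, fun ζ _ z => ?_⟩
    set S : Set Plane := (Metric.ball 0 (‖ζ‖ / 2))ᶜ
    have hS : MeasurableSet S := Metric.isOpen_ball.measurableSet.compl
    have h1 : ∀ φ : Config, fadingLaw μ {h | (z : ℝ≥0∞) < interference ℓ ((φ.carrier ∩ S) \ {ζ}) h}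
        = fadingLaw μ {h | (z : ℝ≥0∞) < shot (φ.erase ζ) (S.indicator ℓ) h} := by
      intro φ
      congr 1
      ext h
      rw [mem_ofPred_eq, mem_ofPred_eq, ← interference_inter, Config.erase_carrier,
        inter_sdiff_right_comm]
    have hi : Measurable ((Ioi (z : ℝ≥0∞)).indicator fun _ => (1 : ℝ≥0∞)) :=
      measurable_const.indicator measurableSet_Ioi
    have hm : ∀ {g : Plane → ℝ≥0∞}, Measurable g →
        Measurable fun φ : Config => fadingLaw μ {h | (z : ℝ≥0∞) < shot φ g h} := by
      intro g hg
      simp only [fadingLaw_shot_lt]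
      exact measurable_lintegral_shot_config hg hi
    simp only [h1, interference_erase]
    rw [hQ.nearestExp_erase hlam ζ (hm hℓ), hQ.palmExp_erase hlam ζ (hm (hℓ.indicator hS))]
    refine lintegral_mono fun φ => measure_mono fun h hh => ?_
    refine lt_of_lt_of_le (show (z : ℝ≥0∞) < shot (φ.inter (Metric.ball 0 ‖ζ‖)ᶜ) ℓ h from hh) ?_
    rw [shot_inter]
    refine shot_mono φ (fun x _ => ?_) h
    refine indicator_le_indicator_of_subset (compl_subset_compl.2 (Metric.ball_subset_ball ?_))
      (fun _ => zero_le) x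
    linarith [norm_nonneg ζ]
  contactMoments n := by
    have hpt : ∀ φ : Config, Metric.infEDist 0 φ.carrier ^ n ≤
        ∑' k : ℕ, ((k : ℝ≥0∞) + 1) ^ n * (emptyDisk k).indicator (fun _ => 1) φ := by
      intro φ
      rcases φ.carrier.eq_empty_or_nonempty with h | h
      · refine le_top.trans (le_of_eq (Eq.symm ?_))
        rw [eq_top_iff, ← ENNReal.tsum_const_eq_top_of_ne_zero (α := ℕ) one_ne_zero]
        refine ENNReal.tsum_le_tsum fun k => ?_
        rw [indicator_of_mem (by simp [emptyDisk, h]), mul_one]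
        exact one_le_pow₀ le_add_self
      · obtain ⟨u, hu⟩ := Config.exists_nearest h
        refine le_trans ?_ (ENNReal.le_tsum ⌊‖u‖⌋₊)
        rw [indicator_of_mem, mul_one, Config.infEDist_eq hu]
        · gcongr
          rw [← ofReal_norm, ← ENNReal.ofReal_natCast, ← ENNReal.ofReal_one,
            ← ENNReal.ofReal_add (by positivity) zero_le_one]
          exact ENNReal.ofReal_le_ofReal (Nat.lt_floor_add_one _).le
        · have h1 := (Config.mem_nearest.1 hu).2
          exact subset_empty_iff.1 ((inter_subset_inter_right _ (Metric.ball_subset_ball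
            (Nat.floor_le (norm_nonneg u)))).trans (subset_empty_iff.2 h1))
    refine (lintegral_mono hpt).trans_lt ?_
    have hm : ∀ k : ℕ, Measurable ((emptyDisk k).indicator fun _ : Config => (1 : ℝ≥0∞)) :=
      fun k => measurable_const.indicator (measurableSet_emptyDisk _)
    rw [lintegral_tsum fun k => ((hm k).const_mul _).aemeasurable]
    set c := lam * Real.pi with hc
    have hc0 : 0 < c := by positivity
    have hsum : Summable fun k : ℕ => ((k : ℝ) + 1) ^ n * Real.exp (-(c * k)) := by
      have := ((summable_nat_add_iff 1).2 (Real.summable_pow_mul_exp_neg_nat_mul n hc0)).mul_left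
        (Real.exp c)
      refine this.congr fun k => ?_
      rw [mul_left_comm, ← Real.exp_add]
      push_cast
      congr 2
      ring
    refine lt_of_le_of_lt (ENNReal.tsum_le_tsum fun k => ?_) hsum.tsum_ofReal_lt_top
    rw [lintegral_const_mul _ (hm k), lintegral_indicator (measurableSet_emptyDisk _),
      setLIntegral_one, hQ.measure_emptyDisk (Nat.cast_nonneg k),
      ENNReal.ofReal_mul (by positivity),
      ENNReal.ofReal_pow (by positivity), ENNReal.ofReal_add (by positivity) zero_le_one,
      ENNReal.ofReal_natCast, ENNReal.ofReal_one]
    gcongr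
    have : (k : ℝ) ≤ (k : ℝ) ^ 2 := by exact_mod_cast Nat.le_self_pow two_ne_zero k
    nlinarith

lemma IsPoissonProcess.kappa_eq_kappaPoissonIntegral (hQ : IsPoissonProcess Q lam)
    (hlam : 0 < lam) (hℓ : Measurable ℓ) (W m a : ℝ) :
    kappa ℓ μ W m a lam Q = kappaPoissonIntegral ℓ μ W m a lam Q := by
  rw [kappa_eq, kappaPoissonIntegral, ← lintegral_const_mul' _ _ ENNReal.ofReal_ne_top]
  refine lintegral_congr_ae ?_
  filter_upwards [contactPDF_ae_eq hlam (hQ.regularLaw (μ := μ) hlam hℓ),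
    ae_restrict_mem measurableSet_Ioi] with y hy hy0
  have hy0 : 0 < y := hy0
  have hn : ‖(!₂[y, 0] : Plane)‖ = y := norm_axis hy0.le
  have h1 := palmExp_emptyDisk hQ hlam !₂[y, 0] (F := fun _ => 1) measurable_const
  rw [lintegral_one, measure_univ, mul_one, hn, hQ.measure_emptyDisk hy0.le] at h1
  have hF : Measurable fun φ : Config =>
      ∫⁻ h, outageWeight ℓ W m a !₂[y, 0] (shot φ ℓ h) ∂fadingLaw μ :=
    measurable_lintegral_shot_config hℓ (measurable_outageWeight hℓ W m a).of_uncurry_left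
  have h2 := hQ.nearestExp_erase hlam !₂[y, 0] hF
  rw [hn] at h2
  change nearestExp Q lam !₂[y, 0] (fun φ => ∫⁻ h, outageWeight ℓ W m a !₂[y, 0]
    (shot (φ.erase !₂[y, 0]) ℓ h) ∂fadingLaw μ) * contactPDF Q y = ENNReal.ofReal
      (2 * lam * Real.pi) * ((∫⁻ φ, ∫⁻ h, outageWeight ℓ W m a !₂[y, 0]
        (shot (φ.inter (Metric.ball 0 y)ᶜ) ℓ h) ∂fadingLaw μ ∂Q) *
          ENNReal.ofReal (y * Real.exp (-(lam * Real.pi * y ^ 2))))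
  rw [h2, hy, h1, ← ENNReal.ofReal_mul (by positivity), mul_left_comm, ← ENNReal.ofReal_mul
    (by positivity)]
  congr 2
  ring

end Poisson

/-! ### The outage probability for small thresholds -/

/-- The probability, over the fading of the serving station `u`, that the SINR is at most `θ` if
the interference is `i`. -/
def outageKernel (ℓ : Plane → ℝ≥0∞) (μ : Measure ℝ) (W θ : ℝ) (u : Plane) (i : ℝ≥0∞) : ℝ≥0∞ :=
  μ {t | ENNReal.ofReal t * ℓ u / (ENNReal.ofReal W + i) ≤ ENNReal.ofReal θ}

/-- The outage probability `1 - P_c(θ)`. -/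
def outageProb (ℓ : Plane → ℝ≥0∞) (μ : Measure ℝ) (W : ℝ) (P : Measure Config) (θ : ℝ) : ℝ≥0∞ :=
  ∫⁻ φ, ∑' u : φ.nearest, fadingExp μ ℓ (outageKernel ℓ μ W θ) φ u ∂P

lemma FadingCondition.tendsto_div {μ : Measure ℝ} {m a : ℝ} (h : FadingCondition μ m a) :
    Tendsto (fun t => cdf μ t / (a * t ^ m)) (𝓝[>] (0 : ℝ)) (𝓝 1) := by
  refine (Asymptotics.isEquivalent_iff_tendsto_one ?_).1 h.near_zero
  filter_upwards [self_mem_nhdsWithin] with t ht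
  have := h.a_pos
  have : 0 < t := ht
  positivity

section Kernel

variable {μ : Measure ℝ} [IsProbabilityMeasure μ] {ℓ : Plane → ℝ≥0∞} {α W m a : ℝ}

lemma measurable_outageKernel (hℓ : Measurable ℓ) (W θ : ℝ) :
    Measurable (Function.uncurry (outageKernel ℓ μ W θ)) := by
  have hS : MeasurableSet {q : (Plane × ℝ≥0∞) × ℝ |
      ENNReal.ofReal q.2 * ℓ q.1.1 / (ENNReal.ofReal W + q.1.2) ≤ ENNReal.ofReal θ} :=
    measurableSet_le (by fun_prop) measurable_const
  exact measurable_measure_prodMk_left hS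

lemma measurable_interference (ℓ : Plane → ℝ≥0∞) (φ : Config) (u : Plane) :
    Measurable fun h : Plane → ℝ => interference ℓ (φ.carrier \ {u}) h := by
  simp only [interference_erase]
  exact measurable_shot _ _

lemma measurable_sinr (ℓ : Plane → ℝ≥0∞) (W : ℝ) (φ : Config) (u : Plane) :
    Measurable (sinr ℓ W φ u) := by
  have := measurable_interference ℓ φ u
  unfold sinr
  fun_prop

/-- The fading of the serving station is independent of the interference. -/
lemma fadingLaw_sinr_le (φ : Config) (u : Plane) (θ : ℝ) :
    fadingLaw μ {h | sinr ℓ W φ u h ≤ ENNReal.ofReal θ} =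
      fadingExp μ ℓ (outageKernel ℓ μ W θ) φ u := by
  have hS : MeasurableSet {h : Plane → ℝ | sinr ℓ W φ u h ≤ ENNReal.ofReal θ} :=
    measurableSet_le (measurable_sinr ℓ W φ u) measurable_const
  have hI : ∀ (h : Plane → ℝ) (t : ℝ), interference ℓ (φ.carrier \ {u}) (Function.update h u t) =
      interference ℓ (φ.carrier \ {u}) h := by
    intro h t
    refine tsum_congr fun x => ?_
    rw [Function.update_of_ne x.2.2]
  rw [← lintegral_indicator_one hS]
  refine (lintegral_fadingLaw_update u (measurable_const.indicator hS)).trans ?_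
  refine lintegral_congr fun h => ?_
  have hT : MeasurableSet {t : ℝ | ENNReal.ofReal t * ℓ u / (ENNReal.ofReal W +
      interference ℓ (φ.carrier \ {u}) h) ≤ ENNReal.ofReal θ} :=
    measurableSet_le (by fun_prop) measurable_const
  rw [outageKernel, ← lintegral_indicator_one hT]
  refine lintegral_congr fun t => indicator_one_congr ?_
  rw [mem_ofPred_eq, mem_ofPred_eq, sinr, hI, Function.update_self]

/-- For positive `i + W` this is the equivalence of `t ℓ(u) / (i + W) ≤ θ` and
`t ≤ θ (i + W) / ℓ(u)`. For `i + W = 0` the quotient is infinite unless `t ≤ 0`, so that the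
formula persists. -/
lemma outageKernel_eq_cdf {θ : ℝ} (hθ : 0 < θ) {u : Plane} (h0 : ℓ u ≠ 0)
    (hT : ℓ u ≠ ∞) {i : ℝ≥0∞} (hi : i ≠ ∞) : outageKernel ℓ μ W θ u i =
      ENNReal.ofReal (cdf μ (θ * ((i + ENNReal.ofReal W) / ℓ u).toReal)) := by
  rw [ofReal_cdf, outageKernel]
  congr 1
  ext t
  rw [mem_ofPred_eq, mem_Iic, add_comm (ENNReal.ofReal W)]
  set s := i + ENNReal.ofReal W
  have hs : s ≠ ∞ := ENNReal.add_ne_top.2 ⟨hi, ENNReal.ofReal_ne_top⟩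
  by_cases hs0 : s = 0
  · rw [hs0, ENNReal.zero_div, ENNReal.toReal_zero, mul_zero]
    constructor
    · intro h
      by_contra ht
      rw [ENNReal.div_zero (mul_ne_zero (by simpa using ht) h0)] at h
      exact ENNReal.ofReal_ne_top (top_le_iff.1 h)
    · intro h
      rw [ENNReal.ofReal_of_nonpos h, zero_mul, ENNReal.zero_div]
      exact zero_le
  · have hx : ENNReal.ofReal (θ * (s / ℓ u).toReal) = ENNReal.ofReal θ * s / ℓ u := by
      rw [ENNReal.ofReal_mul hθ.le, ENNReal.ofReal_toReal (ENNReal.div_ne_top hs h0), mul_div_assoc]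
    rw [ENNReal.div_le_iff hs0 hs, ← ENNReal.le_div_iff_mul_le (.inl h0) (.inl hT), ← hx,
      ENNReal.ofReal_le_ofReal_iff (by positivity)]

lemma FadingCondition.cdf_zero (h : FadingCondition μ m a) : cdf μ 0 = 0 := by
  have := h.measure_Iic_zero
  rw [← ofReal_cdf, ENNReal.ofReal_eq_zero] at this
  exact le_antisymm this (cdf_nonneg μ 0)

/-- Near zero this is the assumption on `F_h`; away from zero `F_h ≤ 1` suffices. -/
lemma FadingCondition.exists_cdf_le (h : FadingCondition μ m a) :
    ∃ A : ℝ, 0 < A ∧ ∀ t : ℝ, 0 ≤ t → cdf μ t ≤ A * t ^ m := by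
  have ha := h.a_pos
  have h2 : ∀ᶠ t in 𝓝[>] (0 : ℝ), cdf μ t / (a * t ^ m) < 2 :=
    h.tendsto_div.eventually (gt_mem_nhds one_lt_two)
  obtain ⟨δ, hδ, hδs⟩ := mem_nhdsGT_iff_exists_Ioo_subset.1 h2
  have hδ : 0 < δ := hδ
  refine ⟨2 * a + δ ^ (-m), by positivity, fun t ht => ?_⟩
  rcases ht.eq_or_lt with rfl | ht
  · rw [h.cdf_zero, Real.zero_rpow h.m_pos.ne', mul_zero]
  · have htm : 0 < t ^ m := by positivity
    by_cases htδ : t < δ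
    · have := hδs ⟨ht, htδ⟩
      rw [mem_ofPred_eq, div_lt_iff₀ (by positivity)] at this
      have h3 : 0 ≤ δ ^ (-m) * t ^ m := by positivity
      nlinarith
    · have h3 : 1 ≤ δ ^ (-m) * t ^ m := by
        rw [Real.rpow_neg hδ.le, ← div_eq_inv_mul, one_le_div (by positivity)]
        exact Real.rpow_le_rpow hδ.le (not_lt.1 htδ) h.m_pos.le
      have h4 : 0 ≤ 2 * a * t ^ m := by positivity
      nlinarith [cdf_le_one μ t]

lemma outageWeight_eq_ofReal (ha : 0 ≤ a) (hm : 0 ≤ m) {u : Plane} (h0 : ℓ u ≠ 0) {i : ℝ≥0∞}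
    (hi : i ≠ ∞) : outageWeight ℓ W m a u i =
      ENNReal.ofReal (a * ((i + ENNReal.ofReal W) / ℓ u).toReal ^ m) := by
  have hs : i + ENNReal.ofReal W ≠ ∞ := ENNReal.add_ne_top.2 ⟨hi, ENNReal.ofReal_ne_top⟩
  rw [ENNReal.ofReal_mul ha, ← ENNReal.ofReal_rpow_of_nonneg ENNReal.toReal_nonneg hm,
    ENNReal.ofReal_toReal (ENNReal.div_ne_top hs h0), ENNReal.div_rpow_of_nonneg _ _ hm,
    outageWeight, ENNReal.rpow_neg, mul_assoc, ENNReal.div_eq_inv_mul]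

/-- The conditional outage probability behaves like the weight times `θ^m` as `θ → 0`. -/
lemma tendsto_outageKernel (hμ : FadingCondition μ m a) {u : Plane} (h0 : ℓ u ≠ 0)
    (hT : ℓ u ≠ ∞) {i : ℝ≥0∞} (hi : i ≠ ∞) :
    Tendsto (fun θ => ENNReal.ofReal (θ ^ (-m)) * outageKernel ℓ μ W θ u i) (𝓝[>] 0)
      (𝓝 (outageWeight ℓ W m a u i)) := by
  have ha := hμ.a_pos
  rw [outageWeight_eq_ofReal hμ.a_pos.le hμ.m_pos.le h0 hi]
  set x := ((i + ENNReal.ofReal W) / ℓ u).toReal with hx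
  have hx0 : 0 ≤ x := ENNReal.toReal_nonneg
  have hreal : Tendsto (fun θ : ℝ => θ ^ (-m) * cdf μ (θ * x)) (𝓝[>] 0) (𝓝 (a * x ^ m)) := by
    rcases hx0.eq_or_lt with h | h
    · simp only [← h, mul_zero, hμ.cdf_zero, Real.zero_rpow hμ.m_pos.ne']
      exact tendsto_const_nhds
    · have hcomp : Tendsto (fun θ : ℝ => θ * x) (𝓝[>] 0) (𝓝[>] 0) := by
        refine tendsto_nhdsWithin_iff.2 ⟨?_, ?_⟩
        · have : Tendsto (fun θ : ℝ => θ * x) (𝓝 0) (𝓝 (0 * x)) := tendsto_id.mul_const x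
          rw [zero_mul] at this
          exact this.mono_left nhdsWithin_le_nhds
        · filter_upwards [self_mem_nhdsWithin] with θ hθ
          exact mul_pos hθ h
      have h1 := (hμ.tendsto_div.comp hcomp).const_mul (a * x ^ m)
      rw [mul_one] at h1
      refine h1.congr' ?_
      filter_upwards [self_mem_nhdsWithin] with θ hθ
      have hθ : 0 < θ := hθ
      rw [Function.comp_apply, Real.mul_rpow hθ.le h.le, Real.rpow_neg hθ.le]
      field_simp
  refine (ENNReal.tendsto_ofReal hreal).congr' ?_
  filter_upwards [self_mem_nhdsWithin] with θ hθ
  have hθ : 0 < θ := hθ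
  rw [outageKernel_eq_cdf hθ h0 hT hi, ENNReal.ofReal_mul (by positivity)]

/-- The domination for the convergence in `tendsto_outageKernel`. -/
lemma exists_outageKernel_le (hμ : FadingCondition μ m a) (W : ℝ) (ℓ : Plane → ℝ≥0∞) :
    ∃ A : ℝ≥0∞, A < ∞ ∧ ∀ θ : ℝ, 0 < θ → ∀ u : Plane, ℓ u ≠ 0 → ℓ u ≠ ∞ → ∀ i : ℝ≥0∞,
      ENNReal.ofReal (θ ^ (-m)) * outageKernel ℓ μ W θ u i ≤ A * outageWeight ℓ W m a u i := by
  obtain ⟨A, hA, hcdf⟩ := hμ.exists_cdf_le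
  have ha := hμ.a_pos
  refine ⟨ENNReal.ofReal (A / a), ENNReal.ofReal_lt_top, fun θ hθ u h0 hT i => ?_⟩
  by_cases hi : i = ∞
  · have h1 : outageWeight ℓ W m a u i = ∞ := by
      rw [outageWeight, hi, top_add, ENNReal.top_rpow_of_pos hμ.m_pos, ENNReal.mul_top]
      refine mul_ne_zero (by simpa using ha) ?_
      rw [Ne, ENNReal.rpow_eq_zero_iff]
      rintro (⟨h, -⟩ | ⟨h, -⟩)
      · exact h0 h
      · exact hT h
    rw [h1, ENNReal.mul_top (by simpa using div_pos hA ha)]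
    exact le_top
  · rw [outageWeight_eq_ofReal ha.le hμ.m_pos.le h0 hi, outageKernel_eq_cdf hθ h0 hT hi,
      ← ENNReal.ofReal_mul (by positivity), ← ENNReal.ofReal_mul (by positivity)]
    refine ENNReal.ofReal_le_ofReal ?_
    set x := ((i + ENNReal.ofReal W) / ℓ u).toReal
    have hx0 : 0 ≤ x := ENNReal.toReal_nonneg
    calc θ ^ (-m) * cdf μ (θ * x) ≤ θ ^ (-m) * (A * (θ * x) ^ m) := by
          gcongr
          exact hcdf _ (by positivity)
      _ = A / a * (a * x ^ m) := by
          rw [Real.mul_rpow hθ.le hx0, Real.rpow_neg hθ.le]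
          field_simp

end Kernel

section Outage

variable {P : Measure Config} [IsProbabilityMeasure P] {μ : Measure ℝ} [IsProbabilityMeasure μ]
  {ℓ : Plane → ℝ≥0∞} {α W m a lam : ℝ}

lemma measurable_tsum_nearest {H : Config → Plane → ℝ≥0∞}
    (hH : Measurable (Function.uncurry H)) :
    Measurable fun φ : Config => ∑' u : φ.nearest, H φ u := by
  simp only [tsum_nearest]
  exact measurable_tsum_points (Φ := fun φ : Config => φ) measurable_id (measurable_onNearest hH)

/-- As the nearest station is almost surely unique, breaking ties at random has no effect. -/
lemma successProb_eq (h : RegularLaw ℓ μ lam P) (hℓ : Measurable ℓ) (θ : ℝ) :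
    successProb ℓ μ W P θ = 1 - (outageProb ℓ μ W P θ).toReal ∧ outageProb ℓ μ W P θ ≤ 1 := by
  have hm := measurable_tsum_nearest (measurable_fadingExp (μ := μ) hℓ
    (measurable_outageKernel (μ := μ) hℓ W θ))
  have hone : ∀ᵐ φ ∂P, (∑' u : φ.nearest, fadingExp μ ℓ (outageKernel ℓ μ W θ) φ u) ≤ 1 := by
    filter_upwards [h.ae_nearest] with φ ⟨u, _, _, hs⟩
    rw [hs, tsum_singleton u fun u => fadingExp μ ℓ (outageKernel ℓ μ W θ) φ u,
      ← fadingLaw_sinr_le]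
    exact prob_le_one
  have hle : outageProb ℓ μ W P θ ≤ 1 := by
    refine (lintegral_mono_ae hone).trans ?_
    simp
  refine ⟨?_, hle⟩
  have hs : ∫⁻ φ, (∑' u : φ.nearest, fadingLaw μ {h | ENNReal.ofReal θ < sinr ℓ W φ u h}) /
      ((φ.nearest.encard : ℕ∞) : ℝ≥0∞) ∂P =
        ∫⁻ φ, 1 - ∑' u : φ.nearest, fadingExp μ ℓ (outageKernel ℓ μ W θ) φ u ∂P := by
    refine lintegral_congr_ae ?_
    filter_upwards [h.ae_nearest] with φ ⟨u, _, _, hs⟩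
    have hS : MeasurableSet {h : Plane → ℝ | sinr ℓ W φ u h ≤ ENNReal.ofReal θ} :=
      measurableSet_le (measurable_sinr ℓ W φ u) measurable_const
    rw [hs, tsum_singleton u fun u => fadingExp μ ℓ (outageKernel ℓ μ W θ) φ u,
      tsum_singleton u fun u => fadingLaw μ {h | ENNReal.ofReal θ < sinr ℓ W φ u h},
      encard_singleton, ← fadingLaw_sinr_le, ← prob_compl_eq_one_sub hS]
    simp only [ENat.toENNReal_one, div_one]
    congr 1
    ext h
    simp
  rw [successProb, hs, lintegral_sub hm (ne_top_of_le_ne_top ENNReal.one_ne_top hle) hone,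
    lintegral_one, measure_univ, ← outageProb, ENNReal.toReal_sub_of_le hle ENNReal.one_ne_top,
    ENNReal.toReal_one]

lemma outageProb_mono (ℓ : Plane → ℝ≥0∞) (μ : Measure ℝ) (W : ℝ) (P : Measure Config) :
    Monotone (outageProb ℓ μ W P) := by
  intro θ θ' hθ
  refine lintegral_mono fun φ => ENNReal.tsum_le_tsum fun u => lintegral_mono fun h => ?_
  refine measure_mono fun t ht => le_trans ?_ (ENNReal.ofReal_le_ofReal hθ)
  exact ht

/-- The outage probability behaves like `κ θ^m` as `θ → 0`. -/
lemma tendsto_outageProb (hlam : 0 < lam) (h : RegularLaw ℓ μ lam P) (hℓ : IsPathLoss α ℓ)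
    (hμ : FadingCondition μ m a) (hκ : kappa ℓ μ W m a lam P < ∞) :
    Tendsto (fun θ => ENNReal.ofReal (θ ^ (-m)) * outageProb ℓ μ W P θ) (𝓝[>] 0)
      (𝓝 (kappa ℓ μ W m a lam P)) := by
  obtain ⟨A, hA, hbound⟩ := exists_outageKernel_le hμ W ℓ
  rw [kappa_eq_lintegral hlam h hℓ] at hκ ⊢
  have hw := measurable_fadingExp (μ := μ) hℓ.measurable
    (measurable_outageWeight hℓ.measurable W m a)
  have hk : ∀ θ, Measurable (Function.uncurry (fadingExp μ ℓ (outageKernel ℓ μ W θ))) := fun θ =>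
    measurable_fadingExp (μ := μ) hℓ.measurable (measurable_outageKernel hℓ.measurable W θ)
  have hwm := measurable_tsum_nearest hw
  have hfin : ∀ᵐ φ ∂P, ∑' u : φ.nearest, fadingExp μ ℓ (outageWeight ℓ W m a) φ u < ∞ :=
    ae_lt_top hwm hκ.ne
  have hwi : ∀ (φ : Config) (u : Plane), Measurable fun h =>
      outageWeight ℓ W m a u (interference ℓ (φ.carrier \ {u}) h) := fun φ u =>
    ((measurable_outageWeight hℓ.measurable W m a).of_uncurry_left).comp
      (measurable_interference ℓ φ u)
  have hki : ∀ (θ : ℝ) (φ : Config) (u : Plane), Measurable fun h =>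
      outageKernel ℓ μ W θ u (interference ℓ (φ.carrier \ {u}) h) := fun θ φ u =>
    ((measurable_outageKernel hℓ.measurable W θ).of_uncurry_left).comp
      (measurable_interference ℓ φ u)
  -- Dominated convergence over the patterns here, and over the fading for a fixed pattern below.
  simp only [outageProb, ← lintegral_const_mul _ (measurable_tsum_nearest (hk _))]
  refine tendsto_lintegral_filter_of_dominated_convergence
    (fun φ => A * ∑' u : φ.nearest, fadingExp μ ℓ (outageWeight ℓ W m a) φ u) ?_ ?_ ?_ ?_
  · exact .of_forall fun θ => (measurable_tsum_nearest (hk θ)).const_mul _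
  · filter_upwards [self_mem_nhdsWithin] with θ hθ
    filter_upwards [h.ae_nearest] with φ ⟨u, hu, _, hs⟩
    rw [hs, tsum_singleton u fun u => fadingExp μ ℓ (outageKernel ℓ μ W θ) φ u,
      tsum_singleton u fun u => fadingExp μ ℓ (outageWeight ℓ W m a) φ u, fadingExp, fadingExp,
      ← lintegral_const_mul _ (hki θ φ u), ← lintegral_const_mul _ (hwi φ u)]
    exact lintegral_mono fun h' => hbound θ hθ u (hℓ.ne_zero u) (hℓ.ne_top u hu) _
  · rw [lintegral_const_mul _ hwm]
    exact (ENNReal.mul_lt_top hA hκ).ne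
  · filter_upwards [h.ae_nearest, hfin] with φ ⟨u, hu, _, hs⟩ hφ
    rw [hs, tsum_singleton u fun u => fadingExp μ ℓ (outageWeight ℓ W m a) φ u] at hφ ⊢
    have hks : ∀ θ, ∑' u : ({u} : Set Plane), fadingExp μ ℓ (outageKernel ℓ μ W θ) φ u =
        fadingExp μ ℓ (outageKernel ℓ μ W θ) φ u := fun θ =>
      tsum_singleton u fun u => fadingExp μ ℓ (outageKernel ℓ μ W θ) φ u
    simp only [hks]
    have h0 := hℓ.ne_zero u
    have hT := hℓ.ne_top u hu
    simp only [fadingExp] at hφ ⊢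
    simp only [← lintegral_const_mul _ (hki _ φ u)]
    refine tendsto_lintegral_filter_of_dominated_convergence
      (fun h' => A * outageWeight ℓ W m a u (interference ℓ (φ.carrier \ {u}) h')) ?_ ?_ ?_ ?_
    · exact .of_forall fun θ => (hki θ φ u).const_mul _
    · filter_upwards [self_mem_nhdsWithin] with θ hθ
      exact .of_forall fun h' => hbound θ hθ u h0 hT _
    · rw [lintegral_const_mul _ (hwi φ u)]
      exact (ENNReal.mul_lt_top hA hφ).ne
    · filter_upwards [ae_lt_top (hwi φ u) hφ.ne] with h' hh'
      refine tendsto_outageKernel hμ h0 hT fun hi => hh'.ne ?_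
      rw [outageWeight, hi, top_add, ENNReal.top_rpow_of_pos hμ.m_pos, ENNReal.mul_top]
      refine mul_ne_zero (by simpa using hμ.a_pos) ?_
      rw [Ne, ENNReal.rpow_eq_zero_iff]
      rintro (⟨h, -⟩ | ⟨h, -⟩)
      · exact h0 h
      · exact hT h

end Outage

/-! ### The asymptotic deployment gain -/

/-- The generalized inverse of a nondecreasing function that behaves like `κ θ^m` at zero. -/
lemma tendsto_sSup_div_rpow {O : ℝ → ℝ} (hO : Monotone O) {κ m : ℝ} (hκ : 0 < κ) (hm : 0 < m)
    (h : Tendsto (fun θ => θ ^ (-m) * O θ) (𝓝[>] 0) (𝓝 κ)) :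
    Tendsto (fun ε => sSup {θ | 0 < θ ∧ O θ ≤ ε} / ε ^ (1 / m)) (𝓝[>] 0)
      (𝓝 (κ ^ (-(1 / m)))) := by
  -- With `θ = c ε^(1/m)`, the ratio `O(θ) / ε` tends to `c^m κ`, which is below `1` for `c < L` and
  -- above `1` for `c > L`.
  set L := κ ^ (-(1 / m)) with hL
  have hL0 : 0 < L := Real.rpow_pos_of_pos hκ _
  have hLm : L ^ m * κ = 1 := by
    rw [hL, ← Real.rpow_mul hκ.le, neg_mul, one_div, inv_mul_cancel₀ hm.ne', Real.rpow_neg_one,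
      inv_mul_cancel₀ hκ.ne']
  have hscale : ∀ c : ℝ, 0 < c →
      Tendsto (fun ε : ℝ => O (c * ε ^ (1 / m)) / ε) (𝓝[>] 0) (𝓝 (c ^ m * κ)) := by
    intro c hc
    have hcomp : Tendsto (fun ε : ℝ => c * ε ^ (1 / m)) (𝓝[>] 0) (𝓝[>] 0) := by
      refine tendsto_nhdsWithin_iff.2 ⟨?_, ?_⟩
      · have : Tendsto (fun ε : ℝ => c * ε ^ (1 / m)) (𝓝 0) (𝓝 (c * 0 ^ (1 / m))) :=
          (Real.continuousAt_rpow_const 0 _ (.inr (by positivity))).const_mul c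
        rw [Real.zero_rpow (by positivity), mul_zero] at this
        exact this.mono_left nhdsWithin_le_nhds
      · filter_upwards [self_mem_nhdsWithin] with ε hε
        have hε : 0 < ε := hε
        exact mul_pos hc (by positivity)
    refine ((h.comp hcomp).const_mul (c ^ m)).congr' ?_
    filter_upwards [self_mem_nhdsWithin] with ε hε
    have hε : 0 < ε := hε
    have h1 : (ε ^ (1 / m)) ^ m = ε := by
      rw [← Real.rpow_mul hε.le, one_div, inv_mul_cancel₀ hm.ne', Real.rpow_one]
    rw [Function.comp_apply, Real.rpow_neg (by positivity), Real.mul_rpow hc.le (by positivity), h1]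
    field_simp
  have hup : ∀ c, L < c → ∀ᶠ ε in 𝓝[>] (0 : ℝ), ∀ θ, 0 < θ ∧ O θ ≤ ε → θ ≤ c * ε ^ (1 / m) := by
    intro c hc
    have hc0 : 0 < c := hL0.trans hc
    have h1 : 1 < c ^ m * κ := by
      rw [← hLm]
      gcongr
    filter_upwards [(hscale c hc0).eventually (lt_mem_nhds h1), self_mem_nhdsWithin]
      with ε h2 hε θ hθ
    have hε : 0 < ε := hε
    rw [one_lt_div hε] at h2
    by_contra hlt
    exact absurd (hO (not_le.1 hlt).le) (not_le.2 (hθ.2.trans_lt h2))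
  refine tendsto_order.2 ⟨fun b hb => ?_, fun b hb => ?_⟩
  · obtain ⟨c, hbc, hcL⟩ := exists_between (max_lt hb hL0)
    have hc0 : 0 < c := (le_max_right _ _).trans_lt hbc
    have h1 : c ^ m * κ < 1 := by
      rw [← hLm]
      gcongr
    filter_upwards [(hscale c hc0).eventually (gt_mem_nhds h1), self_mem_nhdsWithin,
      hup (L + 1) (by linarith)] with ε h2 hε hbd
    have hε : 0 < ε := hε
    rw [div_lt_one hε] at h2
    refine ((le_max_left _ _).trans_lt hbc).trans_le ?_
    rw [le_div_iff₀ (by positivity)]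
    exact le_csSup ⟨_, hbd⟩ ⟨by positivity, h2.le⟩
  · obtain ⟨c, hLc, hcb⟩ := exists_between hb
    filter_upwards [hup c hLc, self_mem_nhdsWithin] with ε hbd hε
    have hε : 0 < ε := hε
    refine lt_of_le_of_lt ?_ hcb
    rw [div_le_iff₀ (by positivity)]
    have hc0 : 0 < c := hL0.trans hLc
    exact Real.sSup_le hbd (by positivity)

section Gain

variable {P Q : Measure Config} [IsProbabilityMeasure P] [IsProbabilityMeasure Q]
  {μ : Measure ℝ} [IsProbabilityMeasure μ] {ℓ : Plane → ℝ≥0∞} {α W m a lam : ℝ}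

/-- The quantile `P_c⁻¹(p)` is asymptotically `((1 - p) / κ)^(1/m)` as `p → 1`. -/
lemma tendsto_successInv_div (hlam : 0 < lam) (h : RegularLaw ℓ μ lam P) (hℓ : IsPathLoss α ℓ)
    (hμ : FadingCondition μ m a) (hκ : kappa ℓ μ W m a lam P < ∞)
    (hκ0 : 0 < kappa ℓ μ W m a lam P) :
    Tendsto (fun p => successInv ℓ μ W P p / (1 - p) ^ (1 / m)) (𝓝[<] 1)
      (𝓝 ((kappa ℓ μ W m a lam P).toReal ^ (-(1 / m)))) := by
  set O : ℝ → ℝ := fun θ => (outageProb ℓ μ W P θ).toReal with hO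
  have hfin : ∀ θ, outageProb ℓ μ W P θ ≠ ∞ := fun θ =>
    ne_top_of_le_ne_top ENNReal.one_ne_top (successProb_eq (W := W) h hℓ.measurable θ).2
  have hmono : Monotone O := fun θ θ' hθ =>
    ENNReal.toReal_mono (hfin θ') (outageProb_mono ℓ μ W P hθ)
  have hlim : Tendsto (fun θ => θ ^ (-m) * O θ) (𝓝[>] 0)
      (𝓝 (kappa ℓ μ W m a lam P).toReal) := by
    refine ((ENNReal.tendsto_toReal hκ.ne).comp
      (tendsto_outageProb hlam h hℓ hμ hκ)).congr' ?_
    filter_upwards [self_mem_nhdsWithin] with θ hθ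
    have hθ : 0 < θ := hθ
    rw [Function.comp_apply, ENNReal.toReal_mul, ENNReal.toReal_ofReal (by positivity)]
  have hmain := tendsto_sSup_div_rpow hmono (ENNReal.toReal_pos hκ0.ne' hκ.ne) hμ.m_pos hlim
  have hcomp : Tendsto (fun p : ℝ => 1 - p) (𝓝[<] 1) (𝓝[>] 0) := by
    refine tendsto_nhdsWithin_iff.2 ⟨?_, ?_⟩
    · have : Tendsto (fun p : ℝ => 1 - p) (𝓝 1) (𝓝 (1 - 1)) := tendsto_const_nhds.sub tendsto_id
      rw [sub_self] at this
      exact this.mono_left nhdsWithin_le_nhds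
    · filter_upwards [self_mem_nhdsWithin] with p hp
      exact sub_pos.2 (mem_Iio.1 hp)
  refine (hmain.comp hcomp).congr fun p => ?_
  have hset : {θ | 0 < θ ∧ O θ ≤ 1 - p} = {θ | 0 < θ ∧ p ≤ successProb ℓ μ W P θ} := by
    ext θ
    rw [mem_ofPred_eq, mem_ofPred_eq, (successProb_eq (W := W) h hℓ.measurable θ).1]
    exact and_congr_right fun _ => ⟨fun h => by linarith, fun h => by linarith⟩
  rw [Function.comp_apply, successInv, hset]

lemma hasADG (hlam : 0 < lam) (hP : RegularLaw ℓ μ lam P) (hQ : RegularLaw ℓ μ lam Q)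
    (hα : 2 < α) (hℓ : IsPathLoss α ℓ) (hμ : FadingCondition μ m a) :
    HasADG ℓ μ W P Q
      (((kappa ℓ μ W m a lam Q).toReal / (kappa ℓ μ W m a lam P).toReal) ^ (1 / m)) := by
  have hκP := kappa_lt_top hlam hP hμ hα hℓ W
  have hκQ := kappa_lt_top hlam hQ hμ hα hℓ W
  have hκP0 := kappa_pos hlam hP hμ hℓ W
  have hκQ0 := kappa_pos hlam hQ hμ hℓ W
  have hp := ENNReal.toReal_pos hκP0.ne' hκP.ne
  have hq := ENNReal.toReal_pos hκQ0.ne' hκQ.ne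
  have h := (tendsto_successInv_div hlam hP hℓ hμ hκP hκP0).div
    (tendsto_successInv_div hlam hQ hℓ hμ hκQ hκQ0) (Real.rpow_pos_of_pos hq _).ne'
  have hlim : (kappa ℓ μ W m a lam P).toReal ^ (-(1 / m)) /
      (kappa ℓ μ W m a lam Q).toReal ^ (-(1 / m)) =
        ((kappa ℓ μ W m a lam Q).toReal / (kappa ℓ μ W m a lam P).toReal) ^ (1 / m) := by
    rw [Real.rpow_neg hp.le, Real.rpow_neg hq.le, Real.div_rpow hq.le hp.le, inv_div_inv]
  rw [hlim] at h
  refine h.congr' ?_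
  filter_upwards [self_mem_nhdsWithin] with p hp1
  have hp1 : 0 < 1 - p := sub_pos.2 hp1
  rw [deploymentGain]
  exact div_div_div_cancel_right₀ (Real.rpow_pos_of_pos hp1 _).ne' _ _

end Gain

/-! ### Nakagami fading -/

lemma cdf_gammaMeasure_eq {m t : ℝ} (hm : 0 < m) (ht : 0 ≤ t) :
    cdf (gammaMeasure m m) t = m ^ m / Real.Gamma m *
      ∫ x in (0 : ℝ)..t, x ^ (m - 1) * Real.exp (-(m * x)) := by
  rw [cdf_gammaMeasure_eq_integral hm hm,
    setIntegral_eq_of_subset_of_forall_sdiff_eq_zero measurableSet_Iic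
      (Icc_subset_Iic_self (a := 0)),
    integral_Icc_eq_integral_Ioc, ← intervalIntegral.integral_of_le ht,
    ← intervalIntegral.integral_const_mul]
  · refine intervalIntegral.integral_congr fun x hx => ?_
    rw [uIcc_of_le ht] at hx
    simp only [gammaPDFReal, if_pos hx.1, mul_assoc]
  · rintro x ⟨hx, hx'⟩
    have : ¬ 0 ≤ x := fun h => hx' ⟨h, hx⟩
    simp [gammaPDFReal, this]

/-- On `[0, t]` the exponential factor of the gamma density is between `exp (-(m t))` and `1`. -/
lemma cdf_gammaMeasure_bounds {m t : ℝ} (hm : 0 < m) (ht : 0 ≤ t) :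
    Real.exp (-(m * t)) * (m ^ (m - 1) / Real.Gamma m * t ^ m) ≤ cdf (gammaMeasure m m) t ∧
      cdf (gammaMeasure m m) t ≤ m ^ (m - 1) / Real.Gamma m * t ^ m := by
  have hc : 0 ≤ m ^ m / Real.Gamma m := div_nonneg (by positivity) (Real.Gamma_pos_of_pos hm).le
  have hi : IntervalIntegrable (fun x : ℝ => x ^ (m - 1)) volume 0 t :=
    intervalIntegral.intervalIntegrable_rpow' (by linarith)
  have hint : ∫ x in (0 : ℝ)..t, x ^ (m - 1) = t ^ m / m := by
    rw [integral_rpow (.inl (by linarith)), sub_add_cancel, Real.zero_rpow hm.ne', sub_zero]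
  have hcm : m ^ (m - 1) / Real.Gamma m * t ^ m = m ^ m / Real.Gamma m * (t ^ m / m) := by
    rw [Real.rpow_sub_one hm.ne']
    ring
  have hi2 : IntervalIntegrable (fun x : ℝ => x ^ (m - 1) * Real.exp (-(m * x))) volume 0 t :=
    hi.mul_continuousOn (by fun_prop)
  rw [cdf_gammaMeasure_eq hm ht, hcm, ← hint]
  constructor
  · rw [mul_left_comm, ← intervalIntegral.integral_const_mul]
    refine mul_le_mul_of_nonneg_left (intervalIntegral.integral_mono_on ht (hi.const_mul _) hi2
      fun x hx => ?_) hc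
    rw [mul_comm]
    have := hx.1
    gcongr
    exact hx.2
  · refine mul_le_mul_of_nonneg_left (intervalIntegral.integral_mono_on ht hi2 hi
      fun x hx => ?_) hc
    have := hx.1
    refine mul_le_of_le_one_right (by positivity) (Real.exp_le_one_iff.2 ?_)
    have : 0 ≤ m * x := by positivity
    linarith

/-- Nakagami fading satisfies the assumptions on the fading. -/
lemma fadingCondition_gammaMeasure {m : ℝ} (hm : 0 < m) :
    FadingCondition (gammaMeasure m m) m (m ^ (m - 1) / Real.Gamma m) where
  nonneg := by
    rw [ae_iff]
    have : {t : ℝ | ¬ 0 ≤ t} = Iio 0 := by ext; simp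
    rw [this, gammaMeasure, withDensity_apply _ measurableSet_Iio,
      lintegral_gammaPDF_of_nonpos le_rfl]
  m_pos := hm
  a_pos := div_pos (by positivity) (Real.Gamma_pos_of_pos hm)
  near_zero := by
    have ha : 0 < m ^ (m - 1) / Real.Gamma m := div_pos (by positivity) (Real.Gamma_pos_of_pos hm)
    refine (Asymptotics.isEquivalent_iff_tendsto_one ?_).2 ?_
    · filter_upwards [self_mem_nhdsWithin] with t ht
      have : 0 < t := ht
      positivity
    · have h1 : Tendsto (fun t : ℝ => Real.exp (-(m * t))) (𝓝[>] 0) (𝓝 1) := by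
        have : Tendsto (fun t : ℝ => Real.exp (-(m * t))) (𝓝 0) (𝓝 (Real.exp (-(m * 0)))) :=
          Continuous.tendsto (by fun_prop) 0
        rw [mul_zero, neg_zero, Real.exp_zero] at this
        exact this.mono_left nhdsWithin_le_nhds
      refine tendsto_of_tendsto_of_tendsto_of_le_of_le' h1 tendsto_const_nhds ?_ ?_
      · filter_upwards [self_mem_nhdsWithin] with t ht
        have ht : 0 < t := ht
        rw [Pi.div_apply, le_div_iff₀ (by positivity)]
        exact (cdf_gammaMeasure_bounds hm ht.le).1
      · filter_upwards [self_mem_nhdsWithin] with t ht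
        have ht : 0 < t := ht
        rw [Pi.div_apply, div_le_one (by positivity)]
        exact (cdf_gammaMeasure_bounds hm ht.le).2
  moments n := by
    have hmeas : Measurable (gammaPDF m m) := (measurable_gammaPDFReal m m).ennreal_ofReal
    rw [gammaMeasure, integrable_withDensity_iff hmeas (.of_forall fun _ => ENNReal.ofReal_lt_top)]
    have hsupp : Function.support (fun x : ℝ => x ^ n * (gammaPDF m m x).toReal) ⊆ Ici 0 := by
      intro x hx
      by_contra h
      exact hx (by simp [gammaPDF_of_neg (not_le.1 h)])
    rw [← integrableOn_iff_integrable_of_support_subset hsupp,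
      integrableOn_Ici_iff_integrableOn_Ioi]
    have hn : (0 : ℝ) ≤ n := Nat.cast_nonneg n
    have hint : IntegrableOn (fun x : ℝ => m ^ m / Real.Gamma m *
        (x ^ (m - 1 + n) * Real.exp (-m * x ^ (1 : ℝ)))) (Ioi 0) :=
      (integrableOn_rpow_mul_exp_neg_mul_rpow (by linarith) one_pos hm).const_mul _
    refine hint.congr_fun (fun x hx => ?_) measurableSet_Ioi
    have hx : 0 < x := hx
    have hG := Real.Gamma_pos_of_pos hm
    simp only [gammaPDF_of_nonneg hx.le]
    rw [ENNReal.toReal_ofReal (by positivity), Real.rpow_add hx,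
      Real.rpow_natCast, Real.rpow_one, neg_mul]
    ring

end CellularNetwork

end

open CellularNetwork in
theorem mainTheorem2 (α : ℝ) (hα : 2 < α) (ℓ : Plane → ℝ≥0∞)
    (hℓ : ℓ = pathLossNonsingular α ∨ ℓ = pathLossSingular α)
    (W : ℝ) (hW : 0 ≤ W) (lam : ℝ) (hlam : 0 < lam)
    (Q : Measure Config) [IsProbabilityMeasure Q] (hQ : IsPoissonProcess Q lam) :
    (∀ (m a : ℝ) (μ : Measure ℝ) [IsProbabilityMeasure μ], FadingCondition μ m a →
      (0 < kappa ℓ μ W m a lam Q ∧ kappa ℓ μ W m a lam Q < ∞ ∧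
        kappa ℓ μ W m a lam Q = kappaPoissonIntegral ℓ μ W m a lam Q) ∧
      ∀ (P : Measure Config) [IsProbabilityMeasure P], ClassA ℓ μ lam P →
        0 < kappa ℓ μ W m a lam P ∧ kappa ℓ μ W m a lam P < ∞ ∧
        HasADG ℓ μ W P Q
          (((kappa ℓ μ W m a lam Q).toReal / (kappa ℓ μ W m a lam P).toReal) ^ (1 / m))) ∧
    (∀ m : ℝ, 0 < m →
      FadingCondition (gammaMeasure m m) m (m ^ (m - 1) / Real.Gamma m) ∧
      kappa ℓ (gammaMeasure m m) W m (m ^ (m - 1) / Real.Gamma m) lam Q =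
        kappaPoissonIntegral ℓ (gammaMeasure m m) W m (m ^ (m - 1) / Real.Gamma m) lam Q) := by
  have hpl : IsPathLoss α ℓ := by
    rcases hℓ with rfl | rfl
    · exact isPathLoss_nonsingular (by linarith)
    · exact isPathLoss_singular (by linarith)
  refine ⟨fun m a μ _ hμ => ?_, fun m hm => ⟨fadingCondition_gammaMeasure hm, ?_⟩⟩
  · have hQr : RegularLaw ℓ μ lam Q := hQ.regularLaw hlam hpl.measurable
    refine ⟨⟨kappa_pos hlam hQr hμ hpl W, kappa_lt_top hlam hQr hμ hα hpl W,
      hQ.kappa_eq_kappaPoissonIntegral hlam hpl.measurable W m a⟩, fun P _ hP => ?_⟩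
    have hPr := hP.regularLaw
    exact ⟨kappa_pos hlam hPr hμ hpl W, kappa_lt_top hlam hPr hμ hα hpl W,
      hasADG hlam hPr hQr hα hpl hμ⟩
  · have := isProbabilityMeasure_gammaMeasure hm hm
    exact hQ.kappa_eq_kappaPoissonIntegral hlam hpl.measurable W m _
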